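/- Let $G$ be a finite simple $3$-connected cubic planar graph, and let $\rho$ be the rotation system of an embedding of $G$ on the sphere (with no twisted edges). The dual graph $G^{\ast}$ has the faces of this embedding as vertices, two distinct faces being adjacent if they share an edge of $G$. Embeddings of $G$ on closed surfaces are cellular and are given by a rotation system together with a signature $\lambda\colon E(G)\to\{1,-1\}$ (the edges of sign $-1$ are called twisted). The facial walks are those produced by the face traversal algorithm, and the surface is determined by its Euler characteristic and its orientability. An embedding is strong if each of its facial walks is a cycle. Two strong embeddings of $G$ are isomorphic if some automorphism of $G$ maps the set of facial cycles of the first onto the set of facial cycles of the second. For a subgraph $H$ of $G^{\ast}$, the embedding of $G$ defined by $H$ has rotation system $\rho$, and its twisted edges are exactly the edges of $G$ whose dual edges belong to $H$. The group $\mathrm{Aut}(G^{\ast})$ acts on the subgraphs of $G^{\ast}$. Let $A_3$ be the disjoint union of two copies of $K_4$, let $A_5$ be the union of two copies of $K_4$ sharing exactly one vertex, and let $A_6$ be the graph obtained from two copies of $K_4$ sharing exactly one edge (and its two end vertices) by removing this edge. Then there is a one-to-one correspondence between the isomorphism classes of strong embeddings of $G$ on 1. the projective plane and the $\mathrm{Aut}(G^{\ast})$-orbits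 of subgraphs of $G^{\ast}$ that are isomorphic to $K_4$; 2. the torus and the $\mathrm{Aut}(G^{\ast})$-orbits of subgraphs of $G^{\ast}$ that are isomorphic to $K_{2,2,2}$, or to $K_{2,2m}$ for some $m\ge 1$ such that the two vertices of each partition set of size two (hence of both partition sets if $m=1$) are not adjacent in $G^{\ast}$; 3. the Klein bottle and the $\mathrm{Aut}(G^{\ast})$-orbits of subgraphs of $G^{\ast}$ that are isomorphic to $A_3$, $A_5$ or $A_6$, or to $K_{2,2m-1}$ for some $m\ge 2$ such that the two vertices of the partition set of size two are not adjacent in $G^{\ast}$. In each case, every subgraph $H$ of the listed kind defines a strong embedding of $G$ on the surface in question, and the correspondence sends the orbit of $H$ to the isomorphism class of the embedding defined by $H$. -/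

import Mathlib

universe u

namespace StrongEmb

variable {V : Type u}

/-- `G` is 3-connected: it has more than three vertices and deleting at most two vertices leaves
a connected graph. -/
def ThreeConnected (G : SimpleGraph V) : Prop :=
  3 < Nat.card V ∧ ∀ S : Finset V, S.card < 3 → (G.induce ((S : Set V)ᶜ)).Connected

/-- A rotation system of `G`: a permutation of the darts (oriented edges) of `G` whose restriction
to the darts leaving a vertex `v` is, for every `v`, a single cyclic permutation of these darts. -/
structure RotationSystem (G : SimpleGraph V) where
  perm : Equiv.Perm G.Dart
  fst_perm : ∀ d, (perm d).fst = d.fst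
  sameCycle : ∀ d d' : G.Dart, d.fst = d'.fst → perm.SameCycle d d'

/-- A (cellular) embedding of `G` on a closed surface, given by a rotation system and a signature;
the edges of sign `-1` are the twisted edges. -/
structure Embedding (G : SimpleGraph V) where
  rot : RotationSystem G
  sign : G.edgeSet → ℤˣ

namespace Embedding

variable {G : SimpleGraph V} (E : Embedding G)

/-- Move along the dart to its other end; the local orientation is reversed exactly if the edge is
twisted. -/
def cross : Equiv.Perm (G.Dart × ℤˣ) where
  toFun x := (x.1.symm, x.2 * E.sign ⟨x.1.edge, x.1.edge_mem⟩)
  invFun x := (x.1.symm, x.2 * E.sign ⟨x.1.edge, x.1.edge_mem⟩)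
  left_inv x := by
    refine Prod.ext (by simp) ?_
    simp [SimpleGraph.Dart.edge_symm, mul_assoc, Int.units_mul_self]
  right_inv x := by
    refine Prod.ext (by simp) ?_
    simp [SimpleGraph.Dart.edge_symm, mul_assoc, Int.units_mul_self]

/-- Turn to the next dart at the same vertex, clockwise or anticlockwise according to the local
orientation. -/
def turn : Equiv.Perm (G.Dart × ℤˣ) where
  toFun x := ((E.rot.perm ^ (x.2 : ℤ)) x.1, x.2)
  invFun x := ((E.rot.perm ^ (x.2 : ℤ))⁻¹ x.1, x.2)
  left_inv x := by simp
  right_inv x := by simp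

/-- One step of the face traversal algorithm. A state `(d, s)` says that the walk is about to
traverse the dart `d`, with current local orientation `s`. The facial walks are the cycles
of this permutation. -/
def next : Equiv.Perm (G.Dart × ℤˣ) := E.cross.trans E.turn

/-- The state of the same facial walk that traverses the same edge in the opposite direction. -/
def rev (x : G.Dart × ℤˣ) : G.Dart × ℤˣ := ((E.cross x).1, -(E.cross x).2)

/-- The cells of the embedding: facial walks up to choice of starting point and direction. -/
def Face : Type u := Quot fun x y : G.Dart × ℤˣ => y = E.next x ∨ y = E.rev x

/-- The cell whose boundary is traversed from the state `x`. -/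
def face (x : G.Dart × ℤˣ) : E.Face := Quot.mk _ x

/-- Euler characteristic of the surface of the embedding. -/
noncomputable def eulerChar : ℤ :=
  (Nat.card V : ℤ) - (Nat.card G.edgeSet : ℤ) + (Nat.card E.Face : ℤ)

/-- The surface is orientable: local orientations at the vertices can be chosen such that exactly
the twisted edges join differently oriented vertices (equivalently, every cycle of `G` has an even
number of twisted edges). -/
def Orientable : Prop :=
  ∃ ε : V → ℤˣ, ∀ d : G.Dart, E.sign ⟨d.edge, d.edge_mem⟩ = ε d.fst * ε d.snd

/-! The surfaces are identified, for connected `G`, by the classification of closed surfaces. -/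

def OnSphere : Prop := E.Orientable ∧ E.eulerChar = 2

def OnProjectivePlane : Prop := ¬ E.Orientable ∧ E.eulerChar = 1

def OnTorus : Prop := E.Orientable ∧ E.eulerChar = 0

def OnKleinBottle : Prop := ¬ E.Orientable ∧ E.eulerChar = 0

/-- The embedding is strong: no facial walk meets a vertex twice, i.e. every facial walk
is a cycle. -/
def IsStrong : Prop :=
  ∀ x y : G.Dart × ℤˣ, E.next.SameCycle x y → x.1.fst = y.1.fst → x = y

/-- The edge set of the facial walk through the state `x`. -/
def walkEdges (x : G.Dart × ℤˣ) : Set (Sym2 V) :=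
  {e | ∃ y, E.next.SameCycle x y ∧ y.1.edge = e}

/-- The set of facial cycles of a strong embedding, each cycle of `G` being given by its
edge set. -/
def facialCycles : Set (Set (Sym2 V)) := Set.range E.walkEdges

/-- Two strong embeddings are isomorphic if some automorphism of `G` maps the set of
facial cycles of the first one onto that of the second one. -/
def Isomorphic (E E' : Embedding G) : Prop :=
  ∃ φ : G ≃g G, (fun C => Sym2.map φ '' C) '' E.facialCycles = E'.facialCycles

theorem Isomorphic.refl (E : Embedding G) : Isomorphic E E :=
  ⟨SimpleGraph.Iso.refl, by
    have h : ∀ C : Set (Sym2 V),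
        Sym2.map (SimpleGraph.Iso.refl : G ≃g G) '' C = C := fun C => by
      have : (Sym2.map (SimpleGraph.Iso.refl : G ≃g G) : Sym2 V → Sym2 V) = id := Sym2.map_id
      rw [this, Set.image_id]
    simp only [h, Set.image_id']⟩

theorem Isomorphic.symm {E E' : Embedding G} : Isomorphic E E' → Isomorphic E' E := by
  rintro ⟨φ, h⟩
  refine ⟨φ.symm, ?_⟩
  rw [← h, Set.image_image]
  have h' : ∀ C : Set (Sym2 V), Sym2.map φ.symm '' (Sym2.map φ '' C) = C := fun C => by
    rw [Set.image_image]
    simp only [Sym2.map_map]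
    simp
  simp only [h', Set.image_id']

theorem Isomorphic.trans {E E' E'' : Embedding G} :
    Isomorphic E E' → Isomorphic E' E'' → Isomorphic E E'' := by
  rintro ⟨φ, h⟩ ⟨ψ, h'⟩
  refine ⟨φ.trans ψ, ?_⟩
  rw [← h', ← h, Set.image_image]
  congr 1
  ext1 C
  rw [Set.image_image]
  simp only [Sym2.map_map]
  rfl

end Embedding

variable {G : SimpleGraph V}

/-- The strong embeddings of `G` on the surface singled out by `S`. -/
abbrev StrongOn (S : Embedding G → Prop) : Type u := {E : Embedding G // E.IsStrong ∧ S E}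

/-- Isomorphism as an equivalence relation on the strong embeddings on a given surface. -/
def isoSetoid (S : Embedding G → Prop) : Setoid (StrongOn S) where
  r E E' := E.1.Isomorphic E'.1
  iseqv := ⟨fun E => .refl E.1, .symm, .trans⟩

/-- The isomorphism classes of strong embeddings of `G` on the surface singled out by `S`. -/
abbrev IsoClass (S : Embedding G → Prop) : Type u := Quotient (isoSetoid S)

/-- Two subgraphs of `D` are related if some automorphism of `D` maps one onto the other. -/
def orbitSetoid {W : Type u} {D : SimpleGraph W} (F : Set D.Subgraph) : Setoid F where
  r H H' := ∃ φ : D ≃g D, H.1.map φ.toHom = H'.1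
  iseqv := by
    refine ⟨fun H => ⟨SimpleGraph.Iso.refl, H.1.map_id⟩, ?_, ?_⟩
    · rintro H H' ⟨φ, h⟩
      refine ⟨φ.symm, ?_⟩
      rw [← h, ← SimpleGraph.Subgraph.map_comp]
      have : φ.symm.toHom.comp φ.toHom = SimpleGraph.Hom.id := by
        ext v
        exact φ.symm_apply_apply v
      rw [this, SimpleGraph.Subgraph.map_id]
    · rintro H H' H'' ⟨φ, h⟩ ⟨ψ, h'⟩
      refine ⟨φ.trans ψ, ?_⟩
      rw [← h', ← h, ← SimpleGraph.Subgraph.map_comp]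
      rfl

/-- The orbits of the automorphism group of `D` on the subgraphs of `D` belonging to the
(automorphism-invariant) family `F`. -/
abbrev Orbit {W : Type u} {D : SimpleGraph W} (F : Set D.Subgraph) : Type u :=
  Quotient (orbitSetoid F)

namespace RotationSystem

variable (ρ : RotationSystem G)

/-- The embedding with rotation system `ρ` and no twisted edge. -/
def untwisted : Embedding G := ⟨ρ, fun _ => 1⟩

/-- `ρ` is the rotation system of an embedding of `G` on the sphere. -/
def IsPlanar : Prop := ρ.untwisted.OnSphere

/-- The dual graph of `G` with respect to the embedding given by `ρ`: its vertices are the faces,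
two distinct faces being adjacent if they are the two sides of a common edge. -/
def dual : SimpleGraph ρ.untwisted.Face where
  Adj f g := f ≠ g ∧ ∃ (d : G.Dart) (s : ℤˣ),
    ρ.untwisted.face (d, s) = f ∧ ρ.untwisted.face (d, -s) = g
  symm := ⟨by
    rintro f g ⟨hne, d, s, hf, hg⟩
    exact ⟨hne.symm, d, -s, hg, by rwa [neg_neg]⟩⟩
  loopless := ⟨fun _ h => h.1 rfl⟩

open Classical in
/-- The embedding of `G` defined by the twisted subgraph `H` of the dual graph: same rotation
system, and an edge of `G` is twisted if and only if its dual edge belongs to `H`. -/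
noncomputable def twist (H : ρ.dual.Subgraph) : Embedding G where
  rot := ρ
  sign e := if ∃ d : G.Dart, d.edge = e.1 ∧
    H.Adj (ρ.untwisted.face (d, 1)) (ρ.untwisted.face (d, -1)) then -1 else 1

/-- Every member `H` of the family `F` of subgraphs of the dual graph defines, as a twisted
subgraph, a strong embedding of `G` on the surface `S`, and `H ↦ twist H` induces a bijection from
the orbits of the automorphism group of the dual graph on `F` onto the isomorphism classes of strong
embeddings of `G` on `S`. -/
def Correspondence (F : Set ρ.dual.Subgraph) (S : Embedding G → Prop) : Prop :=
  ∃ h : ∀ H : F, (ρ.twist H.1).IsStrong ∧ S (ρ.twist H.1),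
    ∃ Φ : Orbit F ≃ IsoClass S,
      ∀ H : F, Φ (Quotient.mk (orbitSetoid F) H) =
        Quotient.mk (isoSetoid S) ⟨ρ.twist H.1, h H⟩

end RotationSystem

/-- Two copies of `K₄` sharing exactly one vertex. -/
def graphA5 : SimpleGraph (Fin 7) := SimpleGraph.fromEdgeSet
  {s(0, 1), s(0, 2), s(0, 3), s(1, 2), s(1, 3), s(2, 3),
   s(3, 4), s(3, 5), s(3, 6), s(4, 5), s(4, 6), s(5, 6)}

/-- Two copies of `K₄` sharing exactly one edge, with this edge (here `{2, 3}`) removed. -/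
def graphA6 : SimpleGraph (Fin 6) := SimpleGraph.fromEdgeSet
  {s(0, 1), s(0, 2), s(0, 3), s(1, 2), s(1, 3),
   s(2, 4), s(2, 5), s(3, 4), s(3, 5), s(4, 5)}

/-- Two disjoint copies of `K₄`. -/
def graphA3 : SimpleGraph (Fin 4 ⊕ Fin 4) :=
  (⊤ : SimpleGraph (Fin 4)).sum (⊤ : SimpleGraph (Fin 4))

section Families

variable {W : Type u} (D : SimpleGraph W)

/-- The subgraphs of `D` isomorphic to `K`. -/
def copies {U : Type} (K : SimpleGraph U) : Set D.Subgraph := {H | Nonempty (H.coe ≃g K)}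

/-- The subgraphs of `D` isomorphic to `K_{2,n}` such that the two vertices of any partition set of
size two (for `n = 2`, of both partition sets) are not adjacent in `D`. -/
def copiesK2 (n : ℕ) : Set D.Subgraph :=
  {H | ∃ f : H.coe ≃g completeBipartiteGraph (Fin 2) (Fin n),
    (∀ i j : Fin 2, ¬ D.Adj (f.symm (Sum.inl i)) (f.symm (Sum.inl j))) ∧
    (n = 2 → ∀ i j : Fin n, ¬ D.Adj (f.symm (Sum.inr i)) (f.symm (Sum.inr j)))}

def projectiveFamily : Set D.Subgraph := copies D (⊤ : SimpleGraph (Fin 4))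

def torusFamily : Set D.Subgraph :=
  copies D (SimpleGraph.completeMultipartiteGraph fun _ : Fin 3 => Fin 2) ∪
    {H | ∃ m : ℕ, 1 ≤ m ∧ H ∈ copiesK2 D (2 * m)}

def kleinFamily : Set D.Subgraph :=
  copies D graphA3 ∪ copies D graphA5 ∪ copies D graphA6 ∪
    {H | ∃ m : ℕ, 2 ≤ m ∧ H ∈ copiesK2 D (2 * m - 1)}

end Families

end StrongEmb

/-! In a cubic graph the two cyclic orders of the edges at a vertex are inverse to each other.
Reversing local orientations therefore turns every embedding into one with the planar rotation
system `ρ` and some signature `l`, without changing its cells (`exists_transports`). Such an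
embedding is encoded by the subgraph `T` of the dual graph formed by the duals of the twisted edges,
and its properties are read off the Laplacian `L` of `T` over the field with two elements. Functions
on the cells correspond to compatible pairs of potentials on the faces and vertices of the plane
graph, so the Euler genus is the rank of `L` (`eulerChar_signed`). Orientability means that `L` has
zero diagonal (`orientable_signed`), and strength means that no `e_f + e_g` with `f`, `g` adjacent
faces lies in the range of `L` (`isStrong_signed`). Planarity enters through duality: even edge sets
of the graph are cuts of the dual graph and conversely (`exists_face_potential`,
`exists_vertex_potential`).

A symmetric matrix of rank one or two over this field has the form `xxᵀ`, `xyᵀ + yxᵀ` or `xxᵀ +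
yyᵀ`. So the faces carry labels in the plane over the field, `L` is a bilinear form in the labels,
and `T` is determined by the sizes of the three nonzero label classes. The rows of `L` sum to zero,
which gives parities. The dual graph contains neither `K₅` nor `K₃,₃` (`card_clique_le`,
`card_bipartite_lt`), which gives upper bounds. Strength forbids a linear functional of the labels
to single out two adjacent faces. The sizes that survive are those of the listed graphs
(`exists_projective`, `torus_counts`, `klein_counts`), and the non-adjacency conditions on `K_{2,n}`
are what is left of strength.

For the isomorphism classes: the facial cycles of a strong embedding with rotation `ρ` determine its
signature (`sgn_eq_of_facialCycles_eq`). Automorphisms of the graph act on the faces, since its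
embedding on the sphere is unique (`exists_transports_untwisted`). Every automorphism of the dual
graph arises in this way, since the triangles of the dual graph around a vertex are its
nonseparating triangles (`exists_iso_of_dual`). -/

namespace StrongEmb

open SimpleGraph

/-! ### Connectivity -/

section Connectivity

variable {V : Type u} {G : SimpleGraph V}

/-- The form in which connectivity is used throughout: with `S` empty for potentials, with one
vertex for nonseparating triangles, and with two vertices for small cuts. -/
theorem ThreeConnected.propagate (h3 : ThreeConnected G) {S : Finset V} (hS : S.card < 3)
    {p : V → Prop} (hp : ∀ u v, G.Adj u v → u ∉ S → v ∉ S → p u → p v)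
    {u v : V} (hu : u ∉ S) (hv : v ∉ S) (h : p u) : p v := by
  obtain ⟨w⟩ := (h3.2 S hS).preconnected ⟨u, by simpa using hu⟩ ⟨v, by simpa using hv⟩
  have key : ∀ (a b : ((S : Set V)ᶜ : Set V)), (G.induce ((S : Set V)ᶜ)).Walk a b →
      p a → p b := by
    intro a b w
    induction w with
    | nil => exact id
    | cons hab _ ih =>
      rename_i a b c _
      intro ha
      exact ih (hp _ _ hab (fun h => a.2 h) (fun h => b.2 h) ha)
  exact key _ _ w h

theorem ThreeConnected.eq_of_adj (h3 : ThreeConnected G) {α : Type*} {ε : V → α}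
    (hε : ∀ u v, G.Adj u v → ε u = ε v) (u v : V) : ε u = ε v :=
  h3.propagate (S := ∅) (p := fun w => ε u = ε w) (by simp)
    (fun a b hab _ _ h => h.trans (hε a b hab)) (by simp) (by simp) rfl

theorem ThreeConnected.eq_of_dart (h3 : ThreeConnected G) {α : Type*} {ε : V → α}
    (hε : ∀ d : G.Dart, ε d.fst = ε d.snd) (u v : V) : ε u = ε v :=
  h3.eq_of_adj (fun a b h => hε ⟨(a, b), h⟩) u v

theorem ThreeConnected.nonempty (h3 : ThreeConnected G) : Nonempty V := by
  by_contra h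
  rw [not_nonempty_iff] at h
  have := h3.1
  simp at this

end Connectivity

theorem RotationSystem.zpow_fst {V : Type u} {G : SimpleGraph V} (ρ : RotationSystem G) (k : ℤ) (d : G.Dart) : ((ρ.perm ^ k) d).fst = d.fst := by
  have hn : ∀ (n : ℕ) (d : G.Dart), ((ρ.perm ^ n) d).fst = d.fst := by
    intro n
    induction n with
    | zero => simp
    | succ n ih => intro d; rw [pow_succ', Equiv.Perm.mul_apply, ρ.fst_perm, ih]
  rcases k with n | n
  · simpa using hn n d
  · have := hn (n + 1) ((ρ.perm ^ (n + 1))⁻¹ d)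
    simpa using this.symm

/-! ### Rotations at the vertices of a cubic graph -/

section Rotation

variable {V : Type u} [Fintype V] {G : SimpleGraph V} [DecidableRel G.Adj]

open scoped Classical in
theorem card_dart_fst (hc : G.IsRegularOfDegree 3) (v : V) :
    (Finset.univ.filter fun d : G.Dart => d.fst = v).card = 3 := by
  rw [← hc v, ← G.dart_fst_fiber_card_eq_degree v]

theorem exists_dart_fst (hc : G.IsRegularOfDegree 3) (v : V) : ∃ d : G.Dart, d.fst = v := by
  classical
  have : (Finset.univ.filter fun d : G.Dart => d.fst = v).Nonempty := by
    rw [← Finset.card_pos, card_dart_fst hc]; norm_num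
  obtain ⟨d, hd⟩ := this
  exact ⟨d, by simpa using hd⟩

namespace RotationSystem

variable (ρ : RotationSystem G)

theorem exists_pow (d d' : G.Dart) (h : d.fst = d'.fst) : ∃ k : ℕ, (ρ.perm ^ k) d = d' := by
  obtain ⟨k, -, hk⟩ := (ρ.sameCycle d d' h).exists_pow_eq'
  exact ⟨k, hk⟩

theorem perm_ne (hc : G.IsRegularOfDegree 3) (d : G.Dart) : ρ.perm d ≠ d := by
  classical
  intro h
  have hsub : (Finset.univ.filter fun d' : G.Dart => d'.fst = d.fst) ⊆ {d} := by
    intro d' hd'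
    obtain ⟨k, rfl⟩ := ρ.exists_pow d d' (by simpa using (Finset.mem_filter.1 hd').2.symm)
    have : (ρ.perm ^ k) d = d := by
      induction k with
      | zero => rfl
      | succ k ih =>
        rw [pow_succ, Equiv.Perm.mul_apply, h]
        exact ih (by
          simp only [Finset.mem_filter, Finset.mem_univ, true_and] at hd' ⊢
          rwa [pow_succ, Equiv.Perm.mul_apply, h] at hd')
    simp [this]
  have := Finset.card_le_card hsub
  rw [card_dart_fst hc] at this
  simp at this

theorem perm_perm_ne (hc : G.IsRegularOfDegree 3) (d : G.Dart) : ρ.perm (ρ.perm d) ≠ d := by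
  classical
  intro h
  have hsub : (Finset.univ.filter fun d' : G.Dart => d'.fst = d.fst) ⊆ {d, ρ.perm d} := by
    intro d' hd'
    obtain ⟨k, rfl⟩ := ρ.exists_pow d d' (by simpa using (Finset.mem_filter.1 hd').2.symm)
    clear hd'
    induction k with
    | zero => simp
    | succ k ih =>
      rw [pow_succ', Equiv.Perm.mul_apply]
      simp only [Finset.mem_insert, Finset.mem_singleton] at ih ⊢
      rcases ih with ih | ih <;> rw [ih] <;> simp [h]
  have := (Finset.card_le_card hsub).trans Finset.card_le_two
  rw [card_dart_fst hc] at this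
  norm_num at this

theorem eq_or_of_fst (hc : G.IsRegularOfDegree 3) {d d' : G.Dart} (h : d'.fst = d.fst) :
    d' = d ∨ d' = ρ.perm d ∨ d' = ρ.perm (ρ.perm d) := by
  classical
  have hsub : ({d, ρ.perm d, ρ.perm (ρ.perm d)} : Finset G.Dart) ⊆
      (Finset.univ.filter fun d' : G.Dart => d'.fst = d.fst) := by
    intro x hx
    simp only [Finset.mem_insert, Finset.mem_singleton] at hx
    rcases hx with rfl | rfl | rfl <;> simp [ρ.fst_perm]
  have hcard : ({d, ρ.perm d, ρ.perm (ρ.perm d)} : Finset G.Dart).card = 3 := by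
    rw [Finset.card_eq_three]
    exact ⟨_, _, _, (ρ.perm_ne hc d).symm, (ρ.perm_perm_ne hc d).symm,
      (ρ.perm_ne hc _).symm, rfl⟩
  have heq := Finset.eq_of_subset_of_card_le hsub (by rw [hcard, card_dart_fst hc])
  have : d' ∈ ({d, ρ.perm d, ρ.perm (ρ.perm d)} : Finset G.Dart) := by
    rw [heq]; simp [h]
  simpa using this

theorem perm_three (hc : G.IsRegularOfDegree 3) (d : G.Dart) :
    ρ.perm (ρ.perm (ρ.perm d)) = d := by
  rcases ρ.eq_or_of_fst hc (d := d) (d' := ρ.perm (ρ.perm (ρ.perm d))) (by simp [ρ.fst_perm])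
    with h | h | h
  · exact h
  · exact absurd (ρ.perm.injective h) (ρ.perm_perm_ne hc d)
  · exact absurd (ρ.perm.injective (ρ.perm.injective h)) (ρ.perm_ne hc d)

theorem perm_inv_eq (hc : G.IsRegularOfDegree 3) (d : G.Dart) :
    ρ.perm⁻¹ d = ρ.perm (ρ.perm d) := by
  rw [Equiv.Perm.inv_eq_iff_eq, ρ.perm_three hc]

/-- Two rotation systems of a cubic graph agree or are opposite at each vertex. -/
theorem exists_orientation (hc : G.IsRegularOfDegree 3) (ρ ρ' : RotationSystem G) :
    ∃ ε : V → ℤˣ, ∀ d : G.Dart, ρ'.perm d = (ρ.perm ^ (ε d.fst : ℤ)) d := by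
  -- Two cyclic orders of three darts that agree at one dart agree at the next, hence everywhere at
  -- the vertex. Otherwise they are inverse to each other.
  have key : ∀ d : G.Dart, ρ'.perm d = ρ.perm d → ρ'.perm (ρ.perm d) = ρ.perm (ρ.perm d) := by
    intro d h
    rcases ρ.eq_or_of_fst hc (d := d) (d' := ρ'.perm (ρ.perm d))
      (by simp [ρ.fst_perm, ρ'.fst_perm]) with h' | h' | h'
    · rw [← h] at h'
      exact absurd h' (ρ'.perm_perm_ne hc d)
    · exact absurd h' (ρ'.perm_ne hc _)
    · exact h'
  classical
  refine ⟨fun v => if ∀ d : G.Dart, d.fst = v → ρ'.perm d = ρ.perm d then 1 else -1, ?_⟩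
  intro d
  dsimp only
  split_ifs with h
  · simpa using h d rfl
  · simp only [Units.val_neg, Units.val_one, zpow_neg, zpow_one]
    rw [ρ.perm_inv_eq hc]
    rcases ρ.eq_or_of_fst hc (d := d) (d' := ρ'.perm d) (ρ'.fst_perm d) with h' | h' | h'
    · exact absurd h' (ρ'.perm_ne hc d)
    · refine absurd ?_ h
      intro d' hd'
      rcases ρ.eq_or_of_fst hc hd' with rfl | rfl | rfl
      · exact h'
      · exact key _ h'
      · exact key _ (key _ h')
    · exact h'

end RotationSystem

end Rotation

/-! ### Facial walks and faces -/

namespace Embedding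

variable {V : Type u} {G : SimpleGraph V} (E : Embedding G)

/-- The sign of the edge of a dart. -/
def sgn (d : G.Dart) : ℤˣ := E.sign ⟨d.edge, d.edge_mem⟩

theorem sgn_symm (d : G.Dart) : E.sgn d.symm = E.sgn d := by
  unfold sgn
  congr 1
  exact Subtype.ext d.edge_symm

theorem next_apply (d : G.Dart) (s : ℤˣ) :
    E.next (d, s) = ((E.rot.perm ^ ((s * E.sgn d : ℤˣ) : ℤ)) d.symm, s * E.sgn d) := rfl

theorem rev_apply (d : G.Dart) (s : ℤˣ) : E.rev (d, s) = (d.symm, -(s * E.sgn d)) := rfl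

theorem fst_next (x : G.Dart × ℤˣ) : (E.next x).1.fst = x.1.snd := by
  rcases x with ⟨d, s⟩
  rw [next_apply]
  exact E.rot.zpow_fst _ _

theorem rev_rev (x : G.Dart × ℤˣ) : E.rev (E.rev x) = x := by
  rcases x with ⟨d, s⟩
  simp [rev_apply, sgn_symm, mul_assoc, Int.units_mul_self]

theorem rev_ne (x : G.Dart × ℤˣ) : E.rev x ≠ x := fun h =>
  x.1.symm_ne (congrArg Prod.fst h)

theorem rev_ne_next (x : G.Dart × ℤˣ) : E.rev x ≠ E.next x := by
  rcases x with ⟨d, s⟩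
  rw [rev_apply, next_apply]
  intro h
  have := congrArg (fun y => (y.2 : ℤ)) h
  simp only [Units.val_neg] at this
  have h0 := (s * E.sgn d).isUnit.ne_zero
  omega

theorem next_rev (d : G.Dart) (s : ℤˣ) :
    E.next (E.rev (d, s)) = ((E.rot.perm ^ (-(s : ℤ))) d, -s) := by
  simp [rev_apply, next_apply, sgn_symm, mul_assoc, Int.units_mul_self]

theorem next_rev_next (x : G.Dart × ℤˣ) : E.next (E.rev (E.next x)) = E.rev x := by
  rcases x with ⟨d, s⟩
  rw [E.next_apply d s, next_rev, rev_apply]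
  simp

theorem rev_next (x : G.Dart × ℤˣ) : E.rev (E.next x) = E.next⁻¹ (E.rev x) := by
  rw [Equiv.Perm.eq_inv_iff_eq, next_rev_next]

theorem rev_next_inv (x : G.Dart × ℤˣ) : E.rev (E.next⁻¹ x) = E.next (E.rev x) := by
  have := E.next_rev_next (E.next⁻¹ x)
  simpa using this.symm

theorem rev_next_zpow (k : ℤ) (x : G.Dart × ℤˣ) :
    E.rev ((E.next ^ k) x) = (E.next ^ (-k)) (E.rev x) := by
  induction k using Int.induction_on with
  | zero => simp
  | succ k ih =>
    rw [add_comm, zpow_add, zpow_one, Equiv.Perm.mul_apply, rev_next, ih, neg_add, zpow_add,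
      zpow_neg_one, Equiv.Perm.mul_apply]
  | pred k ih =>
    rw [sub_eq_add_neg, add_comm, zpow_add, zpow_neg_one, Equiv.Perm.mul_apply, rev_next_inv, ih,
      neg_add, zpow_add, neg_neg, neg_neg, zpow_one, Equiv.Perm.mul_apply]

theorem sameCycle_rev_rev {x y : G.Dart × ℤˣ} (h : E.next.SameCycle x y) :
    E.next.SameCycle (E.rev x) (E.rev y) := by
  obtain ⟨k, rfl⟩ := h
  exact ⟨-k, (E.rev_next_zpow k x).symm⟩

/-- Conjugation by `rev` inverts `next`. If `rev x` were `next ^ k x`, the state `y` halfway between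
them would satisfy `rev y = y` or `rev y = next y`, according to the parity of `k`. The first is
impossible because the dart is reversed, the second because the orientations differ. So every cell
consists of exactly two cycles of `next`. -/
theorem not_sameCycle_rev (x : G.Dart × ℤˣ) : ¬ E.next.SameCycle x (E.rev x) := by
  rintro ⟨k, hk⟩
  obtain ⟨j, rfl | rfl⟩ := Int.even_or_odd' k
  · apply E.rev_ne ((E.next ^ j) x)
    rw [rev_next_zpow, ← hk, ← Equiv.Perm.mul_apply, ← zpow_add]
    congr 2; ring
  · apply E.rev_ne_next ((E.next ^ j) x)
    rw [rev_next_zpow, ← hk, ← Equiv.Perm.mul_apply, ← zpow_add, ← Equiv.Perm.mul_apply,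
      ← zpow_one_add]
    congr 2; ring

theorem face_next (x : G.Dart × ℤˣ) : E.face (E.next x) = E.face x :=
  (Quot.sound (r := fun x y => y = E.next x ∨ y = E.rev x) (Or.inl rfl)).symm

theorem face_rev (x : G.Dart × ℤˣ) : E.face (E.rev x) = E.face x :=
  (Quot.sound (r := fun x y => y = E.next x ∨ y = E.rev x) (Or.inr rfl)).symm

theorem face_surjective : Function.Surjective E.face := Quot.mk_surjective

theorem face_eq_of_sameCycle {x y : G.Dart × ℤˣ} (h : E.next.SameCycle x y) :
    E.face x = E.face y := by
  obtain ⟨k, rfl⟩ := h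
  induction k using Int.induction_on with
  | zero => simp
  | succ k ih => rw [add_comm, zpow_add, zpow_one, Equiv.Perm.mul_apply, face_next, ih]
  | pred k ih =>
    rw [ih, ← E.face_next ((E.next ^ (-(k : ℤ) - 1)) x), ← Equiv.Perm.mul_apply, ← zpow_one_add]
    congr 3; ring

theorem face_eq_iff {x y : G.Dart × ℤˣ} :
    E.face x = E.face y ↔ E.next.SameCycle x y ∨ E.next.SameCycle (E.rev x) y := by
  constructor
  · intro h
    have h' := Quot.eqvGen_exact h
    clear h
    induction h' with
    | rel x y h =>
      rcases h with rfl | rfl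
      · left; exact ⟨1, by simp⟩
      · right; exact Equiv.Perm.SameCycle.refl _ _
    | refl x => left; exact Equiv.Perm.SameCycle.refl _ _
    | symm x y _ ih =>
      rcases ih with h | h
      · left; exact h.symm
      · right
        have := E.sameCycle_rev_rev h
        rw [rev_rev] at this
        exact this.symm
    | trans x y z hxy hyz ih1 ih2 =>
      rcases ih1 with h1 | h1 <;>
        rcases ih2 with h2 | h2
      · left; exact h1.trans h2
      · right; exact (E.sameCycle_rev_rev h1).trans h2
      · right; exact h1.trans h2
      · left
        have := (E.sameCycle_rev_rev h1).trans h2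
        rwa [rev_rev] at this
  · rintro (h | h)
    · exact E.face_eq_of_sameCycle h
    · rw [← E.face_rev, E.face_eq_of_sameCycle h]

/-- The state `(d, 1)` belongs to the corner just before `d` in the rotation, and `(d, -1)` to the
corner just after it. Hence positively oriented states suffice to describe the cells at a vertex. -/
theorem face_neg_one (d : G.Dart) : E.face (d, -1) = E.face (E.rot.perm d, 1) := by
  rw [← E.face_rev (d, -1), ← E.face_next, next_rev]
  simp

instance [Fintype V] [DecidableRel G.Adj] : Finite E.Face := by
  classical
  exact inferInstanceAs (Finite (Quot _))

noncomputable instance [Fintype V] [DecidableRel G.Adj] : Fintype E.Face := Fintype.ofFinite _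

/-- A cubic embedding is strong iff the two sides of each edge near each of its ends belong to
different cells. -/
theorem isStrong_iff [Fintype V] [DecidableRel G.Adj] (hc : G.IsRegularOfDegree 3) :
    E.IsStrong ↔ ∀ d : G.Dart, E.face (d, 1) ≠ E.face (d, -1) := by
  constructor
  · intro hs d h
    rcases E.face_eq_iff.1 h with h | h
    · have := congrArg Prod.snd (hs _ _ h rfl)
      exact absurd this (by simp)
    · have h1 := (E.sameCycle_rev_rev h)
      rw [rev_rev] at h1
      have h2 : E.next.SameCycle (d, 1) (E.next (E.rev (d, -1))) :=
        h1.trans ⟨1, by simp⟩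
      rw [next_rev] at h2
      have := congrArg Prod.fst (hs _ _ h2 (E.rot.zpow_fst _ _).symm)
      simp only [Units.val_neg, Units.val_one, neg_neg, zpow_one] at this
      exact E.rot.perm_ne hc d this.symm
  · intro hne
    have h0 : ∀ d, E.face (d, 1) ≠ E.face (E.rot.perm d, 1) := fun d => by
      rw [← face_neg_one]; exact hne d
    -- A cubic vertex has three corners, and any two of them are the two sides of one of its darts.
    -- So the three cells at a vertex are different.
    have corner : ∀ a b : G.Dart, b.fst = a.fst → E.face (a, 1) = E.face (b, 1) → a = b := by
      intro a b hab hf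
      rcases E.rot.eq_or_of_fst hc hab with h | h | h
      · exact h.symm
      · rw [h] at hf; exact absurd hf (h0 a)
      · rw [h] at hf
        have := h0 (E.rot.perm (E.rot.perm a))
        rw [E.rot.perm_three hc] at this
        exact absurd hf.symm this
    rintro ⟨d, s⟩ ⟨d', s'⟩ hxy hfst
    have hf := E.face_eq_of_sameCycle hxy
    simp only at hfst
    rcases Int.units_eq_one_or s with rfl | rfl <;> rcases Int.units_eq_one_or s' with rfl | rfl
    · rw [corner _ _ hfst.symm hf]
    -- With opposite orientations at the same corner, one state lies on the reversal of the walk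
    -- through the other, which `not_sameCycle_rev` excludes.
    · rw [face_neg_one] at hf
      have h1 := corner _ _ (by rw [E.rot.fst_perm, hfst]) hf
      have h2 : (d, (1 : ℤˣ)) = E.next (E.rev (d', -1)) := by rw [next_rev, h1]; simp
      rw [h2] at hxy
      refine absurd ?_ (E.not_sameCycle_rev (d', -1))
      exact hxy.symm.trans ⟨-1, by simp⟩
    · rw [face_neg_one] at hf
      have h1 := corner _ _ (by rw [E.rot.fst_perm, hfst]) hf
      have h2 : (d', (1 : ℤˣ)) = E.next (E.rev (d, -1)) := by rw [next_rev, ← h1]; simp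
      rw [h2] at hxy
      refine absurd ?_ (E.not_sameCycle_rev (d, -1))
      exact hxy.trans ⟨-1, by simp⟩
    · rw [face_neg_one, face_neg_one] at hf
      have h1 := corner _ _ (by rw [E.rot.fst_perm, E.rot.fst_perm, hfst]) hf
      rw [E.rot.perm.injective h1]

end Embedding

end StrongEmb

namespace StrongEmb

open SimpleGraph

/-! ### Boundary and coboundary maps over the field with two elements -/

section Duality

variable {V : Type u} [Fintype V] {G : SimpleGraph V} [DecidableRel G.Adj]

/-- A dart on the given edge. -/
noncomputable def someDart (e : G.edgeSet) : G.Dart :=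
  (⟨(Quot.out e.1), by
    have h := e.2
    rw [← Quot.out_eq e.1] at h
    exact h⟩ : G.Dart)

theorem someDart_edge {V : Type u} {G : SimpleGraph V} (e : G.edgeSet) : (someDart e).edge = e.1 := Quot.out_eq e.1

open scoped Classical in
theorem sum_dart_eq {R : Type*} [AddCommMonoid R] (w : G.Dart → R) :
    ∑ d, w d = ∑ e : G.edgeSet, (w (someDart e) + w (someDart e).symm) := by
  rw [← Finset.sum_fiberwise_of_maps_to (g := fun d : G.Dart => (⟨d.edge, d.edge_mem⟩ : G.edgeSet))
    (t := Finset.univ) (by simp)]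
  refine Finset.sum_congr rfl fun e _ => ?_
  have : (Finset.univ.filter fun d : G.Dart => (⟨d.edge, d.edge_mem⟩ : G.edgeSet) = e) =
      {someDart e, (someDart e).symm} := by
    ext d
    simp only [Finset.mem_filter, Finset.mem_univ, true_and, Finset.mem_insert,
      Finset.mem_singleton]
    rw [← dart_edge_eq_iff, someDart_edge, Subtype.ext_iff]
  rw [this, Finset.sum_pair (someDart e).symm_ne.symm]

open scoped Classical in
/-- The incidence matrix of the edges with the classes of a labelling of the darts. -/
noncomputable def incidence {N : Type u} (α : G.Dart → N) : Matrix N G.edgeSet (ZMod 2) :=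
  fun n e => (if α (someDart e) = n then 1 else 0) + (if α (someDart e).symm = n then 1 else 0)

open scoped Classical in
theorem incidence_transpose_mulVec {V : Type u} {G : SimpleGraph V} {N : Type u} [Fintype N] (α : G.Dart → N) (z : N → ZMod 2)
    (e : G.edgeSet) :
    ((incidence α).transpose.mulVec z) e = z (α (someDart e)) + z (α (someDart e).symm) := by
  simp [Matrix.mulVec, dotProduct, incidence, add_mul, Finset.sum_add_distrib]

open scoped Classical in
theorem incidence_mulVec {N : Type u} (α : G.Dart → N) (w : G.Dart → ZMod 2)
    (hw : ∀ d, w d.symm = w d) (n : N) :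
    ((incidence α).mulVec fun e => w (someDart e)) n =
      ∑ d ∈ Finset.univ.filter (fun d : G.Dart => α d = n), w d := by
  rw [Finset.sum_filter, sum_dart_eq]
  simp only [Matrix.mulVec, dotProduct, incidence]
  refine Finset.sum_congr rfl fun e _ => ?_
  rw [hw, add_mul, ite_mul, ite_mul, one_mul, zero_mul]

/-- The kernel of the transpose consists of the functions with equal values at both ends of every
edge. By `hconn` these are the constants, a line. -/
theorem rank_incidence {N : Type u} [Fintype N] [Nonempty N] (α : G.Dart → N)
    (hconn : ∀ z : N → ZMod 2, (∀ d : G.Dart, z (α d) = z (α d.symm)) → ∀ a b, z a = z b) :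
    (incidence α).rank + 1 = Fintype.card N := by
  classical
  rw [← Matrix.rank_transpose]
  have h1 := LinearMap.finrank_range_add_finrank_ker (incidence α).transpose.mulVecLin
  rw [Module.finrank_fintype_fun_eq_card] at h1
  rw [Matrix.rank, ← h1]
  congr 1
  symm
  rw [finrank_eq_one_iff']
  have hmem : (fun _ => 1 : N → ZMod 2) ∈ LinearMap.ker (incidence α).transpose.mulVecLin := by
    rw [LinearMap.mem_ker]
    ext e
    rw [Matrix.mulVecLin_apply, incidence_transpose_mulVec]
    exact CharTwo.add_self_eq_zero _
  refine ⟨⟨_, hmem⟩, ?_, ?_⟩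
  · intro h
    have := congrFun (congrArg Subtype.val h) (Classical.arbitrary N)
    exact one_ne_zero this
  · rintro ⟨z, hz⟩
    refine ⟨z (Classical.arbitrary N), Subtype.ext (funext fun n => ?_)⟩
    simp only [SetLike.mk_smul_mk, Pi.smul_apply, smul_eq_mul, mul_one]
    refine hconn z (fun d => ?_) _ _
    rw [LinearMap.mem_ker] at hz
    have h2 := congrFun hz ⟨d.edge, d.edge_mem⟩
    rw [Matrix.mulVecLin_apply, incidence_transpose_mulVec] at h2
    have h3 := CharTwo.add_eq_zero.1 h2
    have h4 : (someDart ⟨d.edge, d.edge_mem⟩).edge = d.edge := someDart_edge _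
    rcases (dart_edge_eq_iff _ _).1 h4 with h5 | h5
    · rw [h5] at h3; exact h3
    · rw [h5, Dart.symm_symm] at h3; exact h3.symm

open scoped Classical in
/-- If the coboundaries of `β` are cycles for `α` and the dimensions fit, then every cycle for `α`
is a coboundary of `β`. -/
theorem exists_coboundary {N M : Type u} [Fintype N] [Nonempty N] [Fintype M] [Nonempty M]
    (α : G.Dart → N) (β : G.Dart → M)
    (hα : ∀ z : N → ZMod 2, (∀ d : G.Dart, z (α d) = z (α d.symm)) → ∀ a b, z a = z b)
    (hβ : ∀ z : M → ZMod 2, (∀ d : G.Dart, z (β d) = z (β d.symm)) → ∀ a b, z a = z b)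
    (hcard : Fintype.card N + Fintype.card M = Fintype.card G.edgeSet + 2)
    (horth : ∀ (y : M → ZMod 2) (n : N),
      ∑ d ∈ Finset.univ.filter (fun d : G.Dart => α d = n), (y (β d) + y (β d.symm)) = 0)
    (w : G.Dart → ZMod 2) (hw : ∀ d, w d.symm = w d)
    (hcyc : ∀ n, ∑ d ∈ Finset.univ.filter (fun d : G.Dart => α d = n), w d = 0) :
    ∃ y : M → ZMod 2, ∀ d, w d = y (β d) + y (β d.symm) := by
  have hle : LinearMap.range (incidence β).transpose.mulVecLin ≤
      LinearMap.ker (incidence α).mulVecLin := by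
    rintro _ ⟨y, rfl⟩
    rw [LinearMap.mem_ker]
    ext n
    have h1 := incidence_mulVec α (fun d => y (β d) + y (β d.symm))
      (fun d => by rw [Dart.symm_symm, add_comm]) n
    rw [horth] at h1
    rw [Matrix.mulVecLin_apply, Matrix.mulVecLin_apply]
    have h2 : (incidence β).transpose.mulVec y =
        fun e => y (β (someDart e)) + y (β (someDart e).symm) :=
      funext (incidence_transpose_mulVec β y)
    rw [h2]
    exact h1
  have hrα := rank_incidence α hα
  have hrβ := rank_incidence β hβ
  rw [← Matrix.rank_transpose] at hrβ
  have h1 := LinearMap.finrank_range_add_finrank_ker (incidence α).mulVecLin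
  rw [Module.finrank_fintype_fun_eq_card] at h1
  -- The coboundaries have dimension `|M| - 1` and the cycles `|E| - (|N| - 1)`. The count `hcard`,
  -- which is Euler's formula on the sphere in the applications, makes these equal.
  have heq := Submodule.eq_of_le_of_finrank_eq hle (by
    change (incidence β).transpose.rank = _
    change (incidence α).rank + _ = _ at h1
    omega)
  have hmem : (fun e => w (someDart e)) ∈ LinearMap.ker (incidence α).mulVecLin := by
    rw [LinearMap.mem_ker]
    ext n
    rw [Matrix.mulVecLin_apply, incidence_mulVec α w hw, hcyc]
    rfl
  rw [← heq] at hmem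
  obtain ⟨y, hy⟩ := hmem
  refine ⟨y, fun d => ?_⟩
  have h2 := congrFun hy ⟨d.edge, d.edge_mem⟩
  rw [Matrix.mulVecLin_apply, incidence_transpose_mulVec] at h2
  have h4 : (someDart ⟨d.edge, d.edge_mem⟩).edge = d.edge := someDart_edge _
  rcases (dart_edge_eq_iff _ _).1 h4 with h5 | h5
  · rw [h5] at h2; exact h2.symm
  · rw [h5, Dart.symm_symm, hw] at h2; rw [← h2, add_comm]

end Duality

/-! ### Plane cubic graphs -/

namespace RotationSystem

section Left

variable {V : Type u} {G : SimpleGraph V} (ρ : RotationSystem G)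

/-- The face of the untwisted embedding to the left of a dart. -/
def left (d : G.Dart) : ρ.untwisted.Face := ρ.untwisted.face (d, 1)

theorem untwisted_sgn (d : G.Dart) : ρ.untwisted.sgn d = 1 := rfl

theorem face_neg_one_eq (d : G.Dart) : ρ.untwisted.face (d, -1) = ρ.left d.symm := by
  rw [left, ← ρ.untwisted.face_rev (d.symm, 1), Embedding.rev_apply, untwisted_sgn]
  simp

theorem left_perm (d : G.Dart) : ρ.left (ρ.perm d) = ρ.left d.symm := by
  rw [← face_neg_one_eq, Embedding.face_neg_one]
  rfl

theorem left_perm_symm (d : G.Dart) : ρ.left (ρ.perm d.symm) = ρ.left d := by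
  rw [left_perm, Dart.symm_symm]

theorem left_surjective : Function.Surjective ρ.left := by
  intro f
  obtain ⟨⟨d, s⟩, rfl⟩ := ρ.untwisted.face_surjective f
  rcases Int.units_eq_one_or s with rfl | rfl
  · exact ⟨d, rfl⟩
  · exact ⟨d.symm, (ρ.face_neg_one_eq d).symm⟩

theorem dual_adj_iff {f g : ρ.untwisted.Face} :
    ρ.dual.Adj f g ↔ f ≠ g ∧ ∃ d, ρ.left d = f ∧ ρ.left d.symm = g := by
  constructor
  · rintro ⟨hne, d, s, hf, hg⟩
    refine ⟨hne, ?_⟩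
    rcases Int.units_eq_one_or s with rfl | rfl
    · exact ⟨d, hf, by rw [← hg, ← face_neg_one_eq]⟩
    · refine ⟨d.symm, by rw [← hf, ← face_neg_one_eq], ?_⟩
      rw [Dart.symm_symm, ← hg, neg_neg]; rfl
  · rintro ⟨hne, d, hf, hg⟩
    exact ⟨hne, d, 1, hf, by rw [face_neg_one_eq, hg]⟩

end Left

open scoped Classical in
-- The permutation `d ↦ ρ.perm d.symm` walks around the face and sends a dart to one that starts at
-- its head, so the sum telescopes.
theorem sum_left_coboundary {V : Type u} [Fintype V] {G : SimpleGraph V} [DecidableRel G.Adj]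
    (ρ : RotationSystem G) (ε : V → ZMod 2) (f : ρ.untwisted.Face) :
    ∑ d ∈ Finset.univ.filter (fun d : G.Dart => ρ.left d = f), (ε d.fst + ε d.snd) = 0 := by
  rw [Finset.sum_add_distrib]
  have : ∑ d ∈ Finset.univ.filter (fun d : G.Dart => ρ.left d = f), ε d.snd =
      ∑ d ∈ Finset.univ.filter (fun d : G.Dart => ρ.left d = f), ε d.fst := by
    refine Finset.sum_equiv (Dart.symm_involutive.toPerm.trans ρ.perm)
      (fun d => ?_) (fun d _ => ?_)
    · simp only [Finset.mem_filter, Finset.mem_univ, true_and, Equiv.trans_apply,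
        Function.Involutive.coe_toPerm]
      rw [left_perm_symm]
    · simp only [Equiv.trans_apply, Function.Involutive.coe_toPerm]
      rw [ρ.fst_perm]
      rfl
  rw [this, CharTwo.add_self_eq_zero]

/-- A rotation system of a 3-connected cubic graph that describes an embedding on the sphere. -/
structure IsPlaneCubic {V : Type u} [Fintype V] {G : SimpleGraph V} [DecidableRel G.Adj]
    (ρ : RotationSystem G) : Prop where
  conn : ThreeConnected G
  cubic : G.IsRegularOfDegree 3
  planar : ρ.IsPlanar

namespace IsPlaneCubic

variable {V : Type u} [Fintype V] {G : SimpleGraph V} [DecidableRel G.Adj] {ρ : RotationSystem G}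

theorem face_nonempty (h : ρ.IsPlaneCubic) : Nonempty ρ.untwisted.Face := by
  obtain ⟨v⟩ := h.conn.nonempty
  obtain ⟨d, -⟩ := exists_dart_fst h.cubic v
  exact ⟨ρ.left d⟩

theorem card_eq (h : ρ.IsPlaneCubic) : Fintype.card V + Fintype.card ρ.untwisted.Face =
    Fintype.card G.edgeSet + 2 := by
  have := h.planar.2
  unfold Embedding.eulerChar at this
  simp only [Nat.card_eq_fintype_card] at this
  omega

/-- Connectedness of the dual graph. Consecutive corners at a vertex lie on the two sides of an
edge, so `z ∘ left` is constant at each vertex and becomes a vertex function that is constant along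
edges. -/
theorem eq_of_left_eq (h : ρ.IsPlaneCubic) {α : Type*} (z : ρ.untwisted.Face → α)
    (hz : ∀ d : G.Dart, z (ρ.left d) = z (ρ.left d.symm)) (f g : ρ.untwisted.Face) :
    z f = z g := by
  choose dv hdv using exists_dart_fst h.cubic
  have h1 : ∀ d d' : G.Dart, d'.fst = d.fst → z (ρ.left d') = z (ρ.left d) := by
    intro d d' hd
    rcases ρ.eq_or_of_fst h.cubic hd with rfl | rfl | rfl
    · rfl
    · rw [left_perm, ← hz]
    · rw [left_perm, ← hz, left_perm, ← hz]
  have h2 := h.conn.eq_of_dart (ε := fun v => z (ρ.left (dv v))) (fun d => by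
    rw [h1 d (dv d.fst) (hdv _), h1 d.symm (dv d.snd) (hdv _), hz])
  obtain ⟨d, rfl⟩ := ρ.left_surjective f
  obtain ⟨d', rfl⟩ := ρ.left_surjective g
  rw [h1 (dv d.fst) d (hdv _).symm, h1 (dv d'.fst) d' (hdv _).symm]
  exact h2 _ _

open scoped Classical in
/-- Every even edge set of the graph is a cut of the dual graph. -/
theorem exists_face_potential (h : ρ.IsPlaneCubic) (w : G.Dart → ZMod 2) (hw : ∀ d, w d.symm = w d)
    (hcyc : ∀ v, ∑ d ∈ Finset.univ.filter (fun d : G.Dart => d.fst = v), w d = 0) :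
    ∃ z : ρ.untwisted.Face → ZMod 2, ∀ d, w d = z (ρ.left d) + z (ρ.left d.symm) := by
  have := h.conn.nonempty
  have := h.face_nonempty
  refine exists_coboundary (fun d : G.Dart => d.fst) ρ.left
    (fun z hz => h.conn.eq_of_dart hz) (fun z hz => h.eq_of_left_eq z hz) h.card_eq ?_ w hw hcyc
  intro y v
  rw [Finset.sum_add_distrib]
  have : ∑ d ∈ Finset.univ.filter (fun d : G.Dart => d.fst = v), y (ρ.left d.symm) =
      ∑ d ∈ Finset.univ.filter (fun d : G.Dart => d.fst = v), y (ρ.left d) := by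
    refine Finset.sum_equiv ρ.perm (fun d => by simp [ρ.fst_perm]) (fun d _ => ?_)
    rw [left_perm]
  rw [this, CharTwo.add_self_eq_zero]

open scoped Classical in
/-- Every even edge set of the dual graph is a cut of the graph. -/
theorem exists_vertex_potential (h : ρ.IsPlaneCubic) (w : G.Dart → ZMod 2) (hw : ∀ d, w d.symm = w d)
    (hcyc : ∀ f, ∑ d ∈ Finset.univ.filter (fun d : G.Dart => ρ.left d = f), w d = 0) :
    ∃ ε : V → ZMod 2, ∀ d, w d = ε d.fst + ε d.snd := by
  have := h.conn.nonempty
  have := h.face_nonempty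
  refine exists_coboundary ρ.left (fun d : G.Dart => d.fst)
    (fun z hz => h.eq_of_left_eq z hz) (fun z hz => h.conn.eq_of_dart hz)
    (by rw [add_comm]; exact h.card_eq) ?_ w hw hcyc
  exact fun y f => ρ.sum_left_coboundary y f

/-- A 3-connected cubic graph has no edge cut with one or two edges. -/
theorem not_cut (h : ρ.IsPlaneCubic) (ε : V → ZMod 2) (d d' : G.Dart)
    (hε : ∀ x : G.Dart, ε x.fst ≠ ε x.snd ↔ x.edge = d.edge ∨ x.edge = d'.edge) : False := by
  classical
  -- Reversing `d'` if necessary, both cut edges start on the same side.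
  wlog hdd : ε d.fst = ε d'.fst generalizing d'
  · refine this d'.symm (by simpa [Dart.edge_symm] using hε) ?_
    have h1 := (hε d).2 (Or.inl rfl)
    have h2 := (hε d').2 (Or.inr rfl)
    change ε d.fst = ε d'.snd
    revert h1 h2 hdd
    generalize ε d.fst = a; generalize ε d.snd = b
    generalize ε d'.fst = a'; generalize ε d'.snd = b'
    revert a b a' b'; decide
  have h1 := (hε d).2 (Or.inl rfl)
  have h2 := (hε d').2 (Or.inr rfl)
  have hS : ({d.fst, d'.fst} : Finset V).card < 3 := Finset.card_le_two.trans_lt (by norm_num)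
  -- Deleting the two tails destroys both cut edges but leaves a connected graph, so all remaining
  -- vertices are on the side of `d.snd`.
  have hout : ∀ v, v ∉ ({d.fst, d'.fst} : Finset V) → ε d.snd = ε v := by
    intro v hv
    refine h.conn.propagate (p := fun v => ε d.snd = ε v) hS ?_ (u := d.snd) ?_ hv rfl
    · intro a b hab ha hb hda
      by_contra hne
      have := (hε ⟨(a, b), hab⟩).1 (by simpa [← hda] using hne)
      simp only [Finset.mem_insert, Finset.mem_singleton, not_or] at ha hb
      rcases this with h' | h'
      · rcases Sym2.eq_iff.1 (h'.trans rfl : s(a, b) = s(d.fst, d.snd)) with ⟨rfl, _⟩ | ⟨_, rfl⟩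
        · exact ha.1 rfl
        · exact hb.1 rfl
      · rcases Sym2.eq_iff.1 (h'.trans rfl : s(a, b) = s(d'.fst, d'.snd)) with ⟨rfl, _⟩ | ⟨_, rfl⟩
        · exact ha.2 rfl
        · exact hb.2 rfl
    · simp only [Finset.mem_insert, Finset.mem_singleton, not_or]
      exact ⟨d.snd_ne_fst, fun h' => h1 (by rw [h', hdd])⟩
  -- A neighbour of `d.fst` other than `d'.fst` lies on the opposite side, so it is reached by `d`
  -- or `d'`. This leaves at most two neighbours.
  have hsub : G.neighborFinset d.fst ⊆
      {d.snd, if d.fst = d'.fst then d'.snd else d'.fst} := by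
    intro v hv
    rw [mem_neighborFinset] at hv
    simp only [Finset.mem_insert, Finset.mem_singleton]
    by_cases hvS : v ∈ ({d.fst, d'.fst} : Finset V)
    · simp only [Finset.mem_insert, Finset.mem_singleton] at hvS
      rcases hvS with rfl | rfl
      · exact absurd rfl hv.ne
      · right; rw [if_neg hv.ne]
    · have h3 := (hε ⟨(d.fst, v), hv⟩).1 (by simpa [← hout v hvS] using h1)
      rcases h3 with h' | h'
      · rcases Sym2.eq_iff.1 (h'.trans rfl : s(d.fst, v) = s(d.fst, d.snd)) with
          ⟨_, rfl⟩ | ⟨h4, _⟩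
        · exact Or.inl rfl
        · exact absurd h4 d.fst_ne_snd
      · rcases Sym2.eq_iff.1 (h'.trans rfl : s(d.fst, v) = s(d'.fst, d'.snd)) with
          ⟨h4, rfl⟩ | ⟨_, h4⟩
        · right; rw [if_pos h4]
        · exact absurd (Finset.mem_insert_of_mem (Finset.mem_singleton.2 h4)) hvS
  have hcard := (Finset.card_le_card hsub).trans Finset.card_le_two
  rw [card_neighborFinset_eq_degree, h.cubic] at hcard
  norm_num at hcard

open scoped Classical in
-- An even set of one or two dual edges would be an edge cut, by `exists_vertex_potential`. Hence
-- the dual has no loops (`left_ne`) and no parallel edges (`dart_eq_of_left`), and a dart may be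
-- identified with the ordered pair of its sides.
theorem no_small_face_cycle (h : ρ.IsPlaneCubic) (d d' : G.Dart)
    (hsum : ∀ f, ∑ x ∈ Finset.univ.filter (fun x : G.Dart => ρ.left x = f),
      (if x.edge = d.edge ∨ x.edge = d'.edge then (1 : ZMod 2) else 0) = 0) : False := by
  obtain ⟨ε, hε⟩ := h.exists_vertex_potential
    (fun x => if x.edge = d.edge ∨ x.edge = d'.edge then (1 : ZMod 2) else 0)
    (fun x => by simp only [Dart.edge_symm]) hsum
  refine h.not_cut ε d d' fun x => ?_
  have hx := hε x
  rw [ne_eq, ← CharTwo.add_eq_zero, ← hx]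
  simp only [ite_eq_right_iff, one_ne_zero, imp_false, not_not]

theorem left_ne (h : ρ.IsPlaneCubic) (d : G.Dart) : ρ.left d ≠ ρ.left d.symm := by
  classical
  intro heq
  refine h.no_small_face_cycle d d fun f => ?_
  simp only [or_self, dart_edge_eq_iff]
  rw [Finset.sum_filter, ← Finset.sum_subset (Finset.subset_univ {d, d.symm}),
    Finset.sum_pair d.symm_ne.symm]
  · by_cases hf : ρ.left d = f
    · simp [← heq, hf, CharTwo.add_self_eq_zero]
    · simp [← heq, hf]
  · intro x _ hx
    simp only [Finset.mem_insert, Finset.mem_singleton] at hx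
    simp [hx]

theorem dart_eq_of_left (h : ρ.IsPlaneCubic) (d d' : G.Dart) (h1 : ρ.left d = ρ.left d')
    (h2 : ρ.left d.symm = ρ.left d'.symm) : d = d' := by
  classical
  by_contra hne
  have hne' : d ≠ d'.symm := by
    rintro rfl
    exact h.left_ne d' h1.symm
  have hne2 : d.symm ≠ d' := fun h => hne' (by rw [← h, Dart.symm_symm])
  have hne3 : d.symm ≠ d'.symm := fun h => hne (Dart.symm_involutive.injective h)
  refine h.no_small_face_cycle d d' fun f => ?_
  simp only [dart_edge_eq_iff]
  rw [Finset.sum_filter, ← Finset.sum_subset (Finset.subset_univ {d, d.symm, d', d'.symm}),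
    Finset.sum_insert (by simp [hne, hne', d.symm_ne.symm]), Finset.sum_insert (by simp [hne2, hne3]),
    Finset.sum_pair d'.symm_ne.symm]
  · simp only [true_or, or_true, if_true, ← h1, ← h2]
    rw [← add_assoc]
    exact CharTwo.add_self_eq_zero _
  · intro x _ hx
    simp only [Finset.mem_insert, Finset.mem_singleton, not_or] at hx
    simp [hx]

theorem dual_adj (h : ρ.IsPlaneCubic) (d : G.Dart) : ρ.dual.Adj (ρ.left d) (ρ.left d.symm) :=
  ρ.dual_adj_iff.2 ⟨h.left_ne d, d, rfl, rfl⟩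

end IsPlaneCubic

end RotationSystem

end StrongEmb

/-! ### Signatures and the Laplacian of the twisted dual edges. -/

namespace StrongEmb

open SimpleGraph

/-- The range of a symmetric matrix is the orthogonal complement of its kernel: a functional that
vanishes on the range is the product with a vector `z`, and by symmetry `z` lies in the kernel. -/
theorem mem_range_mulVecLin_iff {n : Type*} [Fintype n] {M : Matrix n n (ZMod 2)} (hM : M.IsSymm)
    (u : n → ZMod 2) : u ∈ LinearMap.range M.mulVecLin ↔ ∀ z, M.mulVec z = 0 → u ⬝ᵥ z = 0 := by
  constructor
  · rintro ⟨w, rfl⟩ z hz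
    rw [Matrix.mulVecLin_apply]
    have : (M.mulVec w) ⬝ᵥ z = w ⬝ᵥ M.mulVec z := by
      rw [Matrix.dotProduct_mulVec, ← Matrix.mulVec_transpose, hM.eq]
    rw [this, hz, dotProduct_zero]
  · intro hu
    classical
    by_contra hmem
    obtain ⟨φ, hφ, hle⟩ := Submodule.exists_le_ker_of_notMem hmem
    let z : n → ZMod 2 := fun i => φ (Pi.single i 1)
    have hφz : ∀ y, φ y = y ⬝ᵥ z := by
      intro y
      rw [LinearMap.pi_apply_eq_sum_univ φ y]
      simp only [dotProduct, z, smul_eq_mul]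
      refine Finset.sum_congr rfl fun i _ => ?_
      congr 2
      ext j
      simp [Pi.single_apply, eq_comm]
    apply hφ
    rw [hφz]
    apply hu
    ext i
    have h1 : φ (M.mulVec (Pi.single i 1)) = 0 := hle ⟨_, rfl⟩
    rw [hφz, Matrix.mulVec_single_one] at h1
    rw [Matrix.mulVec, Pi.zero_apply, ← h1]
    congr 1
    ext j
    exact hM.apply j i

/-! ### Embeddings with twisted edges -/

namespace RotationSystem

section Twisted

variable {V : Type u} {G : SimpleGraph V} (ρ : RotationSystem G)

/-- The embedding with rotation system `ρ` and signature `l`. -/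
def signed (l : G.edgeSet → ℤˣ) : Embedding G := ⟨ρ, l⟩

/-- The graph formed by the dual edges of the twisted edges. -/
def twistedGraph (l : G.edgeSet → ℤˣ) : SimpleGraph ρ.untwisted.Face where
  Adj f g := f ≠ g ∧ ∃ d, ρ.left d = f ∧ ρ.left d.symm = g ∧ (ρ.signed l).sgn d = -1
  symm := ⟨by
    rintro f g ⟨hne, d, hf, hg, hd⟩
    exact ⟨hne.symm, d.symm, hg, by rwa [Dart.symm_symm], by rwa [Embedding.sgn_symm]⟩⟩
  loopless := ⟨fun _ h => h.1 rfl⟩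

open scoped Classical in
/-- The indicator of the twisted edges. -/
noncomputable def twistInd (l : G.edgeSet → ℤˣ) (d : G.Dart) : ZMod 2 :=
  if (ρ.signed l).sgn d = -1 then 1 else 0

theorem twistInd_symm (l : G.edgeSet → ℤˣ) (d : G.Dart) :
    ρ.twistInd l d.symm = ρ.twistInd l d := by
  unfold twistInd
  rw [Embedding.sgn_symm]

theorem twistInd_of_one {l : G.edgeSet → ℤˣ} {d : G.Dart} (h : (ρ.signed l).sgn d = 1) :
    ρ.twistInd l d = 0 := by
  unfold twistInd
  rw [h, if_neg (by decide)]

theorem twistInd_of_neg_one {l : G.edgeSet → ℤˣ} {d : G.Dart} (h : (ρ.signed l).sgn d = -1) :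
    ρ.twistInd l d = 1 := by
  unfold twistInd
  rw [h, if_pos rfl]

theorem twistedGraph_le_dual (l : G.edgeSet → ℤˣ) : ρ.twistedGraph l ≤ ρ.dual := by
  rintro f g ⟨hne, d, hf, hg, -⟩
  exact ρ.dual_adj_iff.2 ⟨hne, d, hf, hg⟩

open scoped Classical in
/-- The Laplacian modulo two of the twisted graph. -/
noncomputable def lap [Fintype V] [DecidableRel G.Adj] (l : G.edgeSet → ℤˣ) :
    Matrix ρ.untwisted.Face ρ.untwisted.Face (ZMod 2) :=
  (ρ.twistedGraph l).lapMatrix (ZMod 2)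

theorem lap_isSymm [Fintype V] [DecidableRel G.Adj] (l : G.edgeSet → ℤˣ) : (ρ.lap l).IsSymm := by
  classical
  exact isSymm_lapMatrix (R := ZMod 2) (ρ.twistedGraph l)

/-- A pair of potentials on the faces and the vertices with the same coboundary on the twisted
edges and such that the vertex potential does not change along the other edges. -/
def Compatible (l : G.edgeSet → ℤˣ) (z : ρ.untwisted.Face → ZMod 2) (ε : V → ZMod 2) : Prop :=
  ∀ d : G.Dart, ε d.fst + ε d.snd = ρ.twistInd l d * (z (ρ.left d) + z (ρ.left d.symm))

theorem untwisted_face_perm (d : G.Dart) (s : ℤˣ) :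
    ρ.untwisted.face ((ρ.perm ^ (-(s : ℤ))) d, -s) = ρ.untwisted.face (d, s) := by
  have := ρ.untwisted.next_rev d s
  change _ = ((ρ.perm ^ (-(s : ℤ))) d, -s) at this
  rw [← this, Embedding.face_next, Embedding.face_rev]

theorem untwisted_face_symm (d : G.Dart) (s : ℤˣ) :
    ρ.untwisted.face (d.symm, s) = ρ.untwisted.face (d, -s) := by
  rw [← ρ.untwisted.face_rev (d, -s), Embedding.rev_apply, untwisted_sgn]
  simp

theorem sum_sides (z : ρ.untwisted.Face → ZMod 2) (d : G.Dart) (s : ℤˣ) :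
    z (ρ.untwisted.face (d, s)) + z (ρ.untwisted.face (d, -s)) =
      z (ρ.left d) + z (ρ.left d.symm) := by
  rcases Int.units_eq_one_or s with rfl | rfl
  · rw [face_neg_one_eq]; rfl
  · rw [neg_neg, face_neg_one_eq, add_comm]; rfl

/-- The function `z + ε` on states is unchanged by turning at a vertex. Crossing a twisted edge
leads to the other side in the plane, and the resulting change of `z` is compensated by that of `ε`.
So the function descends to the cells of the twisted embedding. -/
theorem Compatible.exists_face_function {ρ : RotationSystem G} {l : G.edgeSet → ℤˣ}
    {z : ρ.untwisted.Face → ZMod 2} {ε : V → ZMod 2} (hc : ρ.Compatible l z ε) :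
    ∃ c : (ρ.signed l).Face → ZMod 2, ∀ (d : G.Dart) (s : ℤˣ),
      c ((ρ.signed l).face (d, s)) = z (ρ.untwisted.face (d, s)) + ε d.fst := by
  let c0 : G.Dart × ℤˣ → ZMod 2 := fun x => z (ρ.untwisted.face x) + ε x.1.fst
  have hrev : ∀ x, c0 ((ρ.signed l).rev x) = c0 x := by
    rintro ⟨d, s⟩
    have h1 := hc d
    have h2 := ρ.sum_sides z d s
    simp only [Embedding.rev_apply, c0, untwisted_face_symm, Dart.symm_toProd, Prod.fst_swap,
      neg_neg]
    rcases Int.units_eq_one_or ((ρ.signed l).sgn d) with h | h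
    · rw [ρ.twistInd_of_one h, zero_mul] at h1
      rw [h, mul_one, CharTwo.add_eq_zero.1 h1]
    · rw [ρ.twistInd_of_neg_one h, one_mul, ← h2] at h1
      rw [h, mul_neg, mul_one]
      generalize z (ρ.untwisted.face (d, s)) = a at *
      generalize z (ρ.untwisted.face (d, -s)) = b at *
      generalize ε d.fst = p at *
      generalize ε d.snd = q at *
      revert h1; clear * -; revert a b p q; decide
  have hnext : ∀ x, c0 ((ρ.signed l).next x) = c0 x := by
    intro x
    obtain ⟨⟨d, s⟩, rfl⟩ : ∃ y, x = (ρ.signed l).rev y :=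
      ⟨_, ((ρ.signed l).rev_rev x).symm⟩
    rw [Embedding.next_rev, hrev]
    change z (ρ.untwisted.face ((ρ.perm ^ (-(s : ℤ))) d, -s)) +
      ε ((ρ.perm ^ (-(s : ℤ))) d).fst = _
    rw [untwisted_face_perm, zpow_fst]
  refine ⟨Quot.lift c0 ?_, fun d s => rfl⟩
  rintro x y (rfl | rfl)
  · exact (hnext x).symm
  · exact (hrev x).symm

end Twisted

namespace IsPlaneCubic

variable {V : Type u} [Fintype V] {G : SimpleGraph V} [DecidableRel G.Adj] {ρ : RotationSystem G}

open scoped Classical in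
theorem sum_twisted (h : ρ.IsPlaneCubic) (l : G.edgeSet → ℤˣ) (y : ρ.untwisted.Face → ZMod 2)
    (f : ρ.untwisted.Face) :
    ∑ d ∈ Finset.univ.filter (fun d : G.Dart => ρ.left d = f),
      ρ.twistInd l d * y (ρ.left d.symm) = ∑ g ∈ (ρ.twistedGraph l).neighborFinset f, y g := by
  simp only [twistInd, ite_mul, one_mul, zero_mul]
  rw [← Finset.sum_filter, Finset.filter_filter]
  refine Finset.sum_bij (fun d _ => ρ.left d.symm) ?_ ?_ ?_ ?_
  · intro d hd
    simp only [Finset.mem_filter, Finset.mem_univ, true_and] at hd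
    rw [mem_neighborFinset]
    exact ⟨hd.1 ▸ h.left_ne d, d, hd.1, rfl, hd.2⟩
  · intro d hd d' hd' heq
    simp only [Finset.mem_filter, Finset.mem_univ, true_and] at hd hd'
    exact h.dart_eq_of_left d d' (hd.1.trans hd'.1.symm) heq
  · intro g hg
    rw [mem_neighborFinset] at hg
    obtain ⟨-, d, hf, hg, hd⟩ := hg
    exact ⟨d, by simp [hf, hd], hg⟩
  · intro d _
    rfl

open scoped Classical in
theorem lap_mulVec (h : ρ.IsPlaneCubic) (l : G.edgeSet → ℤˣ) (z : ρ.untwisted.Face → ZMod 2)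
    (f : ρ.untwisted.Face) :
    ((ρ.lap l).mulVec z) f = ∑ d ∈ Finset.univ.filter (fun d : G.Dart => ρ.left d = f),
      ρ.twistInd l d * (z (ρ.left d) + z (ρ.left d.symm)) := by
  have h1 := h.sum_twisted l (fun _ => z f) f
  have h2 := h.sum_twisted l z f
  simp only [mul_add, Finset.sum_add_distrib]
  rw [lap, lapMatrix_mulVec_apply, h2, CharTwo.sub_eq_add]
  congr 1
  rw [Finset.sum_const, card_neighborFinset_eq_degree, nsmul_eq_mul] at h1
  rw [← h1]
  refine Finset.sum_congr rfl fun d hd => ?_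
  rw [(Finset.mem_filter.1 hd).2]

/-- The value of `L z` at a face is the sum over its boundary of the coboundary of `z` restricted to
the twisted edges. If it vanishes at all faces, this restriction is an even set of dual edges, hence
the coboundary of a vertex function. -/
theorem lap_mulVec_eq_zero_iff (h : ρ.IsPlaneCubic) (l : G.edgeSet → ℤˣ)
    (z : ρ.untwisted.Face → ZMod 2) :
    (ρ.lap l).mulVec z = 0 ↔ ∃ ε, ρ.Compatible l z ε := by
  classical
  constructor
  · intro hz
    obtain ⟨ε, hε⟩ := h.exists_vertex_potential
      (fun d => ρ.twistInd l d * (z (ρ.left d) + z (ρ.left d.symm)))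
      (fun d => by rw [twistInd_symm, Dart.symm_symm, add_comm])
      (fun f => by rw [← h.lap_mulVec, hz]; rfl)
    exact ⟨ε, fun d => (hε d).symm⟩
  · rintro ⟨ε, hε⟩
    ext f
    rw [h.lap_mulVec, Pi.zero_apply, ← ρ.sum_left_coboundary ε f]
    exact Finset.sum_congr rfl fun d _ => (hε d).symm

/-- Converse of `Compatible.exists_face_function`. The differences of `c` across the edges form an
even edge set, because the three corners at a vertex are met cyclically. Hence they are the
differences of a face function `z`, and `c + z` is then the same at the three corners of a vertex,
which defines `ε`. -/
theorem exists_compatible (h : ρ.IsPlaneCubic) (l : G.edgeSet → ℤˣ)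
    (c : (ρ.signed l).Face → ZMod 2) :
    ∃ z ε, ρ.Compatible l z ε ∧ ∀ d, c ((ρ.signed l).face (d, 1)) = z (ρ.left d) + ε d.fst := by
  classical
  let E := ρ.signed l
  change E.Face → ZMod 2 at c
  have hsym : ∀ (d : G.Dart) (s : ℤˣ), E.face (d.symm, s) = E.face (d, -(s * E.sgn d)) := by
    intro d s
    rw [← E.face_rev (d.symm, s), Embedding.rev_apply, Embedding.sgn_symm, Dart.symm_symm]
  have hneg : ∀ d, E.face (d, -1) = E.face (ρ.perm d, 1) := fun d => E.face_neg_one d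
  obtain ⟨z, hz⟩ := h.exists_face_potential (fun d => c (E.face (d, 1)) + c (E.face (d, -1)))
    (fun d => by
      rw [hsym, hsym]
      rcases Int.units_eq_one_or (E.sgn d) with h | h <;> rw [h]
      · simp [add_comm]
      · simp)
    (fun v => by
      rw [Finset.sum_add_distrib]
      have : ∑ d ∈ Finset.univ.filter (fun d : G.Dart => d.fst = v), c (E.face (d, -1)) =
          ∑ d ∈ Finset.univ.filter (fun d : G.Dart => d.fst = v), c (E.face (d, 1)) := by
        refine Finset.sum_equiv ρ.perm (fun d => by simp [ρ.fst_perm]) (fun d _ => ?_)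
        rw [hneg]
      rw [this, CharTwo.add_self_eq_zero])
  choose dv hdv using exists_dart_fst h.cubic
  have h0 : ∀ d, c (E.face (ρ.perm d, 1)) + z (ρ.left (ρ.perm d)) =
      c (E.face (d, 1)) + z (ρ.left d) := by
    intro d
    have := hz d
    rw [hneg, ← left_perm] at this
    generalize c (E.face (ρ.perm d, 1)) = p at *
    generalize c (E.face (d, 1)) = q at *
    generalize z (ρ.left (ρ.perm d)) = r at *
    generalize z (ρ.left d) = t at *
    revert this; clear * -; revert p q r t; decide
  have h1 : ∀ d d' : G.Dart, d'.fst = d.fst →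
      c (E.face (d', 1)) + z (ρ.left d') = c (E.face (d, 1)) + z (ρ.left d) := by
    intro d d' hd
    rcases ρ.eq_or_of_fst h.cubic hd with rfl | rfl | rfl
    · rfl
    · exact h0 d
    · rw [h0, h0]
  refine ⟨z, fun v => c (E.face (dv v, 1)) + z (ρ.left (dv v)), ?_, ?_⟩
  · intro d
    dsimp only
    rw [h1 d (dv d.fst) (hdv _), h1 d.symm (dv d.snd) (hdv _)]
    have h2 := hz d
    rcases Int.units_eq_one_or (E.sgn d) with h | h
    · rw [ρ.twistInd_of_one h, zero_mul, hsym, h]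
      simp only [mul_one]
      generalize c (E.face (d, 1)) = p at *
      generalize c (E.face (d, -1)) = q at *
      generalize z (ρ.left d.symm) = r at *
      generalize z (ρ.left d) = t at *
      revert h2; clear * -; revert p q r t; decide
    · rw [ρ.twistInd_of_neg_one h, one_mul, hsym, h]
      simp only [mul_neg, mul_one, neg_neg]
      generalize c (E.face (d, 1)) = p at *
      generalize z (ρ.left d.symm) = r at *
      generalize z (ρ.left d) = t at *
      clear * -; revert p r t; decide
  · intro d
    dsimp only
    rw [h1 d (dv d.fst) (hdv _), add_comm, add_assoc, CharTwo.add_self_eq_zero, add_zero]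

/-- The pairs of compatible potentials. -/
def compatibleSubmodule (ρ : RotationSystem G) (l : G.edgeSet → ℤˣ) :
    Submodule (ZMod 2) ((ρ.untwisted.Face → ZMod 2) × (V → ZMod 2)) where
  carrier := {p | ρ.Compatible l p.1 p.2}
  zero_mem' := fun d => by simp
  add_mem' := fun {p q} hp hq d => by
    have h1 := hp d
    have h2 := hq d
    simp only [Prod.fst_add, Prod.snd_add, Pi.add_apply]
    linear_combination h1 + h2
  smul_mem' := fun a p hp d => by
    have h1 := hp d
    simp only [Prod.smul_fst, Prod.smul_snd, Pi.smul_apply, smul_eq_mul]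
    linear_combination a * h1

/-- Two projections of the space `Q` of compatible pairs are compared. The map `π` to `z` has range
the kernel of the Laplacian, and `θ`, sending a pair to `z + ε` on darts, has range the functions on
the cells. Both kernels are lines, spanned by `(0, 1)` and `(1, 1)` respectively. So the number of
cells equals the nullity of the Laplacian. -/
theorem card_face_signed (h : ρ.IsPlaneCubic) (l : G.edgeSet → ℤˣ) :
    Fintype.card (ρ.signed l).Face + (ρ.lap l).rank = Fintype.card ρ.untwisted.Face := by
  classical
  obtain ⟨v0⟩ := h.conn.nonempty
  obtain ⟨f0⟩ := h.face_nonempty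
  let Q := compatibleSubmodule ρ l
  let π : Q →ₗ[ZMod 2] (ρ.untwisted.Face → ZMod 2) := (LinearMap.fst _ _ _).comp Q.subtype
  let θ : Q →ₗ[ZMod 2] (G.Dart → ZMod 2) :=
    { toFun := fun p d => p.1.1 (ρ.left d) + p.1.2 d.fst
      map_add' := fun p q => by
        ext d
        simp only [Submodule.coe_add, Prod.fst_add, Prod.snd_add, Pi.add_apply]
        ring
      map_smul' := fun a p => by
        ext d
        simp only [Submodule.coe_smul, Prod.smul_fst, Prod.smul_snd, Pi.smul_apply, smul_eq_mul,
          RingHom.id_apply]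
        ring }
  let κ : ((ρ.signed l).Face → ZMod 2) →ₗ[ZMod 2] (G.Dart → ZMod 2) :=
    LinearMap.pi fun d => LinearMap.proj ((ρ.signed l).face (d, 1))
  have hθ : ∀ (p : Q) d, θ p d = p.1.1 (ρ.left d) + p.1.2 d.fst := fun p d => rfl
  have hκ : ∀ c d, κ c d = c ((ρ.signed l).face (d, 1)) := fun c d => rfl
  have hκinj : LinearMap.ker κ = ⊥ := by
    rw [LinearMap.ker_eq_bot']
    intro c hc
    ext f
    obtain ⟨⟨d, s⟩, rfl⟩ := (ρ.signed l).face_surjective f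
    rcases Int.units_eq_one_or s with rfl | rfl
    · exact congrFun hc d
    · rw [Embedding.face_neg_one]
      exact congrFun hc _
  have hrange : LinearMap.range θ = LinearMap.range κ := by
    apply le_antisymm
    · rintro _ ⟨⟨⟨z, ε⟩, hp⟩, rfl⟩
      obtain ⟨c, hc⟩ := Compatible.exists_face_function hp
      exact ⟨c, funext fun d => hc d 1⟩
    · rintro _ ⟨c, rfl⟩
      obtain ⟨z, ε, hQ, hc⟩ := h.exists_compatible l c
      exact ⟨⟨(z, ε), hQ⟩, funext fun d => (hc d).symm⟩
  have hπ : LinearMap.range π = LinearMap.ker (ρ.lap l).mulVecLin := by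
    ext z
    rw [LinearMap.mem_ker, Matrix.mulVecLin_apply, h.lap_mulVec_eq_zero_iff]
    constructor
    · rintro ⟨⟨⟨z, ε⟩, hp⟩, rfl⟩
      exact ⟨ε, hp⟩
    · rintro ⟨ε, hε⟩
      exact ⟨⟨(z, ε), hε⟩, rfl⟩
  have kπ : Module.finrank (ZMod 2) (LinearMap.ker π) = 1 := by
    rw [finrank_eq_one_iff']
    have hm : ((0 : ρ.untwisted.Face → ZMod 2), fun _ : V => (1 : ZMod 2)) ∈ Q := fun d => by
      simp [CharTwo.add_self_eq_zero]
    refine ⟨⟨⟨_, hm⟩, rfl⟩, ?_, ?_⟩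
    · intro h0
      have := congrFun (congrArg (fun p => p.1.1.2) h0) v0
      exact one_ne_zero this
    · rintro ⟨⟨⟨z, ε⟩, hp⟩, hz⟩
      have hz0 : z = 0 := hz
      subst hz0
      refine ⟨ε v0, Subtype.ext (Subtype.ext (Prod.ext ?_ (funext fun v => ?_)))⟩
      · simp
      · refine (mul_one (ε v0)).trans (h.conn.eq_of_dart (fun d => ?_) v0 v)
        have := hp d
        simpa [CharTwo.add_eq_zero] using this
  have kθ : Module.finrank (ZMod 2) (LinearMap.ker θ) = 1 := by
    rw [finrank_eq_one_iff']
    have hm : ((fun _ => 1 : ρ.untwisted.Face → ZMod 2), fun _ : V => (1 : ZMod 2)) ∈ Q :=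
      fun d => by simp [CharTwo.add_self_eq_zero]
    refine ⟨⟨⟨_, hm⟩, ?_⟩, ?_, ?_⟩
    · rw [LinearMap.mem_ker]
      ext d
      rw [hθ]
      exact CharTwo.add_self_eq_zero _
    · intro h0
      have := congrFun (congrArg (fun p => p.1.1.2) h0) v0
      exact one_ne_zero this
    · rintro ⟨⟨⟨z, ε⟩, hp⟩, hz⟩
      have hk : ∀ d : G.Dart, z (ρ.left d) = ε d.fst := fun d =>
        CharTwo.add_eq_zero.1 (congrFun hz d)
      have hzc := h.eq_of_left_eq z (fun d => by
        rw [← left_perm, hk, hk, ρ.fst_perm])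
      refine ⟨z f0, Subtype.ext (Subtype.ext (Prod.ext (funext fun f => ?_) (funext fun v => ?_)))⟩
      · exact (mul_one (z f0)).trans (hzc _ _)
      · refine (mul_one (z f0)).trans ?_
        obtain ⟨d, rfl⟩ := exists_dart_fst h.cubic v
        exact (hzc _ _).trans (hk d)
  have e1 := LinearMap.finrank_range_add_finrank_ker π
  have e2 := LinearMap.finrank_range_add_finrank_ker θ
  have e3 := LinearMap.finrank_range_add_finrank_ker κ
  have e4 := LinearMap.finrank_range_add_finrank_ker (ρ.lap l).mulVecLin
  rw [hκinj, finrank_bot, Module.finrank_fintype_fun_eq_card] at e3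
  rw [Module.finrank_fintype_fun_eq_card] at e4
  rw [hπ] at e1
  rw [hrange] at e2
  change (ρ.lap l).rank + _ = _ at e4
  omega

/-- The Euler genus of an embedding is the rank modulo two of the Laplacian of the graph dual to
its twisted edges. -/
theorem eulerChar_signed (h : ρ.IsPlaneCubic) (l : G.edgeSet → ℤˣ) :
    (ρ.signed l).eulerChar = 2 - ((ρ.lap l).rank : ℤ) := by
  have h1 := h.card_face_signed l
  have h2 := h.card_eq
  unfold Embedding.eulerChar
  simp only [Nat.card_eq_fintype_card]
  omega

open scoped Classical in
/-- Strong embeddings in terms of the Laplacian of the twisted graph. -/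
theorem isStrong_signed (h : ρ.IsPlaneCubic) (l : G.edgeSet → ℤˣ) :
    (ρ.signed l).IsStrong ↔ ∀ f g, ρ.dual.Adj f g →
      (Pi.single f 1 + Pi.single g 1 : ρ.untwisted.Face → ZMod 2) ∉
        LinearMap.range (ρ.lap l).mulVecLin := by
  have hside : ∀ d, ((ρ.signed l).face (d, 1) ≠ (ρ.signed l).face (d, -1)) ↔
      (Pi.single (ρ.left d) 1 + Pi.single (ρ.left d.symm) 1 : ρ.untwisted.Face → ZMod 2) ∉
        LinearMap.range (ρ.lap l).mulVecLin := by
    intro d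
    -- By orthogonality the pair of sides lies outside the range iff some kernel vector takes
    -- different values on them. Such a vector comes from a function on the cells that distinguishes
    -- the two sides of `d` near its tail.
    rw [mem_range_mulVecLin_iff (ρ.lap_isSymm l)]
    push Not
    constructor
    · intro hne
      obtain ⟨z, ε, hQ, hc⟩ := h.exists_compatible l
        (Pi.single ((ρ.signed l).face (d, 1)) 1)
      refine ⟨z, (h.lap_mulVec_eq_zero_iff l z).2 ⟨ε, hQ⟩, ?_⟩
      have h1 := hc d
      have h2 := hc (ρ.perm d)
      change _ ≠ (ρ.signed l).face (d, -1) at hne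
      rw [Embedding.face_neg_one] at hne
      change _ ≠ (ρ.signed l).face (ρ.perm d, 1) at hne
      rw [Pi.single_eq_of_ne hne.symm, left_perm, ρ.fst_perm] at h2
      rw [Pi.single_eq_same] at h1
      rw [add_dotProduct, single_one_dotProduct, single_one_dotProduct]
      generalize z (ρ.left d) = a at *
      generalize z (ρ.left d.symm) = b at *
      generalize ε d.fst = c at *
      revert h1 h2; clear * -; revert a b c; decide
    · rintro ⟨z, hz, hne⟩ heq
      obtain ⟨ε, hε⟩ := (h.lap_mulVec_eq_zero_iff l z).1 hz
      obtain ⟨c, hc⟩ := hε.exists_face_function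
      have h1 := hc d 1
      rw [heq, hc d (-1), add_left_inj, face_neg_one_eq] at h1
      apply hne
      rw [add_dotProduct, single_one_dotProduct, single_one_dotProduct, h1]
      exact CharTwo.add_self_eq_zero _
  rw [Embedding.isStrong_iff _ h.cubic]
  simp only [hside]
  constructor
  · rintro hd f g hfg
    obtain ⟨-, d, rfl, rfl⟩ := ρ.dual_adj_iff.1 hfg
    exact hd d
  · intro hfg d
    exact hfg _ _ (h.dual_adj d)

/-- The embedding is orientable iff the Laplacian of the twisted graph has zero diagonal. -/
theorem orientable_signed (h : ρ.IsPlaneCubic) (l : G.edgeSet → ℤˣ) :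
    (ρ.signed l).Orientable ↔ ∀ f, ρ.lap l f f = 0 := by
  classical
  -- A diagonal entry is a degree modulo two, the parity of the number of twisted edges on a face.
  -- All parities vanish iff the twisted edges form a cut, and the sides of this cut are the local
  -- orientations.
  have hdiag : ∀ f, ρ.lap l f f =
      ∑ d ∈ Finset.univ.filter (fun d : G.Dart => ρ.left d = f), ρ.twistInd l d := by
    intro f
    have h1 := h.sum_twisted l (fun _ => 1) f
    simp only [mul_one] at h1
    rw [h1, lap, lapMatrix]
    simp [degMatrix, card_neighborFinset_eq_degree]
  simp only [hdiag]
  constructor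
  · rintro ⟨ε, hε⟩ f
    rw [← ρ.sum_left_coboundary (fun v => if ε v = -1 then 1 else 0) f]
    refine Finset.sum_congr rfl fun d _ => ?_
    have h1 : (ρ.signed l).sgn d = ε d.fst * ε d.snd := hε d
    rw [twistInd, h1]
    rcases Int.units_eq_one_or (ε d.fst) with h2 | h2 <;>
      rcases Int.units_eq_one_or (ε d.snd) with h3 | h3 <;> rw [h2, h3] <;> decide
  · intro hf
    obtain ⟨ε, hε⟩ := h.exists_vertex_potential (ρ.twistInd l) (ρ.twistInd_symm l) hf
    refine ⟨fun v => if ε v = 1 then -1 else 1, fun d => ?_⟩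
    have h1 := hε d
    change (ρ.signed l).sgn d = (if ε d.fst = 1 then -1 else 1) * (if ε d.snd = 1 then -1 else 1)
    rw [twistInd] at h1
    rcases Int.units_eq_one_or ((ρ.signed l).sgn d) with h2 | h2 <;> rw [h2] at h1 ⊢ <;>
    · revert h1
      generalize ε d.fst = a
      generalize ε d.snd = b
      clear * -
      revert a b; decide

end IsPlaneCubic

end RotationSystem

end StrongEmb

namespace StrongEmb

open SimpleGraph

/-! ### Symmetric matrices of small rank over the field with two elements -/

section SymmetricMatrix

variable {n : Type*} [Fintype n] {M : Matrix n n (ZMod 2)}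

open Matrix

theorem rank_add_finrank_ker (M : Matrix n n (ZMod 2)) :
    M.rank + Module.finrank (ZMod 2) (LinearMap.ker M.mulVecLin) = Fintype.card n := by
  have h := LinearMap.finrank_range_add_finrank_ker M.mulVecLin
  rwa [Module.finrank_fintype_fun_eq_card] at h

theorem eq_zero_of_rank_eq_zero (h : M.rank = 0) : M = 0 := by
  classical
  have h1 : LinearMap.range M.mulVecLin = ⊥ := Submodule.finrank_eq_zero.1 h
  rw [LinearMap.range_eq_bot] at h1
  ext i j
  have h2 := congrFun (LinearMap.congr_fun h1 (Pi.single j 1)) i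
  simpa [Matrix.mulVecLin_apply, Matrix.mulVec_single_one] using h2

theorem mulVec_vecMulVec (x y z : n → ZMod 2) :
    (vecMulVec x y).mulVec z = (y ⬝ᵥ z) • x := by
  ext i
  simp only [mulVec, dotProduct, vecMulVec_apply, Pi.smul_apply, smul_eq_mul, Finset.sum_mul]
  exact Finset.sum_congr rfl fun j _ => by ring

theorem col_dotProduct (hM : M.IsSymm) (i : n) (z : n → ZMod 2) :
    M.col i ⬝ᵥ z = M.mulVec z i := by
  rw [mulVec]
  congr 1
  ext j
  exact (hM.apply j i).symm

theorem col_mem_range (M : Matrix n n (ZMod 2)) (i : n) :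
    M.col i ∈ LinearMap.range M.mulVecLin := by
  classical
  exact ⟨Pi.single i 1, by rw [mulVecLin_apply, mulVec_single_one]⟩

theorem fun_add_self {n : Type*} (x : n → ZMod 2) : x + x = 0 :=
  funext fun _ => CharTwo.add_self_eq_zero _

/-- Symmetric elimination with pivot `M i i`: the kernel of `M` survives and the basis vector `e_i`
joins it. -/
theorem rank_add_vecMulVec_lt (hM : M.IsSymm) {i : n} (hi : M i i = 1) :
    (M + vecMulVec (M.col i) (M.col i)).rank < M.rank := by
  classical
  have hlt : LinearMap.ker M.mulVecLin <
      LinearMap.ker (M + vecMulVec (M.col i) (M.col i)).mulVecLin := by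
    refine lt_of_le_of_ne ?_ ?_
    · intro z hz
      rw [LinearMap.mem_ker, mulVecLin_apply] at hz ⊢
      rw [add_mulVec, mulVec_vecMulVec, col_dotProduct hM, hz]
      simp
    · intro heq
      have h1 : Pi.single i 1 ∈ LinearMap.ker (M + vecMulVec (M.col i) (M.col i)).mulVecLin := by
        rw [LinearMap.mem_ker, mulVecLin_apply, add_mulVec, mulVec_vecMulVec, mulVec_single_one,
          dotProduct_single_one, col_apply, hi, one_smul, fun_add_self]
      rw [← heq, LinearMap.mem_ker, mulVecLin_apply, mulVec_single_one] at h1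
      have := congrFun h1 i
      rw [col_apply, hi] at this
      exact one_ne_zero this
  have := Submodule.finrank_lt_finrank_of_lt hlt
  have h1 := rank_add_finrank_ker M
  have h2 := rank_add_finrank_ker (M + vecMulVec (M.col i) (M.col i))
  omega

/-- Elimination of a hyperbolic pair from an alternating matrix: the kernel of `M` survives, and
`e_i` and `e_j` join it independently. -/
theorem rank_add_vecMulVec_add_lt (hM : M.IsSymm) (hd : ∀ i, M i i = 0) {i j : n}
    (hij : M i j = 1) :
    (M + (vecMulVec (M.col i) (M.col j) + vecMulVec (M.col j) (M.col i))).rank + 2 ≤ M.rank := by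
  classical
  set N := M + (vecMulVec (M.col i) (M.col j) + vecMulVec (M.col j) (M.col i)) with hN
  have hji : M j i = 1 := by rw [hM.apply]; exact hij
  have hlt : LinearMap.ker M.mulVecLin <
      LinearMap.ker M.mulVecLin ⊔ Submodule.span (ZMod 2) {Pi.single i 1} := by
    refine lt_of_le_of_ne le_sup_left fun heq => ?_
    have h1 : Pi.single i 1 ∈ LinearMap.ker M.mulVecLin := by
      rw [heq]
      exact Submodule.mem_sup_right (Submodule.mem_span_singleton_self _)
    rw [LinearMap.mem_ker, mulVecLin_apply, mulVec_single_one] at h1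
    have := congrFun h1 j
    rw [col_apply, hji] at this
    exact one_ne_zero this
  have hlt2 : LinearMap.ker M.mulVecLin ⊔ Submodule.span (ZMod 2) {Pi.single i 1} <
      LinearMap.ker N.mulVecLin := by
    refine lt_of_le_of_ne (sup_le ?_ ?_) fun heq => ?_
    · intro z hz
      rw [LinearMap.mem_ker, mulVecLin_apply] at hz ⊢
      rw [hN, add_mulVec, add_mulVec, mulVec_vecMulVec, mulVec_vecMulVec, col_dotProduct hM,
        col_dotProduct hM, hz]
      simp
    · rw [Submodule.span_singleton_le_iff_mem, LinearMap.mem_ker, mulVecLin_apply, hN, add_mulVec,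
        add_mulVec, mulVec_vecMulVec, mulVec_vecMulVec, mulVec_single_one, dotProduct_single_one,
        dotProduct_single_one, col_apply, col_apply, hd, hij, one_smul, zero_smul, add_zero,
        fun_add_self]
    · have h1 : Pi.single j 1 ∈ LinearMap.ker N.mulVecLin := by
        rw [LinearMap.mem_ker, mulVecLin_apply, hN, add_mulVec,
          add_mulVec, mulVec_vecMulVec, mulVec_vecMulVec, mulVec_single_one, dotProduct_single_one,
          dotProduct_single_one, col_apply, col_apply, hd, hji, one_smul, zero_smul, zero_add,
          fun_add_self]
      rw [← heq, Submodule.mem_sup] at h1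
      obtain ⟨k, hk, e, he, hke⟩ := h1
      obtain ⟨a, rfl⟩ := Submodule.mem_span_singleton.1 he
      have h2 := congrArg (fun v => M.mulVec v i) hke
      rw [LinearMap.mem_ker, mulVecLin_apply] at hk
      simp only [mulVec_add, mulVec_smul, mulVec_single_one, hk] at h2
      simp [hd, hij] at h2
  have h1 := Submodule.finrank_lt_finrank_of_lt hlt
  have h2 := Submodule.finrank_lt_finrank_of_lt hlt2
  have h3 := rank_add_finrank_ker M
  have h4 := rank_add_finrank_ker N
  omega

theorem zmod_two_eq_one {a : ZMod 2} (h : a ≠ 0) : a = 1 := by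
  revert a; decide

theorem exists_diag_of_rank_eq_one (hM : M.IsSymm) (h : M.rank = 1) : ∃ i, M i i = 1 := by
  by_contra hne
  push Not at hne
  have hd : ∀ i, M i i = 0 := fun i => by
    by_contra h0
    exact hne i (zmod_two_eq_one h0)
  obtain ⟨i, j, hij⟩ : ∃ i j, M i j = 1 := by
    by_contra h0
    push Not at h0
    have : M = 0 := by
      ext i j
      by_contra h1
      exact h0 i j (zmod_two_eq_one h1)
    rw [this, rank_zero] at h
    exact zero_ne_one h
  have := rank_add_vecMulVec_add_lt hM hd hij
  omega

theorem eq_of_add_eq_zero {n : Type*} (A B : Matrix n n (ZMod 2)) (h : A + B = 0) : A = B := by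
  ext i j
  have := congrFun (congrFun h i) j
  exact CharTwo.add_eq_zero.1 this

/-- That `x` lies in the range is recorded, here and for rank two, because strength is a condition
on the range. -/
theorem exists_of_rank_one (hM : M.IsSymm) (h : M.rank = 1) :
    ∃ x : n → ZMod 2, M = vecMulVec x x ∧ x ∈ LinearMap.range M.mulVecLin := by
  obtain ⟨i, hi⟩ := exists_diag_of_rank_eq_one hM h
  have h1 := rank_add_vecMulVec_lt hM hi
  exact ⟨M.col i, eq_of_add_eq_zero _ _ (eq_zero_of_rank_eq_zero (by omega)), col_mem_range M i⟩

theorem exists_of_rank_two_of_diag (hM : M.IsSymm) (h : M.rank = 2) (hd : ∀ i, M i i = 0) :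
    ∃ x y : n → ZMod 2, M = vecMulVec x y + vecMulVec y x ∧
      x ∈ LinearMap.range M.mulVecLin ∧ y ∈ LinearMap.range M.mulVecLin := by
  obtain ⟨i, j, hij⟩ : ∃ i j, M i j = 1 := by
    by_contra h0
    push Not at h0
    have : M = 0 := by
      ext i j
      by_contra h1
      exact h0 i j (zmod_two_eq_one h1)
    rw [this, rank_zero] at h
    exact absurd h (by norm_num)
  have h1 := rank_add_vecMulVec_add_lt hM hd hij
  exact ⟨M.col i, M.col j, eq_of_add_eq_zero _ _ (eq_zero_of_rank_eq_zero (by omega)),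
    col_mem_range M i, col_mem_range M j⟩

theorem exists_of_rank_two (hM : M.IsSymm) (h : M.rank = 2) (hd : ¬ ∀ i, M i i = 0) :
    ∃ x y : n → ZMod 2, M = vecMulVec x x + vecMulVec y y ∧
      x ∈ LinearMap.range M.mulVecLin ∧ y ∈ LinearMap.range M.mulVecLin := by
  push Not at hd
  obtain ⟨i, hi⟩ := hd
  have hi := zmod_two_eq_one hi
  have h1 := rank_add_vecMulVec_lt hM hi
  set N := M + vecMulVec (M.col i) (M.col i) with hN
  have hMN : M = vecMulVec (M.col i) (M.col i) + N := by
    ext a b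
    simp only [hN, Matrix.add_apply]
    generalize M a b = p
    generalize vecMulVec (M.col i) (M.col i) a b = q
    revert p q; decide
  have hNs : N.IsSymm := by
    refine hM.add ?_
    ext a b
    simp [vecMulVec_apply, mul_comm]
  have hN1 : N.rank = 1 := by
    -- If the remainder `N` vanished, `M` would be an outer product, of rank at most one.
    by_contra h0
    have : N = 0 := eq_zero_of_rank_eq_zero (by omega)
    rw [this, add_zero] at hMN
    have h2 := rank_vecMulVec_le (M.col i) (M.col i)
    rw [← hMN] at h2
    omega
  obtain ⟨y, hy, w, hw⟩ := exists_of_rank_one hNs hN1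
  refine ⟨M.col i, y, by rw [← hy]; exact hMN, col_mem_range M i, ?_⟩
  -- `N w` differs from `M w` by a multiple of a column of `M`, so it stays in the range of `M`.
  rw [← hw, mulVecLin_apply, hN, add_mulVec, mulVec_vecMulVec]
  exact add_mem ⟨w, rfl⟩ (Submodule.smul_mem _ _ (col_mem_range M i))

end SymmetricMatrix

/-! ### Excluded subgraphs of the dual graph -/

namespace RotationSystem.IsPlaneCubic

variable {V : Type u} [Fintype V] {G : SimpleGraph V} [DecidableRel G.Adj] {ρ : RotationSystem G}

open scoped Classical in
/-- The edges on which a function on the darts does not vanish. -/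
noncomputable def edgeSupport (w : G.Dart → ZMod 2) : Finset G.edgeSet :=
  Finset.univ.filter fun e => w (someDart e) = 1

theorem mem_edgeSupport {w : G.Dart → ZMod 2} (hw : ∀ d, w d.symm = w d) {d : G.Dart} :
    (⟨d.edge, d.edge_mem⟩ : G.edgeSet) ∈ edgeSupport w ↔ w d = 1 := by
  simp only [edgeSupport, Finset.mem_filter, Finset.mem_univ, true_and]
  have h4 : (someDart ⟨d.edge, d.edge_mem⟩).edge = d.edge := someDart_edge _
  rcases (dart_edge_eq_iff _ _).1 h4 with h5 | h5
  · rw [h5]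
  · rw [h5, hw]

open scoped Classical in
theorem exists_ne_dart_of_even {w : G.Dart → ZMod 2}
    (heven : ∀ f, ∑ d ∈ Finset.univ.filter (fun d : G.Dart => ρ.left d = f), w d = 0)
    {d : G.Dart} (hd : w d = 1) : ∃ d', ρ.left d' = ρ.left d ∧ d' ≠ d ∧ w d' = 1 := by
  by_contra hne
  push Not at hne
  have h1 := heven (ρ.left d)
  rw [Finset.sum_eq_single d] at h1
  · rw [hd] at h1; exact one_ne_zero h1
  · intro d' hd' hne'
    by_contra h0
    exact hne d' (Finset.mem_filter.1 hd').2 hne' (zmod_two_eq_one h0)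
  · intro h0
    simp at h0

open scoped Classical in
-- A nonzero even set of dual edges continues beyond both ends of each of its edges, and the dual
-- graph is simple. So three different edges occur.
theorem three_le_card_edgeSupport (h : ρ.IsPlaneCubic) {w : G.Dart → ZMod 2}
    (hw : ∀ d, w d.symm = w d)
    (heven : ∀ f, ∑ d ∈ Finset.univ.filter (fun d : G.Dart => ρ.left d = f), w d = 0)
    {d : G.Dart} (hd : w d = 1) : 3 ≤ (edgeSupport w).card := by
  obtain ⟨d1, hl1, hn1, hw1⟩ := exists_ne_dart_of_even heven hd
  obtain ⟨d2, hl2, hn2, hw2⟩ := exists_ne_dart_of_even heven (d := d.symm) (by rw [hw, hd])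
  have h0 := h.left_ne d
  have h01 : d.edge ≠ d1.edge := by
    rw [ne_eq, dart_edge_eq_iff, not_or]
    refine ⟨hn1.symm, fun h' => h0 ?_⟩
    rw [← hl1, h', Dart.symm_symm]
  have h02 : d.edge ≠ d2.edge := by
    rw [ne_eq, dart_edge_eq_iff, not_or]
    refine ⟨fun h' => h0 ?_, fun h' => hn2 ?_⟩
    · rw [← hl2, h']
    · rw [h', Dart.symm_symm]
  have h12 : d1.edge ≠ d2.edge := by
    rw [ne_eq, dart_edge_eq_iff, not_or]
    refine ⟨fun h' => h0 ?_, fun h' => hn1 ?_⟩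
    · rw [← hl2, ← hl1, h']
    · refine h.dart_eq_of_left _ _ hl1 ?_
      rw [h', Dart.symm_symm, hl2]
  have hsub : ({⟨d.edge, d.edge_mem⟩, ⟨d1.edge, d1.edge_mem⟩, ⟨d2.edge, d2.edge_mem⟩} :
      Finset G.edgeSet) ⊆ edgeSupport w := by
    intro e he
    simp only [Finset.mem_insert, Finset.mem_singleton] at he
    rcases he with rfl | rfl | rfl <;> rw [mem_edgeSupport hw] <;> assumption
  refine le_trans (le_of_eq ?_) (Finset.card_le_card hsub)
  symm
  rw [Finset.card_eq_three]
  exact ⟨_, _, _, by simpa using h01, by simpa using h02, by simpa using h12, rfl⟩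

open scoped Classical in
-- The girth bound in the bipartite case: `d1` and `d2` continue `d` at its two sides, and `d3`
-- continues `d1` at its far side.
theorem four_le_card_edgeSupport (h : ρ.IsPlaneCubic) {w : G.Dart → ZMod 2}
    (hw : ∀ d, w d.symm = w d)
    (heven : ∀ f, ∑ d ∈ Finset.univ.filter (fun d : G.Dart => ρ.left d = f), w d = 0)
    (A : Set ρ.untwisted.Face)
    (hA : ∀ d, w d = 1 → (ρ.left d ∈ A ↔ ρ.left d.symm ∉ A))
    {d : G.Dart} (hd : w d = 1) : 4 ≤ (edgeSupport w).card := by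
  obtain ⟨d1, hl1, hn1, hw1⟩ := exists_ne_dart_of_even heven hd
  obtain ⟨d2, hl2, hn2, hw2⟩ := exists_ne_dart_of_even heven (d := d.symm) (by rw [hw, hd])
  obtain ⟨d3, hl3, hn3, hw3⟩ := exists_ne_dart_of_even heven (d := d1.symm) (by rw [hw, hw1])
  have h0 := h.left_ne d
  have h1 := h.left_ne d1
  have hne : ρ.left d1.symm ≠ ρ.left d.symm := fun h' => hn1 (h.dart_eq_of_left _ _ hl1 h')
  have h01 : d.edge ≠ d1.edge := by
    rw [ne_eq, dart_edge_eq_iff, not_or]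
    refine ⟨hn1.symm, fun h' => h0 ?_⟩
    rw [← hl1, h', Dart.symm_symm]
  have h02 : d.edge ≠ d2.edge := by
    rw [ne_eq, dart_edge_eq_iff, not_or]
    refine ⟨fun h' => h0 ?_, fun h' => hn2 ?_⟩
    · rw [← hl2, h']
    · rw [h', Dart.symm_symm]
  have h12 : d1.edge ≠ d2.edge := by
    rw [ne_eq, dart_edge_eq_iff, not_or]
    refine ⟨fun h' => h0 ?_, fun h' => hn1 ?_⟩
    · rw [← hl2, ← hl1, h']
    · refine h.dart_eq_of_left _ _ hl1 ?_
      rw [h', Dart.symm_symm, hl2]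
  have h03 : d.edge ≠ d3.edge := by
    rw [ne_eq, dart_edge_eq_iff, not_or]
    refine ⟨fun h' => h1 ?_, fun h' => hne ?_⟩
    · rw [hl1, ← hl3, h']
    · rw [← hl3, h', Dart.symm_symm]
  have h13 : d1.edge ≠ d3.edge := by
    rw [ne_eq, dart_edge_eq_iff, not_or]
    refine ⟨fun h' => h1 ?_, fun h' => hn3 ?_⟩
    · rw [← hl3, h']
    · rw [h', Dart.symm_symm]
  have h23 : d2.edge ≠ d3.edge := by
    rw [ne_eq, dart_edge_eq_iff, not_or]
    refine ⟨fun h' => hne ?_, fun h' => ?_⟩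
    · rw [← hl3, ← h', hl2]
    -- If `d2` and `d3` were the same edge, `d`, `d1` and `d2` would close a triangle, against the
    -- bipartition `A`.
    · have e0 := hA d hd
      have e1 := hA d1 hw1
      have e2 := hA d2 hw2
      rw [h', Dart.symm_symm, hl3, ← h', hl2] at e2
      rw [hl1] at e1
      tauto
  have hsub : ({⟨d.edge, d.edge_mem⟩, ⟨d1.edge, d1.edge_mem⟩, ⟨d2.edge, d2.edge_mem⟩,
      ⟨d3.edge, d3.edge_mem⟩} : Finset G.edgeSet) ⊆ edgeSupport w := by
    intro e he
    simp only [Finset.mem_insert, Finset.mem_singleton] at he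
    rcases he with rfl | rfl | rfl | rfl <;> rw [mem_edgeSupport hw] <;> assumption
  refine le_trans (le_of_eq ?_) (Finset.card_le_card hsub)
  symm
  rw [Finset.card_eq_succ]
  refine ⟨_, _, ?_, rfl, ?_⟩
  · simp [h01, h02, h03]
  · rw [Finset.card_eq_three]
    exact ⟨_, _, _, by simpa using h12, by simpa using h13, by simpa using h23, rfl⟩

end RotationSystem.IsPlaneCubic

end StrongEmb

/-! ### Euler's inequality for subgraphs of the dual graph, excluding `K₅` and `K₃,₃`. -/

namespace StrongEmb

open SimpleGraph

namespace RotationSystem.IsPlaneCubic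

variable {V : Type u} [Fintype V] {G : SimpleGraph V} [DecidableRel G.Adj] {ρ : RotationSystem G}

/-- The spanning subgraph of the edges outside a given edge set. -/
def avoid (t : G.Dart → Prop) : SimpleGraph V := SimpleGraph.fromRel
  fun u v => ∃ d : G.Dart, d.fst = u ∧ d.snd = v ∧ ¬ t d

theorem avoid_comp_eq {V : Type u} {G : SimpleGraph V} {t : G.Dart → Prop} {d : G.Dart}
    (hd : ¬ t d) : (avoid t).connectedComponentMk d.fst = (avoid t).connectedComponentMk d.snd := by
  refine ConnectedComponent.connectedComponentMk_eq_of_adj ?_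
  rw [avoid, fromRel_adj]
  exact ⟨d.fst_ne_snd, Or.inl ⟨d, rfl, rfl, hd⟩⟩

theorem exists_factor {V : Type u} {G : SimpleGraph V} {t : G.Dart → Prop} {ε : V → ZMod 2}
    (hε : ∀ d, ¬ t d → ε d.fst = ε d.snd) :
    ∃ ε' : (avoid t).ConnectedComponent → ZMod 2,
      ∀ v, ε v = ε' ((avoid t).connectedComponentMk v) := by
  have hadj : ∀ u v, (avoid t).Adj u v → ε u = ε v := by
    intro u v huv
    rw [avoid, fromRel_adj] at huv
    rcases huv.2 with ⟨d, rfl, rfl, hd⟩ | ⟨d, rfl, rfl, hd⟩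
    · exact hε d hd
    · exact (hε d hd).symm
  refine ⟨ConnectedComponent.lift ε ?_, fun v => rfl⟩
  intro u v p hp
  clear hp
  induction p with
  | nil => rfl
  | cons huv _ ih => exact (hadj _ _ huv).trans ih

open scoped Classical in
/-- Euler's bound for a subgraph `t` of the dual graph with vertices in `A` all of whose cycles
have length at least `g`. -/
theorem edge_bound (h : ρ.IsPlaneCubic) (A : Finset ρ.untwisted.Face) (hA : A.Nonempty)
    (t : G.Dart → Prop) (ht : ∀ d, t d.symm ↔ t d) (htA : ∀ d, t d → ρ.left d ∈ A) (g : ℕ)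
    (hg : ∀ w : G.Dart → ZMod 2, (∀ d, w d.symm = w d) →
      (∀ f, ∑ d ∈ Finset.univ.filter (fun d : G.Dart => ρ.left d = f), w d = 0) →
      (∀ d, w d = 1 → t d) → (∃ d, w d = 1) → g ≤ (edgeSupport w).card) :
    Fintype.card {e : G.edgeSet // t (someDart e)} + 1 ≤ A.card ∨
      g * (Fintype.card {e : G.edgeSet // t (someDart e)} + 2 - A.card) ≤
        2 * Fintype.card {e : G.edgeSet // t (someDart e)} := by
  set m := Fintype.card {e : G.edgeSet // t (someDart e)} with hm
  -- The components of `avoid t` play the role of the regions into which the subgraph `t` divides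
  -- the sphere. `Δ` is the coboundary from regions to edges of `t`, and `bd` the boundary from
  -- edges to vertices in `A`.
  let comp : V → (avoid t).ConnectedComponent := (avoid t).connectedComponentMk
  let Δ : ((avoid t).ConnectedComponent → ZMod 2) →ₗ[ZMod 2]
      ({e : G.edgeSet // t (someDart e)} → ZMod 2) :=
    { toFun := fun ε e => ε (comp (someDart e.1).fst) + ε (comp (someDart e.1).snd)
      map_add' := fun a b => by ext e; simp only [Pi.add_apply]; ring
      map_smul' := fun a b => by
        ext e; simp only [Pi.smul_apply, smul_eq_mul, RingHom.id_apply]; ring }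
  let b : ρ.untwisted.Face → G.edgeSet → ZMod 2 := incidence ρ.left
  let bd : ({e : G.edgeSet // t (someDart e)} → ZMod 2) →ₗ[ZMod 2] (A → ZMod 2) :=
    { toFun := fun w f => ∑ e, b f e.1 * w e
      map_add' := fun x y => by
        ext f; simp only [Pi.add_apply, mul_add, Finset.sum_add_distrib]
      map_smul' := fun a x => by
        ext f
        simp only [Pi.smul_apply, smul_eq_mul, RingHom.id_apply, Finset.mul_sum]
        exact Finset.sum_congr rfl fun _ _ => by ring }
  let s : (A → ZMod 2) →ₗ[ZMod 2] ZMod 2 := ∑ f, LinearMap.proj f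
  have hs : ∀ y, s y = ∑ f, y f := fun y => by simp [s]
  have hbd : LinearMap.range bd ≤ LinearMap.ker s := by
    rintro _ ⟨w, rfl⟩
    rw [LinearMap.mem_ker, hs]
    change ∑ f : A, ∑ e : {e : G.edgeSet // t (someDart e)}, b f e.1 * w e = 0
    rw [Finset.sum_comm]
    refine Finset.sum_eq_zero fun e _ => ?_
    rw [← Finset.sum_mul]
    have : ∑ f : A, b f e.1 = 0 := by
      have h1 : ∑ f : A, b f e.1 = ∑ f ∈ A, b f e.1 := Finset.sum_coe_sort A fun f => b f e.1
      rw [h1]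
      simp only [b, incidence, Finset.sum_add_distrib, Finset.sum_ite_eq]
      rw [if_pos (htA _ e.2), if_pos (htA _ ((ht _).2 e.2))]
      exact CharTwo.add_self_eq_zero _
    rw [this, zero_mul]
  have hks : Module.finrank (ZMod 2) (LinearMap.ker s) < A.card := by
    have h1 : LinearMap.ker s < ⊤ := by
      rw [lt_top_iff_ne_top]
      intro htop
      obtain ⟨f, hf⟩ := hA
      have h2 : (Pi.single (⟨f, hf⟩ : A) 1 : A → ZMod 2) ∈ LinearMap.ker s := by rw [htop]; trivial
      rw [LinearMap.mem_ker, hs, Finset.sum_pi_single'] at h2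
      simp at h2
    have h2 := Submodule.finrank_lt_finrank_of_lt h1
    rw [finrank_top, Module.finrank_fintype_fun_eq_card, Fintype.card_coe] at h2
    exact h2
  -- A cycle of `t`, extended by zero, is a cut of the graph. Its potential does not change along
  -- edges outside `t`, so it factors through the regions.
  have hker : LinearMap.ker bd ≤ LinearMap.range Δ := by
    intro w hw
    let U : G.edgeSet → ZMod 2 := fun e => if he : t (someDart e) then w ⟨e, he⟩ else 0
    let W : G.Dart → ZMod 2 := fun d => U ⟨d.edge, d.edge_mem⟩
    have hWs : ∀ d, W d.symm = W d := fun d => by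
      simp only [W, Dart.edge_symm]
    have hWe : ∀ e, W (someDart e) = U e := fun e => by
      simp only [W]
      congr 1
      exact Subtype.ext (someDart_edge e)
    have hWt : ∀ d, ¬ t d → W d = 0 := by
      intro d hd
      simp only [W, U]
      rw [dif_neg]
      have h4 : (someDart ⟨d.edge, d.edge_mem⟩).edge = d.edge := someDart_edge _
      rcases (dart_edge_eq_iff _ _).1 h4 with h5 | h5
      · rwa [h5]
      · rwa [h5, ht]
    obtain ⟨ε, hε⟩ := h.exists_vertex_potential W hWs (fun f => by
      rw [← incidence_mulVec ρ.left W hWs]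
      simp only [hWe, Matrix.mulVec, dotProduct]
      rw [← Fintype.sum_subtype_add_sum_subtype (fun e => t (someDart e))]
      have h2 : ∑ e : {e : G.edgeSet // ¬ t (someDart e)}, incidence ρ.left f e.1 * U e.1 = 0 :=
        Finset.sum_eq_zero fun e _ => by simp only [U]; rw [dif_neg e.2, mul_zero]
      rw [h2, add_zero]
      by_cases hf : f ∈ A
      · have h3 := congrFun (LinearMap.mem_ker.1 hw) ⟨f, hf⟩
        rw [Pi.zero_apply] at h3
        rw [← h3]
        refine Finset.sum_congr rfl fun e _ => ?_
        simp only [U]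
        rw [dif_pos e.2]
      · refine Finset.sum_eq_zero fun e _ => ?_
        rw [incidence, if_neg, if_neg, add_zero, zero_mul]
        · rintro rfl; exact hf (htA _ ((ht _).2 e.2))
        · rintro rfl; exact hf (htA _ e.2))
    obtain ⟨ε', hε'⟩ := exists_factor (t := t) (ε := ε) (fun d hd => by
      have := hε d
      rw [hWt d hd] at this
      exact CharTwo.add_eq_zero.1 this.symm)
    refine ⟨ε', funext fun e => ?_⟩
    change ε' (comp (someDart e.1).fst) + ε' (comp (someDart e.1).snd) = w e
    rw [← hε', ← hε', ← hε, hWe]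
    simp only [U]
    rw [dif_pos e.2]
  have hkΔ : 0 < Module.finrank (ZMod 2) (LinearMap.ker Δ) := by
    rw [Module.finrank_pos_iff]
    refine ⟨⟨⟨fun _ => 1, ?_⟩, 0, ?_⟩⟩
    · rw [LinearMap.mem_ker]
      ext e
      exact CharTwo.add_self_eq_zero _
    · obtain ⟨v⟩ := h.conn.nonempty
      intro h0
      have := congrFun (congrArg Subtype.val h0) (comp v)
      exact one_ne_zero this
  have e1 := LinearMap.finrank_range_add_finrank_ker Δ
  have e2 := LinearMap.finrank_range_add_finrank_ker bd
  have e3 := Submodule.finrank_mono hbd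
  have e4 := Submodule.finrank_mono hker
  rw [Module.finrank_fintype_fun_eq_card] at e1 e2
  rw [← hm] at e2
  -- The dimensions give at least `m - |A| + 2` regions. A single region is the case of the first
  -- alternative.
  by_cases hC : Fintype.card (avoid t).ConnectedComponent ≤ 1
  · left; omega
  right
  -- Double counting: when there are several regions, the boundary of each is a nonzero even subset
  -- of `t`, so it has at least `g` edges, and each edge bounds at most two regions.
  have hcount : g * Fintype.card (avoid t).ConnectedComponent ≤ 2 * m := by
    let wc : (avoid t).ConnectedComponent → G.Dart → ZMod 2 := fun c d =>
      (if comp d.fst = c then 1 else 0) + (if comp d.snd = c then 1 else 0)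
    have hone : ∀ c d, wc c d = 1 → c = comp d.fst ∨ c = comp d.snd := by
      intro c d hcd
      by_contra hne
      rw [not_or] at hne
      simp only [wc] at hcd
      rw [if_neg (Ne.symm hne.1), if_neg (Ne.symm hne.2)] at hcd
      exact absurd hcd (by decide)
    have hsupp : ∀ c d, wc c d = 1 → t d := by
      intro c d hcd
      by_contra hd
      have h1 : comp d.fst = comp d.snd := avoid_comp_eq hd
      simp only [wc] at hcd
      rw [h1, CharTwo.add_self_eq_zero] at hcd
      exact zero_ne_one hcd
    have hmin : ∀ c, g ≤ (edgeSupport (wc c)).card := by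
      intro c
      refine hg (wc c) (fun d => add_comm _ _)
        (fun f => ρ.sum_left_coboundary (fun v => if comp v = c then 1 else 0) f) (hsupp c) ?_
      by_contra hne
      push Not at hne
      have hconst := h.conn.eq_of_dart (ε := fun v => if comp v = c then (1 : ZMod 2) else 0)
        (fun d => by
          by_contra h0
          exact hne d (zmod_two_eq_one fun h1 => h0 (CharTwo.add_eq_zero.1 h1)))
      apply hC
      rw [Fintype.card_le_one_iff]
      have hall : ∀ c', c' = c := by
        intro c'
        induction c' using ConnectedComponent.ind with | h v' => ?_
        induction c using ConnectedComponent.ind with | h v => ?_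
        by_contra hvv
        have h3 := hconst v v'
        rw [if_pos rfl, if_neg hvv] at h3
        exact one_ne_zero h3
      exact fun a b => (hall a).trans (hall b).symm
    calc g * Fintype.card (avoid t).ConnectedComponent
        = ∑ _c : (avoid t).ConnectedComponent, g := by
          rw [Finset.sum_const, Finset.card_univ, smul_eq_mul, mul_comm]
      _ ≤ ∑ c : (avoid t).ConnectedComponent, (edgeSupport (wc c)).card :=
          Finset.sum_le_sum fun c _ => hmin c
      _ = ∑ e : G.edgeSet, (Finset.univ.filter fun c => wc c (someDart e) = 1).card := by
          simp only [edgeSupport, Finset.card_filter]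
          rw [Finset.sum_comm]
      _ ≤ ∑ e : G.edgeSet, if t (someDart e) then 2 else 0 := by
          refine Finset.sum_le_sum fun e _ => ?_
          split_ifs with he
          · refine le_trans (Finset.card_le_card (t := {comp (someDart e).fst,
              comp (someDart e).snd}) ?_) Finset.card_le_two
            intro c hc
            simpa using hone c _ (Finset.mem_filter.1 hc).2
          · rw [Nat.le_zero, Finset.card_eq_zero, Finset.filter_eq_empty_iff]
            exact fun c _ hc => he (hsupp c _ hc)
      _ = 2 * m := by
          rw [← Finset.sum_filter, Finset.sum_const, smul_eq_mul, mul_comm, hm,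
            Fintype.card_subtype]
  refine le_trans (Nat.mul_le_mul_left g ?_) hcount
  omega

open scoped Classical in
theorem two_mul_card_edges (t : G.Dart → Prop) (ht : ∀ d, t d.symm ↔ t d) :
    2 * Fintype.card {e : G.edgeSet // t (someDart e)} = (Finset.univ.filter t).card := by
  rw [Finset.card_filter, sum_dart_eq, Fintype.card_subtype, Finset.card_filter, Finset.mul_sum]
  refine Finset.sum_congr rfl fun e _ => ?_
  simp only [ht]
  split_ifs <;> rfl

open scoped Classical in
theorem card_pairs_le (t : G.Dart → Prop)
    (P : Finset (ρ.untwisted.Face × ρ.untwisted.Face))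
    (hP : ∀ p ∈ P, ρ.dual.Adj p.1 p.2 ∧ ∀ d, ρ.left d = p.1 → ρ.left d.symm = p.2 → t d) :
    P.card ≤ (Finset.univ.filter t).card := by
  refine (Finset.card_le_card (s := P)
    (t := (Finset.univ.filter t).image fun d => (ρ.left d, ρ.left d.symm)) ?_).trans
    Finset.card_image_le
  intro p hp
  obtain ⟨h1, h2⟩ := hP p hp
  obtain ⟨-, d, hd1, hd2⟩ := ρ.dual_adj_iff.1 h1
  rw [Finset.mem_image]
  exact ⟨d, by simpa using h2 d hd1 hd2, by rw [hd1, hd2]⟩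

/-- The dual graph has no complete subgraph on five vertices. -/
theorem card_clique_le (h : ρ.IsPlaneCubic) (A : Finset ρ.untwisted.Face)
    (hA : ∀ f ∈ A, ∀ g ∈ A, f ≠ g → ρ.dual.Adj f g) : A.card ≤ 4 := by
  classical
  by_contra hcard
  obtain ⟨B, hBA, hB⟩ := Finset.exists_subset_card_eq (show 5 ≤ A.card by omega)
  let t : G.Dart → Prop := fun d => ρ.left d ∈ B ∧ ρ.left d.symm ∈ B
  have ht : ∀ d, t d.symm ↔ t d := fun d => by simp only [t, Dart.symm_symm]; tauto
  have h1 := h.edge_bound B (Finset.card_pos.1 (by omega)) t ht (fun d hd => hd.1) 3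
    (fun w hw he _ ⟨d, hd⟩ => h.three_le_card_edgeSupport hw he hd)
  have h2 := two_mul_card_edges t ht
  have h3 := card_pairs_le t B.offDiag (fun p hp => by
    rw [Finset.mem_offDiag] at hp
    exact ⟨hA _ (hBA hp.1) _ (hBA hp.2.1) hp.2.2, fun d h1 h2 =>
      ⟨h1 ▸ hp.1, h2 ▸ hp.2.1⟩⟩)
  rw [Finset.offDiag_card, hB] at h3
  rw [hB] at h1
  -- Five vertices and `m ≥ 10` edges: both `m + 1 ≤ 5` and `3 (m - 3) ≤ 2 m` fail.
  omega

/-- The dual graph contains no complete bipartite graph with three vertices on each side. -/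
theorem card_bipartite_lt (h : ρ.IsPlaneCubic) (A B : Finset ρ.untwisted.Face)
    (hAB : ∀ f ∈ A, ∀ g ∈ B, ρ.dual.Adj f g) : A.card < 3 ∨ B.card < 3 := by
  classical
  by_contra hcard
  rw [not_or, not_lt, not_lt] at hcard
  obtain ⟨A', hA', hA⟩ := Finset.exists_subset_card_eq hcard.1
  obtain ⟨B', hB', hB⟩ := Finset.exists_subset_card_eq hcard.2
  have hdisj : ∀ f, f ∈ A' → f ∉ B' := fun f hf hf' => (hAB f (hA' hf) f (hB' hf')).ne rfl
  let t : G.Dart → Prop := fun d =>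
    (ρ.left d ∈ A' ∧ ρ.left d.symm ∈ B') ∨ (ρ.left d ∈ B' ∧ ρ.left d.symm ∈ A')
  have ht : ∀ d, t d.symm ↔ t d := fun d => by simp only [t, Dart.symm_symm]; tauto
  have hd : Disjoint A' B' := Finset.disjoint_left.2 fun f => hdisj f
  have hcard' : (A' ∪ B').card = 6 := by
    rw [Finset.card_union_of_disjoint hd, hA, hB]
  have h1 := h.edge_bound (A' ∪ B') (Finset.card_pos.1 (by omega)) t ht
    (fun d hd => by
      rw [Finset.mem_union]
      rcases hd with hd | hd
      · exact Or.inl hd.1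
      · exact Or.inr hd.1) 4
    (fun w hw he hs ⟨d, hd⟩ => h.four_le_card_edgeSupport hw he (A' : Set ρ.untwisted.Face)
      (fun d hd => by
        have h1 := hdisj (ρ.left d)
        have h2 := hdisj (ρ.left d.symm)
        have h3 := hs d hd
        simp only [t] at h3
        simp only [Finset.mem_coe]
        tauto) hd)
  have h2 := two_mul_card_edges t ht
  have h3 := card_pairs_le t (A' ×ˢ B' ∪ B' ×ˢ A') (fun p hp => by
    rw [Finset.mem_union, Finset.mem_product, Finset.mem_product] at hp
    rcases hp with hp | hp
    · exact ⟨hAB _ (hA' hp.1) _ (hB' hp.2), fun d h1 h2 => Or.inl ⟨h1 ▸ hp.1, h2 ▸ hp.2⟩⟩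
    · exact ⟨(hAB _ (hA' hp.2) _ (hB' hp.1)).symm, fun d h1 h2 =>
        Or.inr ⟨h1 ▸ hp.1, h2 ▸ hp.2⟩⟩)
  rw [Finset.card_union_of_disjoint, Finset.card_product, Finset.card_product, hA, hB] at h3
  · rw [hcard'] at h1
    -- Six vertices and `m ≥ 9` edges: both `m + 1 ≤ 6` and `4 (m - 4) ≤ 2 m` fail.
    omega
  · rw [Finset.disjoint_left]
    intro p hp hp'
    rw [Finset.mem_product] at hp hp'
    exact hdisj _ hp.1 hp'.1

end RotationSystem.IsPlaneCubic

end StrongEmb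

namespace StrongEmb

open SimpleGraph

/-! ### Transport of embeddings along automorphisms -/

section Transport

variable {V : Type u} {G : SimpleGraph V}

/-- The permutation of the darts induced by an automorphism. -/
def dartEquiv (φ : G ≃g G) : Equiv.Perm G.Dart where
  toFun := φ.toHom.mapDart
  invFun := φ.symm.toHom.mapDart
  left_inv _ := Dart.ext _ _ (Prod.ext (φ.symm_apply_apply _) (φ.symm_apply_apply _))
  right_inv _ := Dart.ext _ _ (Prod.ext (φ.apply_symm_apply _) (φ.apply_symm_apply _))

theorem dartEquiv_fst (φ : G ≃g G) (d : G.Dart) : (dartEquiv φ d).fst = φ d.fst := rfl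

theorem dartEquiv_snd (φ : G ≃g G) (d : G.Dart) : (dartEquiv φ d).snd = φ d.snd := rfl

theorem dartEquiv_symm (φ : G ≃g G) (d : G.Dart) :
    dartEquiv φ d.symm = (dartEquiv φ d).symm := rfl

namespace Embedding

/-- The automorphism `φ` carries `E` to `E'` if the local orientations are changed according
to `ε`. -/
structure Transports (φ : G ≃g G) (ε : V → ℤˣ) (E E' : Embedding G) : Prop where
  perm : ∀ d, E'.rot.perm (dartEquiv φ d) = dartEquiv φ ((E.rot.perm ^ (ε d.fst : ℤ)) d)
  sgn : ∀ d, E'.sgn (dartEquiv φ d) = E.sgn d * (ε d.fst * ε d.snd)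

/-- The induced permutation of the states of the face traversal. -/
def stateEquiv (φ : G ≃g G) (ε : V → ℤˣ) : Equiv.Perm (G.Dart × ℤˣ) where
  toFun x := (dartEquiv φ x.1, x.2 * ε x.1.fst)
  invFun x := ((dartEquiv φ).symm x.1, x.2 * ε ((dartEquiv φ).symm x.1).fst)
  left_inv x := Prod.ext (by simp) (by simp [mul_assoc, Int.units_mul_self])
  right_inv x := Prod.ext (by simp) (by simp [mul_assoc, Int.units_mul_self])

theorem stateEquiv_apply (φ : G ≃g G) (ε : V → ℤˣ) (d : G.Dart) (s : ℤˣ) :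
    stateEquiv φ ε (d, s) = (dartEquiv φ d, s * ε d.fst) := rfl

namespace Transports

variable {φ : G ≃g G} {ε : V → ℤˣ} {E E' : Embedding G}

theorem perm_zpow (h : Transports φ ε E E') (d : G.Dart) (s : ℤˣ) :
    (E'.rot.perm ^ (s : ℤ)) (dartEquiv φ d) =
      dartEquiv φ ((E.rot.perm ^ ((s * ε d.fst : ℤˣ) : ℤ)) d) := by
  rcases Int.units_eq_one_or s with rfl | rfl
  · simpa using h.perm d
  · simp only [Units.val_neg, Units.val_one, zpow_neg, zpow_one, neg_mul, one_mul]
    rw [Equiv.Perm.inv_eq_iff_eq, h.perm]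
    congr 1
    have h1 : ((E.rot.perm ^ (ε d.fst : ℤ))⁻¹ d).fst = d.fst := by
      rw [← zpow_neg]; exact E.rot.zpow_fst _ _
    rw [h1]
    simp

theorem stateEquiv_next (h : Transports φ ε E E') (x : G.Dart × ℤˣ) :
    stateEquiv φ ε (E.next x) = E'.next (stateEquiv φ ε x) := by
  rcases x with ⟨d, s⟩
  have h1 : s * ε d.fst * (E.sgn d * (ε d.fst * ε d.snd)) = s * E.sgn d * ε d.snd := by
    rcases Int.units_eq_one_or (ε d.fst) with h | h <;> rw [h] <;> simp [mul_assoc]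
  rw [next_apply, stateEquiv_apply, stateEquiv_apply, next_apply, h.sgn, h1, ← dartEquiv_symm,
    h.perm_zpow, E.rot.zpow_fst]
  change _ = (dartEquiv φ ((E.rot.perm ^ ((s * E.sgn d * ε d.snd * ε d.snd : ℤˣ) : ℤ)) d.symm), _)
  rw [mul_assoc (s * E.sgn d), Int.units_mul_self, mul_one]
  rfl

theorem stateEquiv_rev (h : Transports φ ε E E') (x : G.Dart × ℤˣ) :
    stateEquiv φ ε (E.rev x) = E'.rev (stateEquiv φ ε x) := by
  rcases x with ⟨d, s⟩
  have h1 : s * ε d.fst * (E.sgn d * (ε d.fst * ε d.snd)) = s * E.sgn d * ε d.snd := by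
    rcases Int.units_eq_one_or (ε d.fst) with h | h <;> rw [h] <;> simp [mul_assoc]
  rw [rev_apply, stateEquiv_apply, stateEquiv_apply, rev_apply, h.sgn, h1, ← dartEquiv_symm,
    neg_mul]
  rfl

theorem next_eq (h : Transports φ ε E E') :
    E'.next = stateEquiv φ ε * E.next * (stateEquiv φ ε)⁻¹ := by
  ext1 x
  rw [Equiv.Perm.mul_apply, Equiv.Perm.mul_apply, h.stateEquiv_next]
  simp

theorem sameCycle_iff (h : Transports φ ε E E') {x y : G.Dart × ℤˣ} :
    E'.next.SameCycle (stateEquiv φ ε x) (stateEquiv φ ε y) ↔ E.next.SameCycle x y := by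
  rw [h.next_eq, Equiv.Perm.sameCycle_conj]
  simp

/-- The induced bijection between the cells. -/
def faceEquiv (h : Transports φ ε E E') : E.Face ≃ E'.Face :=
  Quot.congr (stateEquiv φ ε) (fun x y => by
    rw [← h.stateEquiv_next, ← h.stateEquiv_rev, (stateEquiv φ ε).apply_eq_iff_eq,
      (stateEquiv φ ε).apply_eq_iff_eq])

theorem eulerChar_eq (h : Transports φ ε E E') : E'.eulerChar = E.eulerChar := by
  unfold eulerChar
  rw [Nat.card_congr h.faceEquiv]

theorem orientable_iff (h : Transports φ ε E E') : E'.Orientable ↔ E.Orientable := by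
  constructor
  · rintro ⟨η, hη⟩
    refine ⟨fun v => η (φ v) * ε v, fun d => ?_⟩
    have h1 : E'.sgn (dartEquiv φ d) = η (φ d.fst) * η (φ d.snd) := hη (dartEquiv φ d)
    have h2 := h.sgn d
    change E.sgn d = _
    rw [h1] at h2
    calc E.sgn d = E.sgn d * (ε d.fst * ε d.snd) * (ε d.fst * ε d.snd) := by
          rw [mul_assoc, Int.units_mul_self, mul_one]
      _ = _ := by rw [← h2]; exact mul_mul_mul_comm _ _ _ _
  · rintro ⟨η, hη⟩
    refine ⟨fun v => η (φ.symm v) * ε (φ.symm v), fun d' => ?_⟩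
    obtain ⟨d, rfl⟩ := (dartEquiv φ).surjective d'
    change E'.sgn (dartEquiv φ d) = _
    have h1 : E.sgn d = η d.fst * η d.snd := hη d
    rw [h.sgn, h1, dartEquiv_fst, dartEquiv_snd]
    simp only [RelIso.symm_apply_apply]
    exact (mul_mul_mul_comm _ _ _ _)

theorem isStrong_iff (h : Transports φ ε E E') : E'.IsStrong ↔ E.IsStrong := by
  constructor
  · intro hs x y hxy hf
    exact (stateEquiv φ ε).injective (hs _ _ (h.sameCycle_iff.2 hxy) (congrArg φ hf))
  · intro hs x' y' hxy hf
    obtain ⟨x, rfl⟩ := (stateEquiv φ ε).surjective x'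
    obtain ⟨y, rfl⟩ := (stateEquiv φ ε).surjective y'
    rw [hs x y (h.sameCycle_iff.1 hxy) (φ.injective hf)]

theorem walkEdges_eq (h : Transports φ ε E E') (x : G.Dart × ℤˣ) :
    E'.walkEdges (stateEquiv φ ε x) = Sym2.map φ '' E.walkEdges x := by
  ext e
  constructor
  · rintro ⟨y', hy, rfl⟩
    obtain ⟨y, rfl⟩ := (stateEquiv φ ε).surjective y'
    exact ⟨y.1.edge, ⟨y, h.sameCycle_iff.1 hy, rfl⟩, rfl⟩
  · rintro ⟨_, ⟨y, hy, rfl⟩, rfl⟩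
    exact ⟨stateEquiv φ ε y, h.sameCycle_iff.2 hy, rfl⟩

theorem facialCycles_eq (h : Transports φ ε E E') :
    (fun C => Sym2.map φ '' C) '' E.facialCycles = E'.facialCycles := by
  ext C
  constructor
  · rintro ⟨_, ⟨x, rfl⟩, rfl⟩
    exact ⟨stateEquiv φ ε x, h.walkEdges_eq x⟩
  · rintro ⟨x', rfl⟩
    obtain ⟨x, rfl⟩ := (stateEquiv φ ε).surjective x'
    exact ⟨_, ⟨x, rfl⟩, (h.walkEdges_eq x).symm⟩

end Transports

end Embedding

/-- The rotation system pulled back along an automorphism. -/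
def RotationSystem.pullback (ρ : RotationSystem G) (φ : G ≃g G) : RotationSystem G where
  perm := (dartEquiv φ)⁻¹ * ρ.perm * ((dartEquiv φ)⁻¹)⁻¹
  fst_perm d := by
    have h1 : dartEquiv φ (((dartEquiv φ)⁻¹ * ρ.perm * ((dartEquiv φ)⁻¹)⁻¹) d) =
        ρ.perm (dartEquiv φ d) := by simp
    apply φ.injective
    rw [← dartEquiv_fst, h1, ρ.fst_perm, dartEquiv_fst]
  sameCycle d d' hd := by
    rw [Equiv.Perm.sameCycle_conj]
    exact ρ.sameCycle _ _ (congrArg φ hd)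

/-- A signature with prescribed values on the darts. -/
noncomputable def signOf (σ : G.Dart → ℤˣ) : G.edgeSet → ℤˣ := fun e => σ (someDart e)

theorem signOf_sgn (ρ : RotationSystem G) {σ : G.Dart → ℤˣ} (hσ : ∀ d, σ d.symm = σ d)
    (d : G.Dart) : (ρ.signed (signOf σ)).sgn d = σ d := by
  change σ (someDart ⟨d.edge, d.edge_mem⟩) = σ d
  have h4 : (someDart ⟨d.edge, d.edge_mem⟩).edge = d.edge := someDart_edge _
  rcases (dart_edge_eq_iff _ _).1 h4 with h5 | h5
  · rw [h5]
  · rw [h5, hσ]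

/-- Every embedding of a cubic graph is carried by a given automorphism from an embedding with a
given rotation system. -/
theorem exists_transports [Fintype V] [DecidableRel G.Adj] (hc : G.IsRegularOfDegree 3)
    (ρ : RotationSystem G) (φ : G ≃g G) (E' : Embedding G) :
    ∃ (l : G.edgeSet → ℤˣ) (ε : V → ℤˣ), Embedding.Transports φ ε (ρ.signed l) E' := by
  obtain ⟨ε, hε⟩ := ρ.exists_orientation hc (E'.rot.pullback φ)
  -- Once `ε` records where the pulled-back rotation is reversed, the signature is forced by the
  -- transport rule.
  refine ⟨signOf fun d => E'.sgn (dartEquiv φ d) * (ε d.fst * ε d.snd), ε, ⟨fun d => ?_,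
    fun d => ?_⟩⟩
  · have h1 : dartEquiv φ ((E'.rot.pullback φ).perm d) = E'.rot.perm (dartEquiv φ d) := by
      simp [RotationSystem.pullback]
    rw [← h1, hε]
    rfl
  · rw [signOf_sgn, mul_assoc, Int.units_mul_self, mul_one]
    intro d
    rw [dartEquiv_symm, Embedding.sgn_symm]
    congr 1
    exact mul_comm _ _

end Transport

/-! ### Facial cycles determine the twisted edges -/

namespace Embedding

variable {V : Type u} {G : SimpleGraph V} (E : Embedding G)

theorem walkEdges_rev (x : G.Dart × ℤˣ) : E.walkEdges (E.rev x) = E.walkEdges x := by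
  have key : ∀ x, E.walkEdges x ⊆ E.walkEdges (E.rev x) := by
    rintro x _ ⟨y, hy, rfl⟩
    exact ⟨E.rev y, E.sameCycle_rev_rev hy, y.1.edge_symm⟩
  refine Set.Subset.antisymm ?_ (key x)
  have := key (E.rev x)
  rwa [rev_rev] at this

theorem walkEdges_eq_of_sameCycle {x y : G.Dart × ℤˣ} (h : E.next.SameCycle x y) :
    E.walkEdges x = E.walkEdges y := by
  ext e
  exact ⟨fun ⟨z, hz, he⟩ => ⟨z, h.symm.trans hz, he⟩, fun ⟨z, hz, he⟩ => ⟨z, h.trans hz, he⟩⟩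

theorem edge_mem_walkEdges (x : G.Dart × ℤˣ) : x.1.edge ∈ E.walkEdges x :=
  ⟨x, Equiv.Perm.SameCycle.refl _ _, rfl⟩

theorem edge_next_mem_walkEdges (x : G.Dart × ℤˣ) : (E.next x).1.edge ∈ E.walkEdges x :=
  ⟨E.next x, ⟨1, by simp⟩, rfl⟩

/-- A facial cycle does not contain the third edge at a vertex. -/
theorem edge_perm_notMem_walkEdges [Fintype V] [DecidableRel G.Adj] (hc : G.IsRegularOfDegree 3)
    (hs : E.IsStrong) (d : G.Dart) (s : ℤˣ) :
    ((E.rot.perm ^ (s : ℤ)) d).edge ∉ E.walkEdges (d, s) := by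
  have hne : (E.rot.perm ^ (s : ℤ)) d ≠ d := by
    rcases Int.units_eq_one_or s with rfl | rfl
    · simpa using E.rot.perm_ne hc d
    · simp only [Units.val_neg, Units.val_one, zpow_neg, zpow_one]
      rw [E.rot.perm_inv_eq hc]
      exact E.rot.perm_perm_ne hc d
  have hne2 : (E.rot.perm ^ (s : ℤ)) d ≠ (E.rot.perm ^ (-(s : ℤ))) d := by
    rcases Int.units_eq_one_or s with rfl | rfl <;>
      simp only [Units.val_neg, Units.val_one, zpow_neg, zpow_one, neg_neg] <;>
      rw [E.rot.perm_inv_eq hc]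
    · exact (E.rot.perm_ne hc _).symm
    · exact E.rot.perm_ne hc _
  have hfst : ((E.rot.perm ^ (s : ℤ)) d).fst = d.fst := E.rot.zpow_fst _ _
  rintro ⟨⟨y, r⟩, hy, he⟩
  rcases (dart_edge_eq_iff _ _).1 he with h | h
  · simp only at h
    have := congrArg Prod.fst (hs _ _ hy (by rw [h, hfst]))
    exact hne (by rw [← h]; exact this.symm)
  · simp only at h
    have h1 : E.next.SameCycle (d, s) (E.next (y, r)) := hy.trans ⟨1, by simp⟩
    have h2 := hs _ _ h1 (by rw [E.fst_next, h]; exact hfst.symm)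
    have h3 : E.rev (y, r) = E.rev (E.next⁻¹ (d, s)) := by rw [h2]; simp
    rw [rev_next_inv, next_rev] at h3
    have h4 := congrArg Prod.fst h3
    rw [rev_apply] at h4
    simp only [h, Dart.symm_symm] at h4
    exact hne2 h4

/-- The edge before `d` on the facial walk. -/
theorem edge_perm_neg_mem_walkEdges (d : G.Dart) (s : ℤˣ) :
    ((E.rot.perm ^ (-(s : ℤ))) d).edge ∈ E.walkEdges (d, s) := by
  have h := E.edge_next_mem_walkEdges (E.rev (d, s))
  rwa [walkEdges_rev, next_rev] at h

end Embedding

/-- At each of its vertices a facial cycle of a strong embedding avoids the third edge. Hence the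
cycle through `d` shows on which side of `d` it runs at the tail and to which side it turns at the
head, and comparing the two gives the sign of `d`. -/
theorem sgn_eq_of_facialCycles_eq {V : Type u} {G : SimpleGraph V} [Fintype V]
    [DecidableRel G.Adj] (hc : G.IsRegularOfDegree 3) (ρ : RotationSystem G)
    {l m : G.edgeSet → ℤˣ} (hl : (ρ.signed l).IsStrong)
    (h : (ρ.signed l).facialCycles = (ρ.signed m).facialCycles) (d : G.Dart) :
    (ρ.signed l).sgn d = (ρ.signed m).sgn d := by
  obtain ⟨y0, hy0⟩ : (ρ.signed l).walkEdges (d, 1) ∈ (ρ.signed m).facialCycles := by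
    rw [← h]; exact ⟨_, rfl⟩
  have key : ∃ s : ℤˣ, (ρ.signed m).walkEdges (d, s) = (ρ.signed l).walkEdges (d, 1) := by
    have hd := (ρ.signed l).edge_mem_walkEdges (d, 1)
    rw [← hy0] at hd ⊢
    obtain ⟨⟨y, r⟩, hy, he⟩ := hd
    rcases (dart_edge_eq_iff _ _).1 he with h | h
    · simp only at h
      exact ⟨r, by rw [(ρ.signed m).walkEdges_eq_of_sameCycle hy, h]⟩
    · refine ⟨-(r * (ρ.signed m).sgn y), ?_⟩
      rw [(ρ.signed m).walkEdges_eq_of_sameCycle hy, ← Embedding.walkEdges_rev _ (y, r),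
        Embedding.rev_apply]
      simp only at h
      rw [h, Dart.symm_symm]
  obtain ⟨s, hs⟩ := key
  -- For `s = -1` the cycle would also contain the edge following `d` in the rotation, which is the
  -- third edge at the tail.
  have hs1 : s = 1 := by
    rcases Int.units_eq_one_or s with rfl | rfl
    · rfl
    · have h1 := (ρ.signed l).edge_perm_notMem_walkEdges hc hl d 1
      have h2 := (ρ.signed m).edge_perm_neg_mem_walkEdges d (-1)
      rw [hs] at h2
      simp only [Units.val_neg, Units.val_one, neg_neg] at h1 h2
      exact absurd h2 h1
  subst hs1
  by_contra hne
  have hcross : (ρ.signed m).sgn d = - (ρ.signed l).sgn d := by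
    rcases Int.units_eq_one_or ((ρ.signed l).sgn d) with h1 | h1 <;>
      rcases Int.units_eq_one_or ((ρ.signed m).sgn d) with h2 | h2
    · exact absurd (h1.trans h2.symm) hne
    · rw [h1, h2]
    · rw [h1, h2, neg_neg]
    · exact absurd (h1.trans h2.symm) hne
  have h1 := (ρ.signed m).edge_next_mem_walkEdges (d, 1)
  rw [hs, Embedding.next_apply, hcross, one_mul] at h1
  have h2 := (ρ.signed l).edge_perm_notMem_walkEdges hc hl d.symm
    (-((ρ.signed l).sgn d))
  have h3 : (ρ.signed l).rev (d, 1) = (d.symm, -((ρ.signed l).sgn d)) := by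
    rw [Embedding.rev_apply, one_mul]
  rw [← h3, Embedding.walkEdges_rev] at h2
  exact h2 h1

/-! ### Automorphisms of the graph and of the dual graph -/

namespace RotationSystem

variable {V : Type u} [Fintype V] {G : SimpleGraph V} [DecidableRel G.Adj] {ρ : RotationSystem G}

open scoped Classical in
theorem lap_apply_of_ne (ρ : RotationSystem G) (l : G.edgeSet → ℤˣ) {f g : ρ.untwisted.Face}
    (hfg : f ≠ g) : ρ.lap l f g = if (ρ.twistedGraph l).Adj f g then 1 else 0 := by
  rw [lap, lapMatrix, degMatrix, Matrix.sub_apply, Matrix.diagonal_apply_ne _ hfg,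
    adjMatrix_apply, zero_sub, CharTwo.neg_eq]

namespace IsPlaneCubic

theorem twistedGraph_adj_iff (h : ρ.IsPlaneCubic) (l : G.edgeSet → ℤˣ) (d : G.Dart) :
    (ρ.twistedGraph l).Adj (ρ.left d) (ρ.left d.symm) ↔ (ρ.signed l).sgn d = -1 := by
  constructor
  · rintro ⟨-, d', h1, h2, h3⟩
    rwa [← h.dart_eq_of_left _ _ h1 h2]
  · intro hd
    exact ⟨h.left_ne d, d, rfl, rfl, hd⟩

/-- The embedding on the sphere is unique: automorphisms preserve or reverse the rotation. -/
theorem exists_transports_untwisted (h : ρ.IsPlaneCubic) (φ : G ≃g G) :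
    ∃ s : ℤˣ, Embedding.Transports φ (fun _ => s) ρ.untwisted ρ.untwisted := by
  obtain ⟨l, ε, hT⟩ := exists_transports h.cubic ρ φ ρ.untwisted
  -- The pulled-back embedding is again spherical, so its Laplacian has rank zero and no edge is
  -- twisted. The reversals `ε` then agree along every edge, hence everywhere.
  have hrank : (ρ.lap l).rank = 0 := by
    have h1 := hT.eulerChar_eq
    rw [h.eulerChar_signed, h.planar.2] at h1
    omega
  have hL := eq_zero_of_rank_eq_zero hrank
  have hl : ∀ d, (ρ.signed l).sgn d = 1 := by
    intro d
    rcases Int.units_eq_one_or ((ρ.signed l).sgn d) with h1 | h1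
    · exact h1
    · have h2 := ρ.lap_apply_of_ne l (h.left_ne d)
      rw [if_pos ((h.twistedGraph_adj_iff l d).2 h1), hL] at h2
      exact absurd h2 zero_ne_one
  obtain ⟨v0⟩ := h.conn.nonempty
  have hε := h.conn.eq_of_dart (ε := ε) (fun d => by
    have h1 := hT.sgn d
    rw [hl, one_mul] at h1
    change 1 = _ at h1
    rcases Int.units_eq_one_or (ε d.fst) with h2 | h2 <;> rw [h2] at h1 ⊢
    · simpa using h1
    · rw [neg_one_mul] at h1; rw [h1, neg_neg])
  refine ⟨ε v0, ⟨fun d => ?_, fun d => ?_⟩⟩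
  · rw [hε v0 d.fst]; exact hT.perm d
  · rw [Int.units_mul_self, mul_one]; rfl

end IsPlaneCubic

/-- The automorphism `ψ` of the dual graph maps the sides of each edge to the sides of its image
under the automorphism `φ` of the graph. -/
def Induces {V : Type u} {G : SimpleGraph V} (ρ : RotationSystem G) (φ : G ≃g G) (ψ : ρ.dual ≃g ρ.dual) : Prop :=
  ∀ d, (ρ.left (dartEquiv φ d) = ψ (ρ.left d) ∧
      ρ.left (dartEquiv φ d).symm = ψ (ρ.left d.symm)) ∨
    (ρ.left (dartEquiv φ d) = ψ (ρ.left d.symm) ∧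
      ρ.left (dartEquiv φ d).symm = ψ (ρ.left d))

theorem exists_dual_iso {V : Type u} {G : SimpleGraph V} {ρ : RotationSystem G} (φ : G ≃g G)
    {s : ℤˣ}
    (hT : Embedding.Transports φ (fun _ => s) ρ.untwisted ρ.untwisted) :
    ∃ ψ : ρ.dual ≃g ρ.dual, ρ.Induces φ ψ := by
  have hface : ∀ d t, hT.faceEquiv (ρ.untwisted.face (d, t)) =
      ρ.untwisted.face (dartEquiv φ d, t * s) := fun d t => rfl
  refine ⟨⟨hT.faceEquiv, ?_⟩, ?_⟩
  · intro f g
    constructor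
    · rintro ⟨hne, d', t', h1, h2⟩
      obtain ⟨d, rfl⟩ := (dartEquiv φ).surjective d'
      refine ⟨fun h => hne (by rw [h]), d, t' * s, hT.faceEquiv.injective ?_,
        hT.faceEquiv.injective ?_⟩
      · rw [hface, mul_assoc, Int.units_mul_self, mul_one, h1]
      · rw [hface, neg_mul, mul_assoc, Int.units_mul_self, mul_one, h2]
    · rintro ⟨hne, d, t, rfl, rfl⟩
      refine ⟨fun h => hne (hT.faceEquiv.injective h), dartEquiv φ d, t * s, rfl, ?_⟩
      rw [hface, neg_mul]
  · intro d
    change (ρ.left (dartEquiv φ d) = hT.faceEquiv (ρ.left d) ∧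
        ρ.left (dartEquiv φ d).symm = hT.faceEquiv (ρ.left d.symm)) ∨
      (ρ.left (dartEquiv φ d) = hT.faceEquiv (ρ.left d.symm) ∧
        ρ.left (dartEquiv φ d).symm = hT.faceEquiv (ρ.left d))
    rw [← face_neg_one_eq, ← face_neg_one_eq, left, left, hface, hface]
    rcases Int.units_eq_one_or s with rfl | rfl
    · left; simp
    · right; simp

end RotationSystem

end StrongEmb

/-! ### Nonseparating triangles of the dual graph and its automorphisms. -/

namespace StrongEmb

open SimpleGraph

/-- Deleting the vertex set `t` disconnects the graph `D`. -/
def Separating {W : Type u} (D : SimpleGraph W) (t : Set W) : Prop :=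
  ∃ P : W → Prop, (∀ f g, D.Adj f g → f ∉ t → g ∉ t → P f → P g) ∧
    (∃ f, f ∉ t ∧ P f) ∧ ∃ g, g ∉ t ∧ ¬ P g

theorem Separating.of_image {W : Type u} {D : SimpleGraph W} (ψ : D ≃g D) {t : Set W}
    (h : Separating D (ψ '' t)) : Separating D t := by
  obtain ⟨P, hP, ⟨f, hf, hPf⟩, g, hg, hPg⟩ := h
  have hmem : ∀ a, ψ a ∈ ψ '' t ↔ a ∈ t := fun a => ψ.injective.mem_set_image
  refine ⟨fun a => P (ψ a), fun a b hab ha hb => hP _ _ (ψ.map_adj_iff.2 hab)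
    (by rwa [hmem]) (by rwa [hmem]), ⟨ψ.symm f, ?_, ?_⟩, ψ.symm g, ?_, ?_⟩
  · rwa [← hmem, RelIso.apply_symm_apply]
  · simpa using hPf
  · rwa [← hmem, RelIso.apply_symm_apply]
  · simpa using hPg

namespace RotationSystem

variable {V : Type u} {G : SimpleGraph V}

/-- The faces at a vertex. -/
def facesAt (ρ : RotationSystem G) (v : V) : Set ρ.untwisted.Face :=
  {f | ∃ d, d.fst = v ∧ ρ.left d = f}

variable {ρ : RotationSystem G}

theorem left_mem_facesAt (d : G.Dart) : ρ.left d ∈ ρ.facesAt d.fst := ⟨d, rfl, rfl⟩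

theorem left_symm_mem_facesAt (d : G.Dart) : ρ.left d.symm ∈ ρ.facesAt d.fst :=
  ⟨ρ.perm d, ρ.fst_perm d, ρ.left_perm d⟩

theorem left_mem_facesAt_snd (d : G.Dart) : ρ.left d ∈ ρ.facesAt d.snd := by
  have := left_symm_mem_facesAt (ρ := ρ) d.symm
  rwa [Dart.symm_symm] at this

/-- A vertex function that does not change along the edges of a face is constant on it. -/
theorem eq_on_face {f : ρ.untwisted.Face} {ε : V → ZMod 2}
    (hε : ∀ x : G.Dart, ρ.left x = f → ε x.fst = ε x.snd) {x y : G.Dart} (hx : ρ.left x = f)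
    (hy : ρ.left y = f) : ε x.fst = ε y.fst := by
  classical
  let c : G.Dart × ℤˣ → ZMod 2 := fun x => if ρ.untwisted.face x = f then ε x.1.fst else 0
  have hstep : ∀ x : G.Dart × ℤˣ, ρ.untwisted.face x = f → ε x.1.fst = ε x.1.snd := by
    rintro ⟨d, s⟩ hd
    rcases Int.units_eq_one_or s with rfl | rfl
    · exact hε d hd
    · rw [face_neg_one_eq] at hd
      exact (hε d.symm hd).symm
  have hnext : ∀ x, c (ρ.untwisted.next x) = c x := by
    intro x
    simp only [c, Embedding.face_next]
    split_ifs with hf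
    · rw [Embedding.fst_next, hstep x hf]
    · rfl
  have hrev : ∀ x, c (ρ.untwisted.rev x) = c x := by
    intro x
    simp only [c, Embedding.face_rev]
    split_ifs with hf
    · exact (hstep x hf).symm
    · rfl
  let C : ρ.untwisted.Face → ZMod 2 := Quot.lift c (by
    rintro x y (rfl | rfl)
    · exact (hnext x).symm
    · exact (hrev x).symm)
  have hC : ∀ d : G.Dart, ρ.left d = f → C f = ε d.fst := by
    rintro d rfl
    change c (d, 1) = _
    exact if_pos rfl
  rw [← hC x hx, ← hC y hy]

namespace IsPlaneCubic

variable [Fintype V] [DecidableRel G.Adj]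

theorem exists_dart_of_facesAt (h : ρ.IsPlaneCubic) {v : V} {f g : ρ.untwisted.Face}
    (hf : f ∈ ρ.facesAt v) (hg : g ∈ ρ.facesAt v) (hne : f ≠ g) :
    ∃ e : G.Dart, e.fst = v ∧ ((ρ.left e = f ∧ ρ.left e.symm = g) ∨
      (ρ.left e = g ∧ ρ.left e.symm = f)) := by
  obtain ⟨d, rfl, rfl⟩ := hf
  obtain ⟨d', hd', rfl⟩ := hg
  rcases ρ.eq_or_of_fst h.cubic hd' with rfl | rfl | rfl
  · exact absurd rfl hne
  · exact ⟨d, rfl, Or.inl ⟨rfl, (ρ.left_perm d).symm⟩⟩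
  · refine ⟨_, hd', Or.inr ⟨rfl, ?_⟩⟩
    rw [← left_perm, ρ.perm_three h.cubic]

theorem adj_of_facesAt (h : ρ.IsPlaneCubic) {v : V} {f g : ρ.untwisted.Face}
    (hf : f ∈ ρ.facesAt v) (hg : g ∈ ρ.facesAt v) (hne : f ≠ g) : ρ.dual.Adj f g := by
  obtain ⟨e, -, ⟨rfl, rfl⟩ | ⟨rfl, rfl⟩⟩ := h.exists_dart_of_facesAt hf hg hne
  · exact h.dual_adj e
  · exact (h.dual_adj e).symm

theorem left_injOn (h : ρ.IsPlaneCubic) {d d' : G.Dart} (hd : d'.fst = d.fst)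
    (hl : ρ.left d' = ρ.left d) : d' = d := by
  rcases ρ.eq_or_of_fst h.cubic hd with rfl | rfl | rfl
  · rfl
  · rw [left_perm] at hl
    exact absurd hl.symm (h.left_ne d)
  · have h1 := h.left_ne (ρ.perm (ρ.perm d))
    rw [← left_perm, ρ.perm_three h.cubic] at h1
    exact absurd hl h1

/-- Two distinct faces at two distinct vertices are the two sides of an edge joining them. -/
theorem exists_dart_of_common_faces (h : ρ.IsPlaneCubic) {u v : V} (huv : u ≠ v)
    {f g : ρ.untwisted.Face} (hfu : f ∈ ρ.facesAt u) (hgu : g ∈ ρ.facesAt u)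
    (hfv : f ∈ ρ.facesAt v) (hgv : g ∈ ρ.facesAt v) (hne : f ≠ g) :
    ∃ e : G.Dart, e.fst = u ∧ e.snd = v ∧ ((ρ.left e = f ∧ ρ.left e.symm = g) ∨
      (ρ.left e = g ∧ ρ.left e.symm = f)) := by
  obtain ⟨e, he, hs⟩ := h.exists_dart_of_facesAt hfu hgu hne
  obtain ⟨e', he', hs'⟩ := h.exists_dart_of_facesAt hfv hgv hne
  refine ⟨e, he, ?_, hs⟩
  have key : e' = e ∨ e' = e.symm := by
    rcases hs with hs | hs <;> rcases hs' with hs' | hs'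
    · left; exact h.dart_eq_of_left _ _ (hs'.1.trans hs.1.symm) (hs'.2.trans hs.2.symm)
    · right
      refine h.dart_eq_of_left _ _ (hs'.1.trans hs.2.symm) ?_
      rw [Dart.symm_symm]; exact hs'.2.trans hs.1.symm
    · right
      refine h.dart_eq_of_left _ _ (hs'.1.trans hs.2.symm) ?_
      rw [Dart.symm_symm]; exact hs'.2.trans hs.1.symm
    · left; exact h.dart_eq_of_left _ _ (hs'.1.trans hs.1.symm) (hs'.2.trans hs.2.symm)
  rcases key with rfl | rfl
  · exact absurd (he.symm.trans he') huv
  · exact he'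

theorem exists_facesAt (h : ρ.IsPlaneCubic) (v : V) : ∃ a b c : ρ.untwisted.Face,
    a ≠ b ∧ b ≠ c ∧ a ≠ c ∧ ρ.facesAt v = {a, b, c} := by
  obtain ⟨d, rfl⟩ := exists_dart_fst h.cubic v
  refine ⟨ρ.left d, ρ.left (ρ.perm d), ρ.left (ρ.perm (ρ.perm d)), ?_, ?_, ?_, ?_⟩
  · exact fun hl => ρ.perm_ne h.cubic d (h.left_injOn (ρ.fst_perm d) hl.symm)
  · exact fun hl => ρ.perm_ne h.cubic _ (h.left_injOn (ρ.fst_perm _) hl.symm)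
  · exact fun hl => ρ.perm_perm_ne h.cubic d
      (h.left_injOn (by rw [ρ.fst_perm, ρ.fst_perm]) hl.symm)
  · ext f
    constructor
    · rintro ⟨d', hd', rfl⟩
      rcases ρ.eq_or_of_fst h.cubic hd' with rfl | rfl | rfl <;> simp
    · rintro (rfl | rfl | rfl)
      · exact ⟨d, rfl, rfl⟩
      · exact ⟨_, ρ.fst_perm d, rfl⟩
      · exact ⟨ρ.perm (ρ.perm d), by rw [ρ.fst_perm, ρ.fst_perm], rfl⟩

/-- Two vertices with three common faces would be joined by an edge having two of them as sides and
by one having another two. Both are the same edge, which has only two sides. -/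
theorem facesAt_subset (h : ρ.IsPlaneCubic) {u v : V} (huv : ρ.facesAt u ⊆ ρ.facesAt v) :
    u = v := by
  by_contra hne
  obtain ⟨a, b, c, hab, hbc, hac, ht⟩ := h.exists_facesAt u
  have ha : a ∈ ρ.facesAt u := by rw [ht]; simp
  have hb : b ∈ ρ.facesAt u := by rw [ht]; simp
  have hc : c ∈ ρ.facesAt u := by rw [ht]; simp
  obtain ⟨e, h1, h2, h3⟩ := h.exists_dart_of_common_faces hne ha hb (huv ha) (huv hb) hab
  obtain ⟨e', h1', h2', h3'⟩ := h.exists_dart_of_common_faces hne hb hc (huv hb) (huv hc) hbc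
  have : e = e' := Dart.ext _ _ (Prod.ext (h1.trans h1'.symm) (h2.trans h2'.symm))
  subst this
  rcases h3 with ⟨h3, h4⟩ | ⟨h3, h4⟩ <;> rcases h3' with ⟨h3', h4'⟩ | ⟨h3', h4'⟩
  · exact hab (h3.symm.trans h3')
  · exact hac (h3.symm.trans h3')
  · exact hac (h4.symm.trans h4')
  · exact hab (h4.symm.trans h4')

/-- The faces at a vertex do not separate the dual graph. -/
theorem not_separating_facesAt (h : ρ.IsPlaneCubic) (v : V) :
    ¬ Separating ρ.dual (ρ.facesAt v) := by
  classical
  rintro ⟨P, hP, ⟨f, hf, hPf⟩, g, hg, hPg⟩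
  set t := ρ.facesAt v with ht
  obtain ⟨x, rfl⟩ := ρ.left_surjective f
  obtain ⟨y, rfl⟩ := ρ.left_surjective g
  have hx : x.fst ≠ v := fun hv => hf ⟨x, hv, rfl⟩
  have hy : y.fst ≠ v := fun hv => hg ⟨y, hv, rfl⟩
  have hprop : ∀ u a b, a ∈ ρ.facesAt u → b ∈ ρ.facesAt u → a ∉ t → b ∉ t → P a → P b := by
    intro u a b ha hb hat hbt hPa
    by_cases hab : a = b
    · rwa [← hab]
    · exact hP a b (h.adj_of_facesAt ha hb hab) hat hbt hPa
  have key := h.conn.propagate (S := {v}) (p := fun u => ∃ a, a ∈ ρ.facesAt u ∧ a ∉ t ∧ P a)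
    (by simp) ?_ (u := x.fst) (v := y.fst) (by simpa using hx) (by simpa using hy)
    ⟨_, left_mem_facesAt x, hf, hPf⟩
  · obtain ⟨a, ha, hat, hPa⟩ := key
    exact hPg (hprop _ a _ ha (left_mem_facesAt y) hat hg hPa)
  · rintro a b hab ha hb ⟨f, hfa, hft, hPf⟩
    simp only [Finset.mem_singleton] at ha hb
    let d : G.Dart := ⟨(a, b), hab⟩
    -- If both sides of the edge were faces at `v`, they would be common to `v` and `b`, so the edge
    -- itself would end at `v`. A side outside `t` carries the property across the edge.
    have h1 : ρ.left d ∉ t ∨ ρ.left d.symm ∉ t := by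
      by_contra hne
      rw [not_or, not_not, not_not] at hne
      obtain ⟨e', h2', h3', h4'⟩ := h.exists_dart_of_common_faces (Ne.symm hb) hne.1 hne.2
        (left_mem_facesAt_snd d) (left_mem_facesAt d.symm) (h.left_ne d)
      have key : e' = d ∨ e' = d.symm := by
        rcases h4' with h4' | h4'
        · left; exact h.dart_eq_of_left _ _ h4'.1 h4'.2
        · right; exact h.dart_eq_of_left _ _ h4'.1 (by rw [Dart.symm_symm]; exact h4'.2)
      rcases key with rfl | rfl
      · exact ha h2'
      · exact hb h2'
    rcases h1 with h1 | h1
    · exact ⟨_, left_mem_facesAt_snd d, h1,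
        hprop a f _ hfa (left_mem_facesAt d) hft h1 hPf⟩
    · exact ⟨_, left_mem_facesAt d.symm, h1,
        hprop a f _ hfa (left_symm_mem_facesAt d) hft h1 hPf⟩

open scoped Classical in
theorem sum_indicator (d : G.Dart) (f : ρ.untwisted.Face) :
    ∑ x ∈ Finset.univ.filter (fun x : G.Dart => ρ.left x = f),
      ((if x = d then (1 : ZMod 2) else 0) + if x = d.symm then 1 else 0) =
      (if ρ.left d = f then 1 else 0) + if ρ.left d.symm = f then 1 else 0 := by
  rw [Finset.sum_add_distrib, Finset.sum_ite_eq', Finset.sum_ite_eq']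
  simp

/-- A triangle of the dual graph that is not formed by the faces at a vertex is separating. -/
theorem separating_of_triangle (h : ρ.IsPlaneCubic) {a b c : ρ.untwisted.Face}
    (hab : ρ.dual.Adj a b) (hbc : ρ.dual.Adj b c) (hca : ρ.dual.Adj c a)
    (hne : ∀ v, ρ.facesAt v ≠ {a, b, c}) : Separating ρ.dual {a, b, c} := by
  classical
  obtain ⟨-, d1, h1, h1'⟩ := ρ.dual_adj_iff.1 hab
  obtain ⟨-, d2, h2, h2'⟩ := ρ.dual_adj_iff.1 hbc
  obtain ⟨-, d3, h3, h3'⟩ := ρ.dual_adj_iff.1 hca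
  let ind : G.Dart → G.Dart → ZMod 2 := fun d x =>
    (if x = d then (1 : ZMod 2) else 0) + if x = d.symm then 1 else 0
  have hsymm : ∀ d x : G.Dart, ind d x.symm = ind d x := by
    intro d x
    have e1 : x.symm = d ↔ x = d.symm :=
      ⟨fun h => by rw [← h, Dart.symm_symm], fun h => by rw [h, Dart.symm_symm]⟩
    have e2 : x.symm = d.symm ↔ x = d := Dart.symm_involutive.injective.eq_iff
    simp only [ind, e1, e2]
    exact add_comm _ _
  -- The three dual edges form an even set, hence a cut with sides given by `ε`.
  obtain ⟨ε, hε⟩ := h.exists_vertex_potential (fun x => ind d1 x + ind d2 x + ind d3 x)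
    (fun x => by simp only [hsymm]) (fun f => by
      rw [Finset.sum_add_distrib, Finset.sum_add_distrib]
      simp only [ind]
      rw [sum_indicator, sum_indicator, sum_indicator, h1, h1', h2, h2', h3, h3']
      generalize (if a = f then (1 : ZMod 2) else 0) = p
      generalize (if b = f then (1 : ZMod 2) else 0) = q
      generalize (if c = f then (1 : ZMod 2) else 0) = r
      revert p q r; decide)
  have hind : ∀ d x, ρ.left x ∉ ({a, b, c} : Set ρ.untwisted.Face) →
      ρ.left d ∈ ({a, b, c} : Set ρ.untwisted.Face) →
      ρ.left d.symm ∈ ({a, b, c} : Set ρ.untwisted.Face) → ind d x = 0 := by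
    intro d x hx hd hd'
    simp only [ind]
    rw [if_neg, if_neg, add_zero]
    · rintro rfl; exact hx hd'
    · rintro rfl; exact hx hd
  have hout : ∀ x, ρ.left x ∉ ({a, b, c} : Set ρ.untwisted.Face) → ε x.fst = ε x.snd := by
    intro x hx
    have := hε x
    rw [hind d1 x hx (by simp [h1]) (by simp [h1']), hind d2 x hx (by simp [h2]) (by simp [h2']),
      hind d3 x hx (by simp [h3]) (by simp [h3']), add_zero, add_zero] at this
    exact CharTwo.add_eq_zero.1 this.symm
  have hd1 : ε d1.fst ≠ ε d1.snd := by
    intro heq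
    have e := hε d1
    have e1 : ind d1 d1 = 1 := by simp [ind, d1.symm_ne.symm]
    have e2 : ind d2 d1 = 0 := by
      simp only [ind]
      rw [if_neg, if_neg, add_zero]
      · intro h'
        rw [h', h2'] at h1
        exact hca.ne h1
      · intro h'
        rw [h', h2] at h1
        exact hab.ne h1.symm
    have e3 : ind d3 d1 = 0 := by
      simp only [ind]
      rw [if_neg, if_neg, add_zero]
      · intro h'
        rw [h', Dart.symm_symm, h3] at h1'
        exact hbc.ne h1'.symm
      · intro h'
        rw [h', h3] at h1
        exact hca.ne h1
    simp only [e1, e2, e3, heq, CharTwo.add_self_eq_zero] at e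
    simp at e
  -- Since the triangle is not formed by the faces at any vertex, every vertex lies on a face
  -- outside it. So both sides of the cut are seen by such faces.
  have hface : ∀ v, ∃ x : G.Dart, x.fst = v ∧
      ρ.left x ∉ ({a, b, c} : Set ρ.untwisted.Face) := by
    intro v
    by_contra hall
    push Not at hall
    apply hne v
    have hsub : ρ.facesAt v ⊆ {a, b, c} := by
      rintro _ ⟨x, hx, rfl⟩
      exact hall x hx
    obtain ⟨p, q, r, hpq, hqr, hpr, ht⟩ := h.exists_facesAt v
    rw [ht] at hsub ⊢
    have hfin : ({p, q, r} : Finset ρ.untwisted.Face) ⊆ {a, b, c} := by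
      intro x hx
      have := hsub (by simpa using hx : x ∈ ({p, q, r} : Set ρ.untwisted.Face))
      simpa using this
    have hcard : ({p, q, r} : Finset ρ.untwisted.Face).card = 3 :=
      Finset.card_eq_three.2 ⟨p, q, r, hpq, hpr, hqr, rfl⟩
    have heq := Finset.eq_of_subset_of_card_le hfin (by rw [hcard]; exact Finset.card_le_three)
    have := congrArg (fun s : Finset ρ.untwisted.Face => (s : Set ρ.untwisted.Face)) heq
    simpa using this
  have hconst : ∀ x y : G.Dart, ρ.left x = ρ.left y →
      ρ.left x ∉ ({a, b, c} : Set ρ.untwisted.Face) → ε x.fst = ε y.fst := by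
    intro x y hxy hx
    exact eq_on_face (f := ρ.left x) (fun z hz => hout z (by rwa [hz])) rfl hxy.symm
  obtain ⟨u, u', hu, hu'⟩ : ∃ u u', ε u = 1 ∧ ε u' ≠ 1 := by
    by_cases h0 : ε d1.fst = 1
    · exact ⟨_, d1.snd, h0, fun h' => hd1 (h0.trans h'.symm)⟩
    · refine ⟨d1.snd, _, zmod_two_eq_one fun h' => hd1 ?_, h0⟩
      rw [h']
      by_contra h2
      exact h0 (zmod_two_eq_one h2)
  obtain ⟨x, rfl, hx⟩ := hface u
  obtain ⟨y, rfl, hy⟩ := hface u'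
  -- A face outside the triangle has no cut edge on its boundary, so it lies on one side of the cut,
  -- and adjacent faces of this kind lie on the same side.
  refine ⟨fun f => ∃ z : G.Dart, ρ.left z = f ∧ ε z.fst = 1, ?_, ⟨_, hx, x, rfl, hu⟩, _, hy, ?_⟩
  · rintro f g hfg hf hg ⟨z, rfl, hz⟩
    obtain ⟨-, d, hd, rfl⟩ := ρ.dual_adj_iff.1 hfg
    refine ⟨d.symm, rfl, ?_⟩
    rw [← hz, hconst z d hd.symm hf]
    exact (hout d (by rwa [hd])).symm
  · rintro ⟨z, hz, hz1⟩
    exact hu' (by rw [hconst y z hz.symm hy, hz1])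

/-- Among the triangles of the dual graph, those around a vertex are recognised by not being
separating, a property that automorphisms preserve. -/
theorem exists_facesAt_image (h : ρ.IsPlaneCubic) (ψ : ρ.dual ≃g ρ.dual) (v : V) :
    ∃ v', ρ.facesAt v' = ψ '' ρ.facesAt v := by
  by_contra hne
  push Not at hne
  obtain ⟨a, b, c, hab, hbc, hac, ht⟩ := h.exists_facesAt v
  have ha : a ∈ ρ.facesAt v := by rw [ht]; simp
  have hb : b ∈ ρ.facesAt v := by rw [ht]; simp
  have hc : c ∈ ρ.facesAt v := by rw [ht]; simp
  have himg : ψ '' ρ.facesAt v = {ψ a, ψ b, ψ c} := by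
    rw [ht, Set.image_insert_eq, Set.image_pair]
  have hsep := h.separating_of_triangle (ψ.map_adj_iff.2 (h.adj_of_facesAt ha hb hab))
    (ψ.map_adj_iff.2 (h.adj_of_facesAt hb hc hbc))
    (ψ.map_adj_iff.2 (h.adj_of_facesAt hc ha hac.symm)) (fun v' => by rw [← himg]; exact hne v')
  rw [← himg] at hsep
  exact h.not_separating_facesAt v (Separating.of_image ψ hsep)

/-- Every automorphism of the dual graph comes from an automorphism of the graph. -/
theorem exists_iso_of_dual (h : ρ.IsPlaneCubic) (ψ : ρ.dual ≃g ρ.dual) :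
    ∃ φ : G ≃g G, ρ.Induces φ ψ := by
  -- A vertex is determined by its three faces, so `ψ` moves vertices. Two vertices are adjacent iff
  -- they have two common faces, the sides of the edge, so adjacency is preserved.
  choose φ hφ using h.exists_facesAt_image ψ
  choose φ' hφ' using h.exists_facesAt_image ψ.symm
  have hl : Function.LeftInverse φ' φ := fun v => h.facesAt_subset (by
    rw [hφ', hφ, Set.image_image]; simp)
  have hr : Function.RightInverse φ' φ := fun v => h.facesAt_subset (by
    rw [hφ, hφ', Set.image_image]; simp)
  have hmem : ∀ v f, ψ f ∈ ρ.facesAt (φ v) ↔ f ∈ ρ.facesAt v := by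
    intro v f
    rw [hφ]; exact ψ.injective.mem_set_image
  have hsides : ∀ d : G.Dart, ∃ e : G.Dart, e.fst = φ d.fst ∧ e.snd = φ d.snd ∧
      ((ρ.left e = ψ (ρ.left d) ∧ ρ.left e.symm = ψ (ρ.left d.symm)) ∨
        (ρ.left e = ψ (ρ.left d.symm) ∧ ρ.left e.symm = ψ (ρ.left d))) := fun d =>
    h.exists_dart_of_common_faces (fun h' => d.fst_ne_snd (hl.injective h'))
      ((hmem _ _).2 (left_mem_facesAt d)) ((hmem _ _).2 (left_symm_mem_facesAt d))
      ((hmem _ _).2 (left_mem_facesAt_snd d)) ((hmem _ _).2 (left_mem_facesAt d.symm))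
      (fun h' => h.left_ne d (ψ.injective h'))
  let Φ : G ≃g G := ⟨⟨φ, φ', hl, hr⟩, by
    intro a b
    constructor
    · intro hab
      let d' : G.Dart := ⟨(φ a, φ b), hab⟩
      have hne : a ≠ b := fun h' => hab.ne (congrArg φ h')
      have e1 : ψ.symm (ρ.left d') ∈ ρ.facesAt a := by
        rw [← hmem, RelIso.apply_symm_apply]; exact left_mem_facesAt d'
      have e2 : ψ.symm (ρ.left d'.symm) ∈ ρ.facesAt a := by
        rw [← hmem, RelIso.apply_symm_apply]; exact left_symm_mem_facesAt d'
      have e3 : ψ.symm (ρ.left d') ∈ ρ.facesAt b := by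
        rw [← hmem, RelIso.apply_symm_apply]; exact left_mem_facesAt_snd d'
      have e4 : ψ.symm (ρ.left d'.symm) ∈ ρ.facesAt b := by
        rw [← hmem, RelIso.apply_symm_apply]; exact left_mem_facesAt d'.symm
      obtain ⟨e, rfl, rfl, -⟩ := h.exists_dart_of_common_faces hne e1 e2 e3 e4
        (fun h' => h.left_ne d' (ψ.symm.injective h'))
      exact e.adj
    · intro hab
      obtain ⟨e, h1, h2, -⟩ := hsides ⟨(a, b), hab⟩
      have := e.adj
      rw [h1, h2] at this
      exact this⟩
  refine ⟨Φ, fun d => ?_⟩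
  obtain ⟨e, h1, h2, h3⟩ := hsides d
  have : e = dartEquiv Φ d := Dart.ext _ _ (Prod.ext h1 h2)
  rwa [this] at h3

end IsPlaneCubic

end RotationSystem

end StrongEmb

namespace StrongEmb

open SimpleGraph

/-! ### Matrices given by a bilinear form on labels -/

section Forms

/-- A symmetric bilinear form on pairs over the field with two elements. -/
structure IsForm (q : ZMod 2 × ZMod 2 → ZMod 2 × ZMod 2 → ZMod 2) : Prop where
  add_right : ∀ a b c, q a (b + c) = q a b + q a c
  symm : ∀ a b, q a b = q b a

namespace IsForm

variable {q : ZMod 2 × ZMod 2 → ZMod 2 × ZMod 2 → ZMod 2}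

theorem zero_right (hq : IsForm q) (a : ZMod 2 × ZMod 2) : q a 0 = 0 := by
  have := hq.add_right a 0 0
  rw [add_zero, CharTwo.add_self_eq_zero] at this
  exact this

theorem zero_left (hq : IsForm q) (a : ZMod 2 × ZMod 2) : q 0 a = 0 := by
  rw [hq.symm, hq.zero_right]

theorem smul_right (hq : IsForm q) (k : ZMod 2) (a b : ZMod 2 × ZMod 2) :
    q a (k • b) = q a b * k := by
  by_cases hk : k = 0
  · rw [hk, zero_smul, hq.zero_right, mul_zero]
  · rw [zmod_two_eq_one hk, one_smul, mul_one]

theorem sum_right (hq : IsForm q) {ι : Type*} (s : Finset ι) (a : ZMod 2 × ZMod 2)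
    (b : ι → ZMod 2 × ZMod 2) : q a (∑ i ∈ s, b i) = ∑ i ∈ s, q a (b i) := by
  classical
  induction s using Finset.induction_on with
  | empty => simp [hq.zero_right]
  | insert i s hi ih => rw [Finset.sum_insert hi, Finset.sum_insert hi, hq.add_right, ih]

end IsForm

/-- The form of rank one. -/
def formP (a b : ZMod 2 × ZMod 2) : ZMod 2 := a.1 * b.1

/-- The alternating form. -/
def formA (a b : ZMod 2 × ZMod 2) : ZMod 2 := a.1 * b.2 + a.2 * b.1

/-- The standard form. -/
def formN (a b : ZMod 2 × ZMod 2) : ZMod 2 := a.1 * b.1 + a.2 * b.2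

theorem isForm_formP : IsForm formP :=
  ⟨fun a b c => by simp [formP]; ring, fun a b => by simp [formP]; ring⟩

theorem isForm_formA : IsForm formA :=
  ⟨fun a b c => by simp [formA]; ring, fun a b => by simp [formA]; ring⟩

theorem isForm_formN : IsForm formN :=
  ⟨fun a b c => by simp [formN]; ring, fun a b => by simp [formN]; ring⟩

/-- No nonzero pair is orthogonal to two distinct nonzero pairs. -/
def IsNondegenerate (q : ZMod 2 × ZMod 2 → ZMod 2 × ZMod 2 → ZMod 2) : Prop :=
  ∀ p p' c, p ≠ 0 → p' ≠ 0 → p ≠ p' → q p c = 0 → q p' c = 0 → c = 0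

theorem isNondegenerate_formA : IsNondegenerate formA := by unfold IsNondegenerate formA; decide

theorem isNondegenerate_formN : IsNondegenerate formN := by unfold IsNondegenerate formN; decide

variable {n : Type*} [Fintype n] {M : Matrix n n (ZMod 2)}
  {q : ZMod 2 × ZMod 2 → ZMod 2 × ZMod 2 → ZMod 2} {τ : n → ZMod 2 × ZMod 2}

theorem mulVec_of_form (hq : IsForm q) (hM : ∀ i j, M i j = q (τ i) (τ j)) (w : n → ZMod 2)
    (i : n) : M.mulVec w i = q (τ i) (∑ j, w j • τ j) := by
  rw [hq.sum_right]
  simp only [Matrix.mulVec, dotProduct, hM, hq.smul_right]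

/-- Two distinct nonzero labels span the plane, so the range of `M` consists of all functions `j ↦ q
(τ j) c`. Nondegeneracy makes `c ↦ q (τ ·) c` injective, so the dimension is two. -/
theorem rank_of_form (hq : IsForm q) (hnd : IsNondegenerate q)
    (hM : ∀ i j, M i j = q (τ i) (τ j)) {i i' : n} (hi : τ i ≠ 0) (hi' : τ i' ≠ 0)
    (hne : τ i ≠ τ i') : M.rank = 2 := by
  classical
  let A : (ZMod 2 × ZMod 2) →ₗ[ZMod 2] (n → ZMod 2) :=
    { toFun := fun c j => q (τ j) c
      map_add' := fun a b => funext fun j => hq.add_right _ _ _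
      map_smul' := fun k a => funext fun j => by
        rw [hq.smul_right, Pi.smul_apply, RingHom.id_apply, smul_eq_mul, mul_comm] }
  have hspan : ∀ p p' c : ZMod 2 × ZMod 2, p ≠ 0 → p' ≠ 0 → p ≠ p' →
      ∃ a b : ZMod 2, c = a • p + b • p' := by decide
  have hrange : LinearMap.range M.mulVecLin = LinearMap.range A := by
    apply le_antisymm
    · rintro _ ⟨w, rfl⟩
      exact ⟨∑ j, w j • τ j, funext fun i => (mulVec_of_form hq hM w i).symm⟩
    · rintro _ ⟨c, rfl⟩
      obtain ⟨a, b, rfl⟩ := hspan _ _ c hi hi' hne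
      refine ⟨Pi.single i a + Pi.single i' b, funext fun j => ?_⟩
      rw [Matrix.mulVecLin_apply, mulVec_of_form hq hM]
      change _ = q (τ j) _
      congr 1
      simp [add_smul, Finset.sum_add_distrib, Pi.single_apply]
  have hinj : LinearMap.ker A = ⊥ := by
    rw [LinearMap.ker_eq_bot']
    intro c hc
    exact hnd _ _ c hi hi' hne (congrFun hc i) (congrFun hc i')
  have h1 := LinearMap.finrank_range_add_finrank_ker A
  rw [hinj, finrank_bot, Module.finrank_prod, Module.finrank_self] at h1
  rw [Matrix.rank, hrange]
  exact h1

end Forms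

/-! ### Labelled faces: adjacency, strength and realisation of labels. -/

namespace RotationSystem

variable {V : Type u} {G : SimpleGraph V} {ρ : RotationSystem G}

theorem twist_sgn (H : ρ.dual.Subgraph) (d : G.Dart) :
    (ρ.twist H).sgn d = -1 ↔ H.Adj (ρ.left d) (ρ.left d.symm) := by
  classical
  have key : (∃ d' : G.Dart, d'.edge = d.edge ∧
      H.Adj (ρ.untwisted.face (d', 1)) (ρ.untwisted.face (d', -1))) ↔
      H.Adj (ρ.left d) (ρ.left d.symm) := by
    simp only [face_neg_one_eq]
    constructor
    · rintro ⟨d', he, hd⟩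
      rcases (dart_edge_eq_iff _ _).1 he with rfl | rfl
      · exact hd
      · rw [Dart.symm_symm] at hd
        exact hd.symm
    · intro hd
      exact ⟨d, rfl, hd⟩
  rw [← key]
  simp only [Embedding.sgn, twist]
  split_ifs with h1
  · simp [h1]
  · simp [h1]

theorem twist_twistedGraph (H : ρ.dual.Subgraph) (f g : ρ.untwisted.Face) :
    (ρ.twistedGraph (ρ.twist H).sign).Adj f g ↔ H.Adj f g := by
  constructor
  · rintro ⟨-, d, rfl, rfl, hd⟩
    exact (twist_sgn H d).1 hd
  · intro hfg
    obtain ⟨hne, d, rfl, rfl⟩ := ρ.dual_adj_iff.1 hfg.adj_sub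
    exact ⟨hne, d, rfl, rfl, (twist_sgn H d).2 hfg⟩

variable [Fintype V] [DecidableRel G.Adj]

theorem IsPlaneCubic.twist_eq_signed (h : ρ.IsPlaneCubic) (H : ρ.dual.Subgraph)
    (l : G.edgeSet → ℤˣ) (hH : ∀ f g, H.Adj f g ↔ (ρ.twistedGraph l).Adj f g) :
    ρ.twist H = ρ.signed l := by
  have hs : (ρ.twist H).sign = l := by
    funext e
    have h1 : (ρ.twist H).sgn (someDart e) = (ρ.signed l).sgn (someDart e) := by
      have h2 : (ρ.twist H).sgn (someDart e) = -1 ↔ (ρ.signed l).sgn (someDart e) = -1 := by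
        rw [twist_sgn, hH, h.twistedGraph_adj_iff]
      rcases Int.units_eq_one_or ((ρ.twist H).sgn (someDart e)) with h3 | h3 <;>
        rcases Int.units_eq_one_or ((ρ.signed l).sgn (someDart e)) with h4 | h4
      · rw [h3, h4]
      · exact (h2.2 h4).trans h4.symm
      · exact h3.trans (h2.1 h3).symm
      · rw [h3, h4]
    have he : (⟨(someDart e).edge, (someDart e).edge_mem⟩ : G.edgeSet) = e :=
      Subtype.ext (someDart_edge e)
    unfold Embedding.sgn at h1
    rw [he] at h1
    exact h1
  change (⟨ρ, (ρ.twist H).sign⟩ : Embedding G) = ⟨ρ, l⟩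
  rw [hs]

/-- The labels `τ` describe the Laplacian of the twisted graph of `l` by means of the form `q`. -/
def Labels (ρ : RotationSystem G) (q : ZMod 2 × ZMod 2 → ZMod 2 × ZMod 2 → ZMod 2)
    (l : G.edgeSet → ℤˣ) (τ : ρ.untwisted.Face → ZMod 2 × ZMod 2) : Prop :=
  ∀ f g, ρ.lap l f g = q (τ f) (τ g)

/-- No pair of adjacent faces is cut out of the faces by the form `q`. -/
def NoAdjacentPair (ρ : RotationSystem G) (q : ZMod 2 × ZMod 2 → ZMod 2 × ZMod 2 → ZMod 2)
    (τ : ρ.untwisted.Face → ZMod 2 × ZMod 2) : Prop :=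
  ∀ c f g, ρ.dual.Adj f g → ¬ ∀ x, q (τ x) c = 1 ↔ x = f ∨ x = g

namespace Labels

variable {q : ZMod 2 × ZMod 2 → ZMod 2 × ZMod 2 → ZMod 2} {l : G.edgeSet → ℤˣ}
  {τ : ρ.untwisted.Face → ZMod 2 × ZMod 2}

/-- The adjacency gives the entries off the diagonal. The diagonal follows because the rows of both
matrices sum to zero: for the Laplacian always, for the form because the labels sum to zero. -/
theorem of_adj (hq : IsForm q)
    (hT : ∀ f g, f ≠ g → ((ρ.twistedGraph l).Adj f g ↔ q (τ f) (τ g) = 1))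
    (hsum : ∑ f, τ f = 0) : ρ.Labels q l τ := by
  classical
  have hoff : ∀ f g, f ≠ g → ρ.lap l f g = q (τ f) (τ g) := by
    intro f g hfg
    rw [ρ.lap_apply_of_ne l hfg]
    split_ifs with hadj
    · exact ((hT f g hfg).1 hadj).symm
    · by_contra h0
      exact hadj ((hT f g hfg).2 (zmod_two_eq_one (Ne.symm h0)))
  intro f g
  by_cases hfg : f = g
  · subst hfg
    have h1 : ∑ g, ρ.lap l f g = 0 := by
      have := congrFun (lapMatrix_mulVec_const_eq_zero (R := ZMod 2) (ρ.twistedGraph l)) f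
      rw [Matrix.mulVec, dotProduct] at this
      simpa [lap] using this
    have h2 : ∑ g, q (τ f) (τ g) = 0 := by rw [← hq.sum_right, hsum, hq.zero_right]
    rw [← Finset.add_sum_erase _ _ (Finset.mem_univ f)] at h1 h2
    have h3 : ∑ g ∈ Finset.univ.erase f, ρ.lap l f g =
        ∑ g ∈ Finset.univ.erase f, q (τ f) (τ g) :=
      Finset.sum_congr rfl fun g hg => hoff f g (Finset.ne_of_mem_erase hg).symm
    rw [h3] at h1
    exact add_right_cancel (h1.trans h2.symm)
  · exact hoff f g hfg

theorem adj_iff (hL : ρ.Labels q l τ) {f g : ρ.untwisted.Face} (hfg : f ≠ g) :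
    (ρ.twistedGraph l).Adj f g ↔ q (τ f) (τ g) = 1 := by
  classical
  rw [← hL, ρ.lap_apply_of_ne l hfg]
  simp

/-- Every vector in the range of the Laplacian is `x ↦ q (τ x) c` for some `c`. It equals `e_f +
e_g` iff `f` and `g` are exactly the faces on which the functional is one. -/
theorem isStrong (h : ρ.IsPlaneCubic) (hq : IsForm q) (hL : ρ.Labels q l τ)
    (hS : ρ.NoAdjacentPair q τ) : (ρ.signed l).IsStrong := by
  classical
  rw [h.isStrong_signed]
  rintro f g hfg ⟨w, hw⟩
  refine hS (∑ j, w j • τ j) f g hfg fun x => ?_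
  rw [← mulVec_of_form hq hL, ← Matrix.mulVecLin_apply, hw, Pi.add_apply, Pi.single_apply,
    Pi.single_apply]
  have hne := hfg.ne
  by_cases h1 : x = f
  · have h2 : x ≠ g := fun h2 => hne (h1.symm.trans h2)
    simp [h1, hne]
  · by_cases h2 : x = g
    · simp [h2, hne.symm]
    · simp [h1, h2]

theorem noAdjacentPair (h : ρ.IsPlaneCubic)
    (hr : ∀ c, (fun f => q (τ f) c) ∈ LinearMap.range (ρ.lap l).mulVecLin)
    (hs : (ρ.signed l).IsStrong) : ρ.NoAdjacentPair q τ := by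
  classical
  intro c f g hfg hx
  refine (h.isStrong_signed l).1 hs f g hfg ?_
  convert hr c using 1
  funext x
  have hne := hfg.ne
  rw [Pi.add_apply, Pi.single_apply, Pi.single_apply]
  by_cases h1 : x = f
  · rw [(hx x).2 (Or.inl h1), if_pos h1, if_neg (fun h2 => hne (h1.symm.trans h2)), add_zero]
  · by_cases h2 : x = g
    · rw [(hx x).2 (Or.inr h2), if_neg h1, if_pos h2, zero_add]
    · rw [if_neg h1, if_neg h2, add_zero]
      by_contra h0
      exact (not_or.2 ⟨h1, h2⟩) ((hx x).1 (zmod_two_eq_one (Ne.symm h0)))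

end Labels

/-! ### The embeddings defined by a labelled subgraph -/

/-- The labels of the model graph are transported to `H` and extended by zero. Only labels in `H`
can then contribute to a pair cut out by the form, so strength becomes a condition on the model. -/
theorem exists_labels_of_iso {q : ZMod 2 × ZMod 2 → ZMod 2 × ZMod 2 → ZMod 2} (hq : IsForm q)
    {U : Type} [Fintype U] {K : SimpleGraph U} {σ : U → ZMod 2 × ZMod 2}
    (hK : ∀ u v, u ≠ v → (K.Adj u v ↔ q (σ u) (σ v) = 1)) (hsum : ∑ u, σ u = 0)
    {H : ρ.dual.Subgraph} (e : H.coe ≃g K)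
    (hS : ∀ c u v, u ≠ v → (∀ t, q (σ t) c = 1 ↔ t = u ∨ t = v) →
      ¬ ρ.dual.Adj (e.symm u) (e.symm v)) :
    ∃ τ, ρ.Labels q (ρ.twist H).sign τ ∧ ρ.NoAdjacentPair q τ ∧ ∀ u, τ (e.symm u) = σ u := by
  classical
  let τ : ρ.untwisted.Face → ZMod 2 × ZMod 2 := fun f =>
    if hf : f ∈ H.verts then σ (e ⟨f, hf⟩) else 0
  have hτ : ∀ x : H.verts, τ x = σ (e x) := fun x => dif_pos x.2
  have hτ0 : ∀ f, f ∉ H.verts → τ f = 0 := fun f hf => dif_neg hf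
  have hτe : ∀ u, τ (e.symm u) = σ u := fun u => by rw [hτ, RelIso.apply_symm_apply]
  refine ⟨τ, Labels.of_adj hq ?_ ?_, ?_, hτe⟩
  · intro f g hfg
    rw [twist_twistedGraph]
    by_cases hf : f ∈ H.verts
    · by_cases hg : g ∈ H.verts
      · have h1 := hK (e ⟨f, hf⟩) (e ⟨g, hg⟩) (fun h' => hfg (by
          simpa using e.injective h'))
        rw [e.map_adj_iff, Subgraph.coe_adj, ← hτ, ← hτ] at h1
        exact h1
      · rw [hτ0 g hg, hq.zero_right]
        exact ⟨fun h' => absurd h'.snd_mem hg, fun h' => absurd h' (by decide)⟩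
    · rw [hτ0 f hf, hq.zero_left]
      exact ⟨fun h' => absurd h'.fst_mem hf, fun h' => absurd h' (by decide)⟩
  · rw [← hsum, ← Finset.sum_subset (Finset.subset_univ (Finset.univ.image fun u =>
      ((e.symm u : H.verts) : ρ.untwisted.Face))), Finset.sum_image]
    · exact Finset.sum_congr rfl fun u _ => hτe u
    · intro u _ v _ huv
      exact e.symm.injective (Subtype.ext huv)
    · intro f _ hf
      apply hτ0
      intro hf'
      apply hf
      rw [Finset.mem_image]
      exact ⟨e ⟨f, hf'⟩, Finset.mem_univ _, by rw [RelIso.symm_apply_apply]⟩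
  · intro c f g hfg hx
    have hmem : ∀ x, q (τ x) c = 1 → x ∈ H.verts := by
      intro x hx'
      by_contra h0
      rw [hτ0 x h0, hq.zero_left] at hx'
      exact zero_ne_one hx'
    have hf := hmem f ((hx f).2 (Or.inl rfl))
    have hg := hmem g ((hx g).2 (Or.inr rfl))
    refine hS c (e ⟨f, hf⟩) (e ⟨g, hg⟩) (fun h' => hfg.ne (by simpa using e.injective h'))
      (fun t => ?_) (by simpa using hfg)
    rw [← hτe, hx]
    constructor
    · rintro (h1 | h1)
      · left; rw [← e.apply_symm_apply t]; congr 1; exact Subtype.ext h1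
      · right; rw [← e.apply_symm_apply t]; congr 1; exact Subtype.ext h1
    · rintro (rfl | rfl)
      · left; rw [RelIso.symm_apply_apply]
      · right; rw [RelIso.symm_apply_apply]

/-! ### Subgraphs with given labels -/

/-- The subgraph of the dual graph formed by the dual edges of the twisted edges and the faces with
nonzero label. -/
def labelSubgraph {q : ZMod 2 × ZMod 2 → ZMod 2 × ZMod 2 → ZMod 2} (hq : IsForm q)
    {l : G.edgeSet → ℤˣ} {τ : ρ.untwisted.Face → ZMod 2 × ZMod 2} (hL : ρ.Labels q l τ) :
    ρ.dual.Subgraph where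
  verts := {f | τ f ≠ 0}
  Adj := (ρ.twistedGraph l).Adj
  adj_sub h := ρ.twistedGraph_le_dual l h
  edge_vert {f g} h := by
    intro h0
    have := (hL.adj_iff h.ne).1 h
    rw [h0, hq.zero_left] at this
    exact zero_ne_one this
  symm := (ρ.twistedGraph l).symm

open scoped Classical in
/-- The number of faces with a given label. -/
noncomputable def labelCount (τ : ρ.untwisted.Face → ZMod 2 × ZMod 2) (p : ZMod 2 × ZMod 2) : ℕ :=
  (Finset.univ.filter fun f => τ f = p).card

/-- Adjacency of distinct faces depends only on their labels, so every label-preserving bijection is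
an isomorphism. One exists as soon as the label classes have equal sizes. -/
theorem exists_iso_labelSubgraph {q : ZMod 2 × ZMod 2 → ZMod 2 × ZMod 2 → ZMod 2} (hq : IsForm q)
    {l : G.edgeSet → ℤˣ} {τ : ρ.untwisted.Face → ZMod 2 × ZMod 2} (hL : ρ.Labels q l τ)
    {U : Type} [Fintype U] {K : SimpleGraph U} {σ : U → ZMod 2 × ZMod 2}
    (hK : ∀ u v, u ≠ v → (K.Adj u v ↔ q (σ u) (σ v) = 1)) (hσ : ∀ u, σ u ≠ 0)
    (hcount : ∀ p, p ≠ 0 → labelCount τ p = (Finset.univ.filter fun u => σ u = p).card) :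
    ∃ e : (labelSubgraph hq hL).coe ≃g K, ∀ u, τ (e.symm u) = σ u := by
  classical
  have hcard : ∀ p, Nonempty ({x : (labelSubgraph hq hL).verts // τ x = p} ≃ {u // σ u = p}) := by
    intro p
    by_cases hp : p = 0
    · subst hp
      have : IsEmpty {x : (labelSubgraph hq hL).verts // τ x = 0} := ⟨fun x => x.1.2 x.2⟩
      have : IsEmpty {u // σ u = 0} := ⟨fun x => hσ x.1 x.2⟩
      exact ⟨Equiv.equivOfIsEmpty _ _⟩
    · have e1 : {x : (labelSubgraph hq hL).verts // τ x = p} ≃ {f // τ f = p} :=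
        { toFun := fun x => ⟨x.1.1, x.2⟩
          invFun := fun f => ⟨⟨f.1, fun h0 => hp (f.2.symm.trans h0)⟩, f.2⟩
          left_inv := fun x => rfl
          right_inv := fun x => rfl }
      have h1 := hcount p hp
      unfold labelCount at h1
      rw [← Fintype.card_subtype, ← Fintype.card_subtype] at h1
      exact ⟨e1.trans (Fintype.equivOfCardEq h1)⟩
  let e : (labelSubgraph hq hL).verts ≃ U :=
    Equiv.ofFiberEquiv (f := fun x : (labelSubgraph hq hL).verts => τ x) (g := σ)
      fun p => (hcard p).some
  have he : ∀ x, σ (e x) = τ x := fun x => Equiv.ofFiberEquiv_map _ x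
  refine ⟨⟨e, ?_⟩, fun u => ?_⟩
  · intro x y
    by_cases hxy : x = y
    · subst hxy; simp
    · rw [hK _ _ (fun h' => hxy (e.injective h')), he, he, Subgraph.coe_adj]
      exact (hL.adj_iff (fun h' => hxy (Subtype.ext h'))).symm
  · change τ (e.symm u) = σ u
    rw [← he, Equiv.apply_symm_apply]

end RotationSystem

end StrongEmb

namespace StrongEmb

open SimpleGraph

/-! ### Labels of the graphs in the families -/

section Models

/-- Labels of the vertices of `graphA3`. -/
def labelA3 : Fin 4 ⊕ Fin 4 → ZMod 2 × ZMod 2 := Sum.elim (fun _ => (1, 0)) (fun _ => (0, 1))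

/-- Labels of the vertices of `graphA5`. -/
def labelA5 : Fin 7 → ZMod 2 × ZMod 2 :=
  ![(1, 0), (1, 0), (1, 0), (1, 1), (0, 1), (0, 1), (0, 1)]

/-- Labels of the vertices of `graphA6`. -/
def labelA6 : Fin 6 → ZMod 2 × ZMod 2 := ![(1, 0), (1, 0), (1, 1), (1, 1), (0, 1), (0, 1)]

/-- Labels of the vertices of the octahedron. -/
def labelOct : (Σ _ : Fin 3, Fin 2) → ZMod 2 × ZMod 2 := fun x => ![(1, 0), (0, 1), (1, 1)] x.1

/-- Labels of the vertices of `K_{2,n}` for the alternating form. -/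
def labelTorus (p p' : ZMod 2 × ZMod 2) (n : ℕ) : Fin 2 ⊕ Fin n → ZMod 2 × ZMod 2 :=
  Sum.elim (fun _ => p) (fun _ => p')

/-- Labels of the vertices of `K_{2,n}` for the standard form. -/
def labelKlein (n : ℕ) : Fin 2 ⊕ Fin n → ZMod 2 × ZMod 2 :=
  Sum.elim ![(1, 0), (0, 1)] (fun _ => (1, 1))

theorem adj_top_iff (u v : Fin 4) (h : u ≠ v) :
    (⊤ : SimpleGraph (Fin 4)).Adj u v ↔ formP (1, 0) (1, 0) = 1 := by
  simp [h, formP]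

theorem adj_graphA3_iff (u v : Fin 4 ⊕ Fin 4) (h : u ≠ v) :
    graphA3.Adj u v ↔ formN (labelA3 u) (labelA3 v) = 1 := by
  rcases u with u | u <;> rcases v with v | v <;> simp [graphA3, labelA3, formN] at h ⊢ <;> exact h

theorem adj_graphA5_iff (u v : Fin 7) (h : u ≠ v) :
    graphA5.Adj u v ↔ formN (labelA5 u) (labelA5 v) = 1 := by
  rw [graphA5, fromEdgeSet_adj]
  simp only [Set.mem_insert_iff, Set.mem_singleton_iff, formN]
  revert u v
  decide

theorem adj_graphA6_iff (u v : Fin 6) (h : u ≠ v) :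
    graphA6.Adj u v ↔ formN (labelA6 u) (labelA6 v) = 1 := by
  rw [graphA6, fromEdgeSet_adj]
  simp only [Set.mem_insert_iff, Set.mem_singleton_iff, formN]
  revert u v
  decide

theorem adj_oct_iff (u v : Σ _ : Fin 3, Fin 2) :
    (completeMultipartiteGraph fun _ : Fin 3 => Fin 2).Adj u v ↔
      formA (labelOct u) (labelOct v) = 1 := by
  rcases u with ⟨i, u⟩
  rcases v with ⟨j, v⟩
  simp only [completeMultipartiteGraph, comap_adj, top_adj, formA, labelOct]
  revert i j
  decide

theorem formA_eq_one_iff : ∀ p p' : ZMod 2 × ZMod 2, formA p p' = 1 ↔ p ≠ 0 ∧ p' ≠ 0 ∧ p ≠ p' := by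
  unfold formA; decide

theorem adj_labelTorus_iff {p p' : ZMod 2 × ZMod 2} (hp : p ≠ 0) (hp' : p' ≠ 0) (hne : p ≠ p')
    {n : ℕ} (u v : Fin 2 ⊕ Fin n) :
    (completeBipartiteGraph (Fin 2) (Fin n)).Adj u v ↔
      formA (labelTorus p p' n u) (labelTorus p p' n v) = 1 := by
  rw [formA_eq_one_iff]
  rcases u with u | u <;> rcases v with v | v <;>
    simp [labelTorus, hp, hp', hne, hne.symm]

theorem adj_labelKlein_iff {n : ℕ} (u v : Fin 2 ⊕ Fin n) (h : u ≠ v) :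
    (completeBipartiteGraph (Fin 2) (Fin n)).Adj u v ↔
      formN (labelKlein n u) (labelKlein n v) = 1 := by
  rcases u with u | u <;> rcases v with v | v
  · have h' : u ≠ v := fun h0 => h (by rw [h0])
    simp only [completeBipartiteGraph_adj, labelKlein, Sum.elim_inl, Sum.isLeft_inl, Sum.isRight_inl]
    clear h
    revert u v
    unfold formN
    decide
  · simp only [completeBipartiteGraph_adj, labelKlein, Sum.elim_inl, Sum.elim_inr, Sum.isLeft_inl,
      Sum.isRight_inl, Sum.isLeft_inr, Sum.isRight_inr]
    clear h
    revert u
    unfold formN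
    decide
  · simp only [completeBipartiteGraph_adj, labelKlein, Sum.elim_inl, Sum.elim_inr, Sum.isLeft_inl,
      Sum.isRight_inl, Sum.isLeft_inr, Sum.isRight_inr]
    clear h
    revert v
    unfold formN
    decide
  · simp only [completeBipartiteGraph_adj, labelKlein, Sum.elim_inr, Sum.isLeft_inr,
      Sum.isRight_inr]
    unfold formN
    decide

theorem sum_labelTorus (p p' : ZMod 2 × ZMod 2) (m : ℕ) : ∑ u, labelTorus p p' (2 * m) u = 0 := by
  have h2 : ∀ p : ZMod 2 × ZMod 2, p + p = 0 := by decide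
  rw [Fintype.sum_sum_type]
  simp only [labelTorus, Sum.elim_inl, Sum.elim_inr, Finset.sum_const, Finset.card_univ,
    Fintype.card_fin, mul_nsmul, two_nsmul, h2]
  simp

theorem sum_labelKlein {m : ℕ} (hm : 1 ≤ m) : ∑ u, labelKlein (2 * m - 1) u = 0 := by
  obtain ⟨k, rfl⟩ : ∃ k, m = k + 1 := ⟨m - 1, by omega⟩
  have h2 : ∀ p : ZMod 2 × ZMod 2, p + p = 0 := by decide
  have h3 : 2 * (k + 1) - 1 = 2 * k + 1 := by omega
  rw [h3, Fintype.sum_sum_type]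
  simp only [labelKlein, Sum.elim_inl, Sum.elim_inr, Finset.sum_const, Finset.card_univ,
    Fintype.card_fin, add_nsmul, mul_nsmul, two_nsmul, h2, one_nsmul]
  simp only [nsmul_zero, zero_add, Fin.sum_univ_two]
  decide

end Models

namespace RotationSystem

variable {V : Type u} [Fintype V] {G : SimpleGraph V} [DecidableRel G.Adj] {ρ : RotationSystem G}

/-! ### Surfaces of labelled embeddings -/

theorem Labels.onProjectivePlane (h : ρ.IsPlaneCubic) {l : G.edgeSet → ℤˣ}
    {τ : ρ.untwisted.Face → ZMod 2 × ZMod 2} (hL : ρ.Labels formP l τ) {f : ρ.untwisted.Face}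
    (hf : τ f = (1, 0)) : (ρ.signed l).OnProjectivePlane := by
  have hff : ρ.lap l f f = 1 := by rw [hL, hf]; rfl
  refine ⟨fun ho => ?_, ?_⟩
  · rw [(h.orientable_signed l).1 ho f] at hff
    exact zero_ne_one hff
  · have h1 : ρ.lap l = Matrix.vecMulVec (fun f => (τ f).1) (fun f => (τ f).1) := by
      ext a b; rw [hL]; rfl
    have h2 : (ρ.lap l).rank ≤ 1 := by rw [h1]; exact Matrix.rank_vecMulVec_le _ _
    have h3 : (ρ.lap l).rank ≠ 0 := fun h0 => by
      rw [eq_zero_of_rank_eq_zero h0] at hff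
      exact zero_ne_one hff
    rw [h.eulerChar_signed]
    omega

theorem Labels.onTorus (h : ρ.IsPlaneCubic) {l : G.edgeSet → ℤˣ}
    {τ : ρ.untwisted.Face → ZMod 2 × ZMod 2} (hL : ρ.Labels formA l τ) {f g : ρ.untwisted.Face}
    (hf : τ f ≠ 0) (hg : τ g ≠ 0) (hne : τ f ≠ τ g) : (ρ.signed l).OnTorus := by
  refine ⟨(h.orientable_signed l).2 fun x => ?_, ?_⟩
  · rw [hL]
    by_contra h0
    exact ((formA_eq_one_iff _ _).1 (zmod_two_eq_one h0)).2.2 rfl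
  · rw [h.eulerChar_signed, rank_of_form isForm_formA isNondegenerate_formA hL hf hg hne]
    norm_num

theorem Labels.onKleinBottle (h : ρ.IsPlaneCubic) {l : G.edgeSet → ℤˣ}
    {τ : ρ.untwisted.Face → ZMod 2 × ZMod 2} (hL : ρ.Labels formN l τ) {f g : ρ.untwisted.Face}
    (hf : τ f = (1, 0)) (hg : τ g = (0, 1)) : (ρ.signed l).OnKleinBottle := by
  refine ⟨fun ho => ?_, ?_⟩
  · have hff : ρ.lap l f f = 1 := by rw [hL, hf]; rfl
    rw [(h.orientable_signed l).1 ho f] at hff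
    exact zero_ne_one hff
  · rw [h.eulerChar_signed, rank_of_form isForm_formN isNondegenerate_formN hL (i := f) (i' := g)
      (by rw [hf]; decide) (by rw [hg]; decide) (by rw [hf, hg]; decide)]
    norm_num

namespace IsPlaneCubic

/-- The one label class has four members, so the form never singles out exactly two faces. -/
theorem twist_projective (h : ρ.IsPlaneCubic) {H : ρ.dual.Subgraph}
    (hH : H ∈ projectiveFamily ρ.dual) :
    (ρ.twist H).IsStrong ∧ (ρ.twist H).OnProjectivePlane := by
  obtain ⟨e⟩ := hH
  obtain ⟨τ, hL, hS, hτ⟩ := exists_labels_of_iso isForm_formP (σ := fun _ : Fin 4 => (1, 0))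
    adj_top_iff (by decide) e (fun c u v huv ht => absurd ht (by
      clear * - huv; revert c u v; unfold formP; decide))
  exact ⟨hL.isStrong h isForm_formP hS, hL.onProjectivePlane h (hτ 0)⟩

/-- For the octahedron every nonzero functional selects four vertices. For `K_{2,2m}` a selected
pair can only be a partition set of size two, and this is where non-adjacency in the dual graph is
used. -/
theorem twist_torus (h : ρ.IsPlaneCubic) {H : ρ.dual.Subgraph}
    (hH : H ∈ torusFamily ρ.dual) : (ρ.twist H).IsStrong ∧ (ρ.twist H).OnTorus := by
  rcases hH with ⟨⟨e⟩⟩ | ⟨m, hm, e, h1, h2⟩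
  · obtain ⟨τ, hL, hS, hτ⟩ := exists_labels_of_iso isForm_formA (σ := labelOct)
      (fun u v _ => adj_oct_iff u v) (by decide) e (fun c u v huv ht => absurd ht (by
        clear * - huv; revert c u v; unfold formA; decide))
    refine ⟨hL.isStrong h isForm_formA hS, hL.onTorus h (f := e.symm ⟨0, 0⟩)
      (g := e.symm ⟨1, 0⟩) ?_ ?_ ?_⟩ <;> rw [hτ] <;> try rw [hτ]
    all_goals decide
  · obtain ⟨τ, hL, hS, hτ⟩ := exists_labels_of_iso isForm_formA
      (σ := labelTorus (1, 0) (0, 1) (2 * m))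
      (fun u v _ => adj_labelTorus_iff (by decide) (by decide) (by decide) u v)
      (sum_labelTorus _ _ m) e (fun c u v huv ht => by
        have h10 := ht (Sum.inl 0)
        have h11 := ht (Sum.inl 1)
        simp only [labelTorus, Sum.elim_inl] at h10 h11
        by_cases hc : formA (1, 0) c = 1
        · have e1 := h10.1 hc
          have e2 := h11.1 hc
          rcases e1 with e1 | e1 <;> rcases e2 with e2 | e2 <;> subst e1
          · exact absurd e2 (by simp)
          · rw [← e2]; exact h1 _ _
          · rw [← e2]; exact h1 _ _
          · exact absurd e2 (by simp)
        · have hnl : ∀ i, Sum.inl i ≠ u ∧ Sum.inl i ≠ v := by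
            intro i
            have := ht (Sum.inl i)
            simp only [labelTorus, Sum.elim_inl] at this
            rw [← not_or, ← this]
            exact hc
          rcases u with u | u
          · exact absurd rfl (hnl u).1
          rcases v with v | v
          · exact absurd rfl (hnl v).2
          have hc' : formA (0, 1) c = 1 := (ht (Sum.inr u)).2 (Or.inl rfl)
          have hall : ∀ i, i = u ∨ i = v := by
            intro i
            simpa using (ht (Sum.inr i)).1 hc'
          refine h2 ?_ u v
          have hsub : (Finset.univ : Finset (Fin (2 * m))) ⊆ {u, v} := by
            intro i _
            simpa using hall i
          have := (Finset.card_le_card hsub).trans Finset.card_le_two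
          rw [Finset.card_univ, Fintype.card_fin] at this
          omega)
    refine ⟨hL.isStrong h isForm_formA hS, hL.onTorus h (f := e.symm (Sum.inl 0))
      (g := e.symm (Sum.inr ⟨0, by omega⟩)) ?_ ?_ ?_⟩ <;> rw [hτ] <;> try rw [hτ]
    all_goals simp only [labelTorus, Sum.elim_inl, Sum.elim_inr]; decide

/-- In the three models built from copies of `K₄` no functional selects exactly two vertices. In
`K_{2,2m-1}` the only selected pair is the partition set of size two: since `2m - 1 ≥ 3`, a
functional that is one on the other partition set selects too much. -/
theorem twist_klein (h : ρ.IsPlaneCubic) {H : ρ.dual.Subgraph}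
    (hH : H ∈ kleinFamily ρ.dual) : (ρ.twist H).IsStrong ∧ (ρ.twist H).OnKleinBottle := by
  rcases hH with ((⟨⟨e⟩⟩ | ⟨⟨e⟩⟩) | ⟨⟨e⟩⟩) | ⟨m, hm, e, h1, -⟩
  · obtain ⟨τ, hL, hS, hτ⟩ := exists_labels_of_iso isForm_formN (σ := labelA3)
      adj_graphA3_iff (by decide) e (fun c u v huv ht => absurd ht (by
        clear * - huv; revert c u v; unfold formN; decide))
    exact ⟨hL.isStrong h isForm_formN hS, hL.onKleinBottle h (hτ (Sum.inl 0)) (hτ (Sum.inr 0))⟩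
  · obtain ⟨τ, hL, hS, hτ⟩ := exists_labels_of_iso isForm_formN (σ := labelA5)
      adj_graphA5_iff (by decide) e (fun c u v huv ht => absurd ht (by
        clear * - huv; revert c u v; unfold formN; decide))
    exact ⟨hL.isStrong h isForm_formN hS, hL.onKleinBottle h (hτ 0) (hτ 4)⟩
  · obtain ⟨τ, hL, hS, hτ⟩ := exists_labels_of_iso isForm_formN (σ := labelA6)
      adj_graphA6_iff (by decide) e (fun c u v huv ht => absurd ht (by
        clear * - huv; revert c u v; unfold formN; decide))
    exact ⟨hL.isStrong h isForm_formN hS, hL.onKleinBottle h (hτ 0) (hτ 4)⟩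
  · obtain ⟨τ, hL, hS, hτ⟩ := exists_labels_of_iso isForm_formN
      (σ := labelKlein (2 * m - 1)) adj_labelKlein_iff (sum_labelKlein (by omega)) e
      (fun c u v huv ht => by
        have hr : ∀ i : Fin (2 * m - 1), formN (1, 1) c = 1 ↔
            (Sum.inr i : Fin 2 ⊕ Fin (2 * m - 1)) = u ∨ Sum.inr i = v := fun i => ht (Sum.inr i)
        by_cases hc : formN (1, 1) c = 1
        · exfalso
          have a0 := (hr ⟨0, by omega⟩).1 hc
          have a1 := (hr ⟨1, by omega⟩).1 hc
          have a2 := (hr ⟨2, by omega⟩).1 hc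
          have hne : ∀ i j w, i ≠ j → (Sum.inr i : Fin 2 ⊕ Fin (2 * m - 1)) = w →
              Sum.inr j ≠ w := fun i j w hij h' h'' =>
            hij (Sum.inr_injective (h'.trans h''.symm))
          rcases a0 with a0 | a0 <;> rcases a1 with a1 | a1 <;> rcases a2 with a2 | a2 <;>
            first
            | exact hne _ _ _ (by simp) a0 a1
            | exact hne _ _ _ (by simp) a0 a2
            | exact hne _ _ _ (by simp) a1 a2
        · have hnr : ∀ i : Fin (2 * m - 1), (Sum.inr i : Fin 2 ⊕ Fin (2 * m - 1)) ≠ u ∧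
              Sum.inr i ≠ v := by
            intro i
            rw [← not_or, ← hr]
            exact hc
          rcases u with u | u
          · rcases v with v | v
            · exact h1 u v
            · exact absurd rfl (hnr v).2
          · exact absurd rfl (hnr u).1)
    exact ⟨hL.isStrong h isForm_formN hS, hL.onKleinBottle h (hτ (Sum.inl 0)) (hτ (Sum.inl 1))⟩

end IsPlaneCubic

end RotationSystem

end StrongEmb

/-! ### Sizes of the label classes of a strong embedding. -/

namespace StrongEmb

open SimpleGraph

/-- With at most one nonzero label the matrix would be an outer product, of rank at most one. -/
theorem exists_ne_of_rank_eq_two {n : Type*} [Fintype n] {M : Matrix n n (ZMod 2)}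
    {q : ZMod 2 × ZMod 2 → ZMod 2 × ZMod 2 → ZMod 2} (hq : IsForm q) {τ : n → ZMod 2 × ZMod 2}
    (hM : ∀ i j, M i j = q (τ i) (τ j)) (hr : M.rank = 2) :
    ∃ i j, τ i ≠ 0 ∧ τ j ≠ 0 ∧ τ i ≠ τ j := by
  classical
  by_contra hcon
  push Not at hcon
  obtain ⟨p, hp⟩ : ∃ p, ∀ i, τ i = 0 ∨ τ i = p := by
    by_cases h0 : ∃ i, τ i ≠ 0
    · obtain ⟨i, hi⟩ := h0
      refine ⟨τ i, fun j => ?_⟩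
      by_cases hj : τ j = 0
      · exact Or.inl hj
      · exact Or.inr (hcon i j hi hj).symm
    · push Not at h0
      exact ⟨0, fun i => Or.inl (h0 i)⟩
  have h1 : M = Matrix.vecMulVec (fun i => q (τ i) p) (fun j => if τ j = 0 then 0 else 1) := by
    ext i j
    rw [hM, Matrix.vecMulVec_apply]
    by_cases hj : τ j = 0
    · rw [if_pos hj, hj, hq.zero_right, mul_zero]
    · rw [if_neg hj, mul_one, (hp j).resolve_left hj]
  have h2 : M.rank ≤ 1 := by rw [h1]; exact Matrix.rank_vecMulVec_le _ _
  omega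

theorem card_labelTorus {p p' : ZMod 2 × ZMod 2} (n : ℕ) (r : ZMod 2 × ZMod 2) :
    (Finset.univ.filter fun u => labelTorus p p' n u = r).card =
      (if p = r then 2 else 0) + if p' = r then n else 0 := by
  rw [Finset.card_filter, Fintype.sum_sum_type]
  change ((∑ _i : Fin 2, if p = r then 1 else 0) + ∑ _i : Fin n, if p' = r then 1 else 0) = _
  split_ifs <;> simp

theorem card_labelKlein (n : ℕ) (r : ZMod 2 × ZMod 2) :
    (Finset.univ.filter fun u => labelKlein n u = r).card =
      (if (1, 0) = r ∨ (0, 1) = r then 1 else 0) + if (1, 1) = r then n else 0 := by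
  have h2 : ∀ r : ZMod 2 × ZMod 2, (∑ i : Fin 2, if ![(1, 0), (0, 1)] i = r then 1 else 0) =
      if (1, 0) = r ∨ (0, 1) = r then 1 else 0 := by decide
  rw [Finset.card_filter, Fintype.sum_sum_type, ← h2]
  change ((∑ i : Fin 2, if ![(1, 0), (0, 1)] i = r then 1 else 0) +
    ∑ _i : Fin n, if (1, 1) = r then 1 else 0) = _
  congr 1
  split_ifs <;> simp

/-- Here `a`, `b`, `c` are the sizes of the three nonzero label classes, which span a complete
tripartite graph. The hypotheses are parity, rank two, absence of `K₃,₃` and strength. Absence of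
`K₃,₃` leaves two classes with at most two members. The outcomes are the octahedron and `K_{2,n}`
with `n` even. -/
theorem torus_counts {a b c : ℕ} (hac : (a + c) % 2 = 0) (hbc : (b + c) % 2 = 0) (pac : 0 < a + c)
    (pbc : 0 < b + c) (pab : 0 < a + b) (ba : a < 3 ∨ b + c < 3) (bb : b < 3 ∨ a + c < 3)
    (bc : c < 3 ∨ a + b < 3) (oab : b = 1 → a ≠ 1) (oac : c = 1 → a ≠ 1) (obc : c = 1 → b ≠ 1) :
    (a = 2 ∧ b = 2 ∧ c = 2) ∨ (a = 2 ∧ 0 < b ∧ c = 0) ∨ (b = 2 ∧ 0 < a ∧ c = 0) ∨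
      (a = 2 ∧ 0 < c ∧ b = 0) ∨ (c = 2 ∧ 0 < a ∧ b = 0) ∨ (b = 2 ∧ 0 < c ∧ a = 0) ∨
      (c = 2 ∧ 0 < b ∧ a = 0) := by
  have hle : (a < 3 ∧ b < 3) ∨ (a < 3 ∧ c < 3) ∨ (b < 3 ∧ c < 3) := by omega
  rcases hle with ⟨h1, h2⟩ | ⟨h1, h2⟩ | ⟨h1, h2⟩
  · interval_cases a <;> interval_cases b <;> omega
  · interval_cases a <;> interval_cases c <;> omega
  · interval_cases b <;> interval_cases c <;> omega

/-- The classes of sizes `a` and `b` are cliques not joined to each other, and both are joined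
completely to the independent class of size `c`. The bounds `4` and `3` exclude `K₅`, and the
conditions on sizes one and two express strength. The outcomes are `A₃`, `A₅`, `A₆` and `K_{2,n}`
with `n` odd. -/
theorem klein_counts {a b c : ℕ} (hac : (a + c) % 2 = 0) (hbc : (b + c) % 2 = 0)
    (pab : 0 < a + b) (pac : 0 < a + c) (pbc : 0 < b + c) (a4 : a ≤ 4) (b4 : b ≤ 4)
    (a3 : 0 < c → a ≤ 3) (b3 : 0 < c → b ≤ 3) (bc : c < 3 ∨ a + b < 3) (ac2 : c = 0 → a ≠ 2)
    (ac1 : c = 1 → a ≠ 1) (bc2 : c = 0 → b ≠ 2) (bc1 : c = 1 → b ≠ 1) (ab2 : b = 0 → a ≠ 2)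
    (ba2 : a = 0 → b ≠ 2) :
    (a = 4 ∧ b = 4 ∧ c = 0) ∨ (a = 3 ∧ b = 3 ∧ c = 1) ∨ (a = 2 ∧ b = 2 ∧ c = 2) ∨
      (a = 1 ∧ b = 1 ∧ 3 ≤ c) := by
  obtain rfl | rfl | rfl | hc : c = 0 ∨ c = 1 ∨ c = 2 ∨ 3 ≤ c := by omega
  · have h1 := ac2 rfl
    have h2 := bc2 rfl
    clear * - hac hbc pac pbc a4 b4 h1 h2
    omega
  · have h1 := ac1 rfl
    have h2 := bc1 rfl
    have h3 := a3 one_pos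
    have h4 := b3 one_pos
    clear * - hac hbc h1 h2 h3 h4
    omega
  · have h3 := a3 two_pos
    have h4 := b3 two_pos
    clear * - hac hbc pab ab2 ba2 h3 h4
    omega
  · have h3 := bc.resolve_left (by omega)
    clear * - hac hbc pab ab2 ba2 h3 hc
    omega

namespace RotationSystem

variable {V : Type u} [Fintype V] {G : SimpleGraph V} [DecidableRel G.Adj] {ρ : RotationSystem G}
  {q : ZMod 2 × ZMod 2 → ZMod 2 × ZMod 2 → ZMod 2} {l : G.edgeSet → ℤˣ}
  {τ : ρ.untwisted.Face → ZMod 2 × ZMod 2}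

/-! ### Numbers of faces with given labels -/

theorem labelCount_pos (τ : ρ.untwisted.Face → ZMod 2 × ZMod 2) (f : ρ.untwisted.Face) :
    0 < labelCount τ (τ f) := by
  classical
  exact Finset.card_pos.2 ⟨f, by simp⟩

theorem exists_of_labelCount_pos {p : ZMod 2 × ZMod 2} (hp : 0 < labelCount τ p) :
    ∃ f, τ f = p := by
  classical
  obtain ⟨f, hf⟩ := Finset.card_pos.1 hp
  exact ⟨f, by simpa using hf⟩

theorem sum_labels (τ : ρ.untwisted.Face → ZMod 2 × ZMod 2) :
    ∑ f, τ f = (((labelCount τ (1, 0) + labelCount τ (1, 1) : ℕ) : ZMod 2),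
      ((labelCount τ (0, 1) + labelCount τ (1, 1) : ℕ) : ZMod 2)) := by
  classical
  have h1 : ∀ p : ZMod 2 × ZMod 2,
      p.1 = (if p = (1, 0) then 1 else 0) + if p = (1, 1) then 1 else 0 := by decide
  have h2 : ∀ p : ZMod 2 × ZMod 2,
      p.2 = (if p = (0, 1) then 1 else 0) + if p = (1, 1) then 1 else 0 := by decide
  have hc : ∀ p, (labelCount τ p : ZMod 2) = ∑ f, if τ f = p then 1 else 0 := by
    intro p
    rw [Finset.sum_boole]
    unfold labelCount
    congr!
  refine Prod.ext ?_ ?_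
  · rw [Prod.fst_sum]
    push_cast
    rw [hc, hc, ← Finset.sum_add_distrib]
    exact Finset.sum_congr rfl fun f _ => h1 (τ f)
  · rw [Prod.snd_sum]
    push_cast
    rw [hc, hc, ← Finset.sum_add_distrib]
    exact Finset.sum_congr rfl fun f _ => h2 (τ f)

theorem even_of_sum_labels (hs : ∑ f, τ f = 0) :
    Even (labelCount τ (1, 0) + labelCount τ (1, 1)) ∧
      Even (labelCount τ (0, 1) + labelCount τ (1, 1)) := by
  rw [sum_labels] at hs
  exact ⟨(ZMod.natCast_eq_zero_iff_even).1 (congrArg Prod.fst hs),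
    (ZMod.natCast_eq_zero_iff_even).1 (congrArg Prod.snd hs)⟩

namespace Labels

/-- The Laplacian kills the constants, so the sum of all labels is orthogonal to every label. For a
nondegenerate form of rank two the sum then vanishes, which gives the parities of the class sizes.
-/
theorem form_sum (hq : IsForm q) (hL : ρ.Labels q l τ) (f : ρ.untwisted.Face) :
    q (τ f) (∑ g, τ g) = 0 := by
  classical
  rw [hq.sum_right]
  have := congrFun (lapMatrix_mulVec_const_eq_zero (R := ZMod 2) (ρ.twistedGraph l)) f
  rw [Matrix.mulVec, dotProduct] at this
  simp only [← hL f]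
  simpa [lap] using this

theorem sum_eq_zero (hq : IsForm q) (hnd : IsNondegenerate q) (hL : ρ.Labels q l τ)
    (hr : (ρ.lap l).rank = 2) : ∑ f, τ f = 0 := by
  obtain ⟨f, g, hf, hg, hne⟩ := exists_ne_of_rank_eq_two hq hL hr
  exact hnd _ _ _ hf hg hne (hL.form_sum hq f) (hL.form_sum hq g)

theorem labelCount_pos_or (hq : IsForm q) (hL : ρ.Labels q l τ) (hr : (ρ.lap l).rank = 2) :
    0 < labelCount τ (1, 0) + labelCount τ (1, 1) ∧
      0 < labelCount τ (0, 1) + labelCount τ (1, 1) ∧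
      0 < labelCount τ (1, 0) + labelCount τ (0, 1) := by
  obtain ⟨f, g, hf, hg, hne⟩ := exists_ne_of_rank_eq_two hq hL hr
  have h1 := labelCount_pos τ f
  have h2 := labelCount_pos τ g
  generalize τ f = p at *
  generalize τ g = p' at *
  have key : ∀ p : ZMod 2 × ZMod 2, p ≠ 0 → p = (1, 0) ∨ p = (0, 1) ∨ p = (1, 1) := by decide
  rcases key p hf with rfl | rfl | rfl <;> rcases key p' hg with rfl | rfl | rfl <;>
    first
    | exact absurd rfl hne
    | omega

theorem labelCount_le_four (h : ρ.IsPlaneCubic) (hL : ρ.Labels q l τ) {p : ZMod 2 × ZMod 2}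
    (hp : q p p = 1) : labelCount τ p ≤ 4 := by
  classical
  refine h.card_clique_le _ fun f hf g hg hfg => ρ.twistedGraph_le_dual l ((hL.adj_iff hfg).2 ?_)
  rw [(Finset.mem_filter.1 hf).2, (Finset.mem_filter.1 hg).2, hp]

/-- Any face labelled `p'` extends the clique of the faces labelled `p`, and five faces cannot be
pairwise adjacent. -/
theorem labelCount_le_three (h : ρ.IsPlaneCubic) (hq : IsForm q) (hL : ρ.Labels q l τ)
    {p p' : ZMod 2 × ZMod 2} (hp : q p p = 1) (hp' : q p p' = 1) (hne : p ≠ p')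
    (hpos : 0 < labelCount τ p') : labelCount τ p ≤ 3 := by
  classical
  obtain ⟨x, hx⟩ := exists_of_labelCount_pos hpos
  have h1 := h.card_clique_le (insert x (Finset.univ.filter fun f => τ f = p))
    fun f hf g hg hfg => ρ.twistedGraph_le_dual l ((hL.adj_iff hfg).2 (by
      rw [Finset.mem_insert, Finset.mem_filter] at hf hg
      rcases hf with rfl | ⟨-, hf⟩ <;> rcases hg with rfl | ⟨-, hg⟩
      · exact absurd rfl hfg
      · rw [hx, hg, hq.symm, hp']
      · rw [hf, hx, hp']
      · rw [hf, hg, hp]))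
  rw [Finset.card_insert_of_notMem (by simp [hx, hne.symm])] at h1
  unfold labelCount
  convert Nat.le_of_succ_le_succ h1

theorem labelCount_bipartite (h : ρ.IsPlaneCubic) (hL : ρ.Labels q l τ)
    {p p' p'' : ZMod 2 × ZMod 2} (hp' : q p p' = 1) (hp'' : q p p'' = 1) (hne' : p ≠ p')
    (hne'' : p ≠ p'') (hne : p' ≠ p'') :
    labelCount τ p < 3 ∨ labelCount τ p' + labelCount τ p'' < 3 := by
  classical
  have h1 := h.card_bipartite_lt (Finset.univ.filter fun f => τ f = p)
    ((Finset.univ.filter fun f => τ f = p') ∪ Finset.univ.filter fun f => τ f = p'')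
    fun f hf g hg => by
      rw [Finset.mem_union, Finset.mem_filter, Finset.mem_filter] at hg
      rw [Finset.mem_filter] at hf
      have hfg : f ≠ g := by
        rintro rfl
        rcases hg with hg | hg
        · exact hne' (hf.2.symm.trans hg.2)
        · exact hne'' (hf.2.symm.trans hg.2)
      refine ρ.twistedGraph_le_dual l ((hL.adj_iff hfg).2 ?_)
      rcases hg with hg | hg
      · rw [hf.2, hg.2, hp']
      · rw [hf.2, hg.2, hp'']
  rw [Finset.card_union_of_disjoint] at h1
  · unfold labelCount
    convert h1
  · rw [Finset.disjoint_filter]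
    intro f _ h2 h3
    exact hne (h2.symm.trans h3)

end Labels

namespace NoAdjacentPair

/-- When the classes selected by `c` have two members altogether, strength applies to exactly this
pair. This excludes small class sizes and also supplies the non-adjacency required of `K_{2,n}`. -/
theorem not_adj (hS : ρ.NoAdjacentPair q τ) {c p p' : ZMod 2 × ZMod 2}
    (hc : ∀ a, q a c = 1 ↔ a = p ∨ a = p') (hpp : p ≠ p')
    (hn : labelCount τ p + labelCount τ p' = 2) {f g : ρ.untwisted.Face}
    (hf : τ f = p ∨ τ f = p') (hg : τ g = p ∨ τ g = p') : ¬ ρ.dual.Adj f g := by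
  classical
  intro hfg
  have hcard : (Finset.univ.filter fun x => τ x = p ∨ τ x = p').card = 2 := by
    rw [Finset.filter_or, Finset.card_union_of_disjoint]
    · refine Eq.trans ?_ hn
      unfold labelCount
      congr!
    · rw [Finset.disjoint_filter]
      intro f _ h2 h3
      exact hpp (h2.symm.trans h3)
  have hsub : ({f, g} : Finset ρ.untwisted.Face) = Finset.univ.filter fun x => τ x = p ∨ τ x = p' := by
    refine Finset.eq_of_subset_of_card_le ?_ (by rw [hcard, Finset.card_pair hfg.ne])
    intro x hx
    rw [Finset.mem_insert, Finset.mem_singleton] at hx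
    rw [Finset.mem_filter]
    rcases hx with rfl | rfl
    · exact ⟨Finset.mem_univ _, hf⟩
    · exact ⟨Finset.mem_univ _, hg⟩
  refine hS c f g hfg fun x => ?_
  rw [hc]
  have := Finset.ext_iff.1 hsub x
  simp only [Finset.mem_insert, Finset.mem_singleton, Finset.mem_filter, Finset.mem_univ,
    true_and] at this
  exact this.symm

theorem labelCount_ne_two (hS : ρ.NoAdjacentPair q τ) (hL : ρ.Labels q l τ)
    {c p p' : ZMod 2 × ZMod 2} (hc : ∀ a, q a c = 1 ↔ a = p ∨ a = p') (hpp : p ≠ p')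
    (hp : q p p = 1) (h0 : labelCount τ p' = 0) : labelCount τ p ≠ 2 := by
  classical
  intro h2
  obtain ⟨f, g, hfg, hs⟩ := Finset.card_eq_two.1 h2
  have hmem : ∀ x, τ x = p ↔ x = f ∨ x = g := fun x => by
    simpa using Finset.ext_iff.1 hs x
  have hf : τ f = p := (hmem f).2 (Or.inl rfl)
  have hg : τ g = p := (hmem g).2 (Or.inr rfl)
  refine hS.not_adj hc hpp (by rw [h2, h0]) (Or.inl hf) (Or.inl hg)
    (ρ.twistedGraph_le_dual l ((hL.adj_iff hfg).2 ?_))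
  rw [hf, hg, hp]

theorem labelCount_ne_one (hS : ρ.NoAdjacentPair q τ) (hL : ρ.Labels q l τ)
    {c p p' : ZMod 2 × ZMod 2} (hc : ∀ a, q a c = 1 ↔ a = p ∨ a = p') (hpp : p ≠ p')
    (hp : q p p' = 1) (h1 : labelCount τ p' = 1) : labelCount τ p ≠ 1 := by
  intro h2
  obtain ⟨f, hf⟩ := exists_of_labelCount_pos (τ := τ) (p := p) (by omega)
  obtain ⟨g, hg⟩ := exists_of_labelCount_pos (τ := τ) (p := p') (by omega)
  have hfg : f ≠ g := by
    rintro rfl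
    exact hpp (hf.symm.trans hg)
  refine hS.not_adj hc hpp (by rw [h2, h1]) (Or.inl hf) (Or.inr hg)
    (ρ.twistedGraph_le_dual l ((hL.adj_iff hfg).2 ?_))
  rw [hf, hg, hp]

end NoAdjacentPair

theorem forall_label_iff {P : ZMod 2 × ZMod 2 → Prop} :
    (∀ p, p ≠ 0 → P p) ↔ P (1, 0) ∧ P (0, 1) ∧ P (1, 1) := by
  constructor
  · intro hP
    exact ⟨hP _ (by decide), hP _ (by decide), hP _ (by decide)⟩
  · rintro ⟨h1, h2, h3⟩ p hp
    have key : ∀ p : ZMod 2 × ZMod 2, p ≠ 0 → p = (1, 0) ∨ p = (0, 1) ∨ p = (1, 1) := by decide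
    rcases key p hp with rfl | rfl | rfl <;> assumption

namespace IsPlaneCubic

/-! ### Twisted graphs of strong embeddings -/

/-- The faces on which `x` is one form a clique. Their number is positive, even by the row sums, at
most four by planarity, and not two by strength. -/
theorem exists_projective (h : ρ.IsPlaneCubic) (hs : (ρ.signed l).IsStrong)
    (hl : (ρ.signed l).OnProjectivePlane) :
    ∃ H ∈ projectiveFamily ρ.dual, ρ.twist H = ρ.signed l := by
  have hr : (ρ.lap l).rank = 1 := by
    have := hl.2
    rw [h.eulerChar_signed] at this
    omega
  obtain ⟨x, hx, hxr⟩ := exists_of_rank_one (ρ.lap_isSymm l) hr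
  let τ : ρ.untwisted.Face → ZMod 2 × ZMod 2 := fun f => (x f, 0)
  have hL : ρ.Labels formP l τ := fun f g => by rw [hx]; rfl
  have hS : ρ.NoAdjacentPair formP τ := Labels.noAdjacentPair (l := l) h (fun c => by
    convert Submodule.smul_mem _ c.1 hxr using 1
    funext f
    simp [formP, τ, mul_comm]) hs
  obtain ⟨f, hf⟩ : ∃ f, x f ≠ 0 := by
    by_contra hcon
    push Not at hcon
    have : ρ.lap l = 0 := by
      rw [hx]; ext a b; simp [Matrix.vecMulVec_apply, hcon]
    rw [this, Matrix.rank_zero] at hr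
    omega
  have hf1 : τ f = (1, 0) := by simp only [τ]; rw [zmod_two_eq_one hf]
  have hpos := labelCount_pos τ f
  rw [hf1] at hpos
  have h11 : ∀ p, p.2 = 1 → labelCount τ p = 0 := by
    intro p hp
    by_contra h0
    obtain ⟨g, hg⟩ := exists_of_labelCount_pos (Nat.pos_of_ne_zero h0)
    rw [← hg] at hp
    exact zero_ne_one hp
  have hsum : ∑ f, τ f = 0 := by
    have h1 := hL.form_sum isForm_formP f
    rw [hf1] at h1
    refine Prod.ext (by simpa [formP] using h1) ?_
    rw [Prod.snd_sum]
    simp [τ]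
  have hev := (even_of_sum_labels hsum).1
  have h4 := hL.labelCount_le_four h (p := (1, 0)) rfl
  have h2 := hS.labelCount_ne_two hL (c := (1, 0)) (p := (1, 0)) (p' := (1, 1))
    (by unfold formP; decide) (by decide) rfl (h11 _ rfl)
  rw [h11 (1, 1) rfl, add_zero, Nat.even_iff] at hev
  have hn : labelCount τ (1, 0) = 4 := by omega
  obtain ⟨e, -⟩ := exists_iso_labelSubgraph isForm_formP hL (σ := fun _ : Fin 4 => (1, 0))
    adj_top_iff (by decide) (forall_label_iff.2
      ⟨hn.trans (by decide), (h11 _ rfl).trans (by decide), (h11 _ rfl).trans (by decide)⟩)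
  exact ⟨labelSubgraph isForm_formP hL, ⟨e⟩, h.twist_eq_signed _ _ fun _ _ => Iff.rfl⟩

/-- The alternating form treats the three nonzero labels alike, so this covers the six bipartite
outcomes of `torus_counts`. The functional given by `p'` selects the class of `p`, since `p''` does
not occur. -/
theorem labelSubgraph_mem_torusFamily (hL : ρ.Labels formA l τ) (hS : ρ.NoAdjacentPair formA τ)
    {p p' p'' : ZMod 2 × ZMod 2} (hp : p ≠ 0) (hp' : p' ≠ 0) (hp'' : p'' ≠ 0) (hne : p ≠ p')
    (hne' : p ≠ p'') (hne'' : p' ≠ p'') (h2 : labelCount τ p = 2) (h0 : labelCount τ p'' = 0)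
    (hpos : 0 < labelCount τ p') (hev : Even (labelCount τ p')) :
    labelSubgraph isForm_formA hL ∈ torusFamily ρ.dual := by
  obtain ⟨m, hm⟩ := hev.two_dvd
  have hcover : ∀ p p' p'' r : ZMod 2 × ZMod 2, p ≠ 0 ∧ p' ≠ 0 ∧ p'' ≠ 0 ∧ p ≠ p' ∧ p ≠ p'' ∧
      p' ≠ p'' → r ≠ 0 → r = p ∨ r = p' ∨ r = p'' := by decide
  have hc : ∀ p p' p'' : ZMod 2 × ZMod 2, p ≠ 0 ∧ p' ≠ 0 ∧ p'' ≠ 0 ∧ p ≠ p' ∧ p ≠ p'' ∧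
      p' ≠ p'' → ∀ a, formA a p' = 1 ↔ a = p ∨ a = p'' := by unfold formA; decide
  obtain ⟨e, he⟩ := exists_iso_labelSubgraph isForm_formA hL (σ := labelTorus p p' (2 * m))
    (fun u v _ => adj_labelTorus_iff hp hp' hne u v)
    (fun u => by rcases u with u | u <;> simp [labelTorus, hp, hp'])
    (fun r hr => by
      rw [card_labelTorus]
      rcases hcover p p' p'' r ⟨hp, hp', hp'', hne, hne', hne''⟩ hr with rfl | rfl | rfl
      · simp [h2, hne.symm]
      · simp [hm, hne]
      · simp [h0, hne', hne''])
  refine Or.inr ⟨m, by omega, e, fun i j => ?_, fun h2m i j => ?_⟩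
  · exact hS.not_adj (hc p p' p'' ⟨hp, hp', hp'', hne, hne', hne''⟩) hne' (by rw [h2, h0])
      (Or.inl (he _)) (Or.inl (he _))
  · exact hS.not_adj (hc p' p p'' ⟨hp', hp, hp'', hne.symm, hne'', hne'⟩) hne'' (by rw [hm, h2m, h0])
      (Or.inl (he _)) (Or.inl (he _))

theorem exists_torus (h : ρ.IsPlaneCubic) (hs : (ρ.signed l).IsStrong)
    (hl : (ρ.signed l).OnTorus) : ∃ H ∈ torusFamily ρ.dual, ρ.twist H = ρ.signed l := by
  have hr : (ρ.lap l).rank = 2 := by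
    have := hl.2
    rw [h.eulerChar_signed] at this
    omega
  obtain ⟨x, y, hxy, hxr, hyr⟩ := exists_of_rank_two_of_diag (ρ.lap_isSymm l) hr
    ((h.orientable_signed l).1 hl.1)
  let τ : ρ.untwisted.Face → ZMod 2 × ZMod 2 := fun f => (x f, y f)
  have hL : ρ.Labels formA l τ := fun f g => by rw [hxy]; rfl
  have hS : ρ.NoAdjacentPair formA τ := Labels.noAdjacentPair (l := l) h (fun c => by
    convert Submodule.add_mem _ (Submodule.smul_mem _ c.2 hxr) (Submodule.smul_mem _ c.1 hyr)
      using 1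
    funext f
    simp [formA, τ, mul_comm]) hs
  obtain ⟨hac, hbc⟩ := even_of_sum_labels (hL.sum_eq_zero isForm_formA isNondegenerate_formA hr)
  obtain ⟨pac, pbc, pab⟩ := hL.labelCount_pos_or isForm_formA hr
  have ba := hL.labelCount_bipartite h (p := (1, 0)) (p' := (0, 1)) (p'' := (1, 1)) rfl rfl
    (by decide) (by decide) (by decide)
  have bb := hL.labelCount_bipartite h (p := (0, 1)) (p' := (1, 0)) (p'' := (1, 1)) rfl rfl
    (by decide) (by decide) (by decide)
  have bc := hL.labelCount_bipartite h (p := (1, 1)) (p' := (1, 0)) (p'' := (0, 1)) rfl rfl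
    (by decide) (by decide) (by decide)
  have oab := hS.labelCount_ne_one hL (c := (1, 1)) (p := (1, 0)) (p' := (0, 1))
    (by unfold formA; decide) (by decide) rfl
  have oac := hS.labelCount_ne_one hL (c := (0, 1)) (p := (1, 0)) (p' := (1, 1))
    (by unfold formA; decide) (by decide) rfl
  have obc := hS.labelCount_ne_one hL (c := (1, 0)) (p := (0, 1)) (p' := (1, 1))
    (by unfold formA; decide) (by decide) rfl
  refine ⟨labelSubgraph isForm_formA hL, ?_, h.twist_eq_signed _ _ fun _ _ => Iff.rfl⟩
  have mem := @labelSubgraph_mem_torusFamily _ _ _ _ _ _ _ hL hS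
  rw [Nat.even_iff] at hac hbc
  rcases torus_counts hac hbc pac pbc pab ba bb bc oab oac obc with ⟨ha, hb, hc⟩ | ⟨h2, h3, h0⟩ |
    ⟨h2, h3, h0⟩ | ⟨h2, h3, h0⟩ | ⟨h2, h3, h0⟩ | ⟨h2, h3, h0⟩ | ⟨h2, h3, h0⟩
  · obtain ⟨e, -⟩ := exists_iso_labelSubgraph isForm_formA hL (σ := labelOct)
      (fun u v _ => adj_oct_iff u v) (by decide) (forall_label_iff.2
        ⟨ha.trans (by decide), hb.trans (by decide), hc.trans (by decide)⟩)
    exact Or.inl ⟨e⟩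
  all_goals
    refine mem ?_ ?_ ?_ ?_ ?_ ?_ h2 h0 h3 (by rw [Nat.even_iff]; omega) <;> decide

theorem exists_klein (h : ρ.IsPlaneCubic) (hs : (ρ.signed l).IsStrong)
    (hl : (ρ.signed l).OnKleinBottle) : ∃ H ∈ kleinFamily ρ.dual, ρ.twist H = ρ.signed l := by
  have hr : (ρ.lap l).rank = 2 := by
    have := hl.2
    rw [h.eulerChar_signed] at this
    omega
  obtain ⟨x, y, hxy, hxr, hyr⟩ := exists_of_rank_two (ρ.lap_isSymm l) hr
    (fun hd => hl.1 ((h.orientable_signed l).2 hd))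
  let τ : ρ.untwisted.Face → ZMod 2 × ZMod 2 := fun f => (x f, y f)
  have hL : ρ.Labels formN l τ := fun f g => by rw [hxy]; rfl
  have hS : ρ.NoAdjacentPair formN τ := Labels.noAdjacentPair (l := l) h (fun c => by
    convert Submodule.add_mem _ (Submodule.smul_mem _ c.1 hxr) (Submodule.smul_mem _ c.2 hyr)
      using 1
    funext f
    simp [formN, τ, mul_comm]) hs
  obtain ⟨hac, hbc⟩ := even_of_sum_labels (hL.sum_eq_zero isForm_formN isNondegenerate_formN hr)
  obtain ⟨pac, pbc, pab⟩ := hL.labelCount_pos_or isForm_formN hr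
  have a4 := hL.labelCount_le_four h (p := (1, 0)) rfl
  have b4 := hL.labelCount_le_four h (p := (0, 1)) rfl
  have a3 := hL.labelCount_le_three h isForm_formN (p := (1, 0)) (p' := (1, 1)) rfl rfl (by decide)
  have b3 := hL.labelCount_le_three h isForm_formN (p := (0, 1)) (p' := (1, 1)) rfl rfl (by decide)
  have bc := hL.labelCount_bipartite h (p := (1, 1)) (p' := (1, 0)) (p'' := (0, 1)) rfl rfl
    (by decide) (by decide) (by decide)
  have hca : ∀ a, formN a (1, 0) = 1 ↔ a = (1, 0) ∨ a = (1, 1) := by unfold formN; decide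
  have hcb : ∀ a, formN a (0, 1) = 1 ↔ a = (0, 1) ∨ a = (1, 1) := by unfold formN; decide
  have hcc : ∀ a, formN a (1, 1) = 1 ↔ a = (1, 0) ∨ a = (0, 1) := by unfold formN; decide
  have ac2 := hS.labelCount_ne_two hL hca (by decide) rfl
  have ac1 := hS.labelCount_ne_one hL hca (by decide) rfl
  have bc2 := hS.labelCount_ne_two hL hcb (by decide) rfl
  have bc1 := hS.labelCount_ne_one hL hcb (by decide) rfl
  have ab2 := hS.labelCount_ne_two hL hcc (by decide) rfl
  have ba2 := hS.labelCount_ne_two hL (fun a => (hcc a).trans or_comm) (by decide) rfl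
  refine ⟨labelSubgraph isForm_formN hL, ?_, h.twist_eq_signed _ _ fun _ _ => Iff.rfl⟩
  rw [Nat.even_iff] at hac hbc
  rcases klein_counts hac hbc pab pac pbc a4 b4 a3 b3 bc ac2 ac1 bc2 bc1 ab2 ba2 with
    ⟨ha, hb, hc⟩ | ⟨ha, hb, hc⟩ | ⟨ha, hb, hc⟩ | ⟨ha, hb, hc⟩
  · obtain ⟨e, -⟩ := exists_iso_labelSubgraph isForm_formN hL (σ := labelA3) adj_graphA3_iff
      (by decide) (forall_label_iff.2
        ⟨ha.trans (by decide), hb.trans (by decide), hc.trans (by decide)⟩)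
    exact Or.inl (Or.inl (Or.inl ⟨e⟩))
  · obtain ⟨e, -⟩ := exists_iso_labelSubgraph isForm_formN hL (σ := labelA5) adj_graphA5_iff
      (by decide) (forall_label_iff.2
        ⟨ha.trans (by decide), hb.trans (by decide), hc.trans (by decide)⟩)
    exact Or.inl (Or.inl (Or.inr ⟨e⟩))
  · obtain ⟨e, -⟩ := exists_iso_labelSubgraph isForm_formN hL (σ := labelA6) adj_graphA6_iff
      (by decide) (forall_label_iff.2
        ⟨ha.trans (by decide), hb.trans (by decide), hc.trans (by decide)⟩)
    exact Or.inl (Or.inr ⟨e⟩)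
  · obtain ⟨m, hm⟩ : ∃ m, labelCount τ (1, 1) = 2 * m - 1 := ⟨(labelCount τ (1, 1) + 1) / 2, by omega⟩
    obtain ⟨e, he⟩ := exists_iso_labelSubgraph isForm_formN hL (σ := labelKlein (2 * m - 1))
      adj_labelKlein_iff
      (by
        rintro (u | u)
        · revert u; simp only [labelKlein, Sum.elim_inl]; decide
        · simp only [labelKlein, Sum.elim_inr]; decide)
      (fun r hr => by
        rw [card_labelKlein]
        revert r
        refine forall_label_iff.2 ⟨?_, ?_, ?_⟩
        · rw [ha]; simp
        · rw [hb]; simp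
        · rw [hm]; simp)
    refine Or.inr ⟨m, by omega, e, fun i j => ?_, fun h2m => by omega⟩
    have hlab : ∀ i : Fin 2, labelKlein (2 * m - 1) (Sum.inl i) = (1, 0) ∨
        labelKlein (2 * m - 1) (Sum.inl i) = (0, 1) := by
      simp only [labelKlein, Sum.elim_inl]; decide
    exact hS.not_adj hcc (by decide) (by rw [ha, hb]) (by rw [he]; exact hlab i)
      (by rw [he]; exact hlab j)

end IsPlaneCubic

end RotationSystem

end StrongEmb

namespace StrongEmb

open SimpleGraph

/-! ### Members of the families have no isolated vertices -/

/-- A signature remembers only the edges of a subgraph. Without isolated vertices the edges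
determine the vertex set too, which injectivity of the correspondence needs. -/
theorem exists_adj_of_iso {W : Type u} {D : SimpleGraph W} {U : Type} {K : SimpleGraph U}
    {H : D.Subgraph} (e : H.coe ≃g K) (hK : ∀ u, ∃ v, K.Adj u v) {f : W} (hf : f ∈ H.verts) :
    ∃ g, H.Adj f g := by
  obtain ⟨v, hv⟩ := hK (e ⟨f, hf⟩)
  refine ⟨e.symm v, ?_⟩
  have h1 := e.symm.map_adj_iff.2 hv
  rwa [RelIso.symm_apply_apply] at h1

theorem exists_adj_completeBipartiteGraph {n : ℕ} (hn : 0 < n) (u : Fin 2 ⊕ Fin n) :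
    ∃ v, (completeBipartiteGraph (Fin 2) (Fin n)).Adj u v := by
  rcases u with u | u
  · exact ⟨Sum.inr ⟨0, hn⟩, by simp⟩
  · exact ⟨Sum.inl 0, by simp⟩

section Families

variable {W : Type u} {D : SimpleGraph W} {H : D.Subgraph} {f : W}

theorem exists_adj_of_mem_projectiveFamily (hH : H ∈ projectiveFamily D) (hf : f ∈ H.verts) :
    ∃ g, H.Adj f g := by
  obtain ⟨e⟩ := hH
  exact exists_adj_of_iso e (by simp only [top_adj]; decide) hf

theorem exists_adj_of_mem_torusFamily (hH : H ∈ torusFamily D) (hf : f ∈ H.verts) :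
    ∃ g, H.Adj f g := by
  rcases hH with ⟨⟨e⟩⟩ | ⟨m, hm, e, -⟩
  · exact exists_adj_of_iso e (by simp only [adj_oct_iff, formA]; decide) hf
  · exact exists_adj_of_iso e (exists_adj_completeBipartiteGraph (by omega)) hf

theorem exists_adj_of_mem_kleinFamily (hH : H ∈ kleinFamily D) (hf : f ∈ H.verts) :
    ∃ g, H.Adj f g := by
  rcases hH with ((⟨⟨e⟩⟩ | ⟨⟨e⟩⟩) | ⟨⟨e⟩⟩) | ⟨m, hm, e, -⟩
  · have h1 : ∀ u, ∃ v, u ≠ v ∧ formN (labelA3 u) (labelA3 v) = 1 := by unfold formN; decide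
    exact exists_adj_of_iso e (fun u => (h1 u).imp fun v hv => (adj_graphA3_iff u v hv.1).2 hv.2) hf
  · have h1 : ∀ u, ∃ v, u ≠ v ∧ formN (labelA5 u) (labelA5 v) = 1 := by unfold formN; decide
    exact exists_adj_of_iso e (fun u => (h1 u).imp fun v hv => (adj_graphA5_iff u v hv.1).2 hv.2) hf
  · have h1 : ∀ u, ∃ v, u ≠ v ∧ formN (labelA6 u) (labelA6 v) = 1 := by unfold formN; decide
    exact exists_adj_of_iso e (fun u => (h1 u).imp fun v hv => (adj_graphA6_iff u v hv.1).2 hv.2) hf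
  · exact exists_adj_of_iso e (exists_adj_completeBipartiteGraph (by omega)) hf

end Families

theorem isoClass_eq_iff {V : Type u} {G : SimpleGraph V} {S : Embedding G → Prop}
    {E E' : StrongOn S} : Quotient.mk (isoSetoid S) E = Quotient.mk (isoSetoid S) E' ↔
      E.1.Isomorphic E'.1 :=
  Quotient.eq (r := isoSetoid S)

theorem orbit_eq_iff {W : Type u} {D : SimpleGraph W} {F : Set D.Subgraph} {H H' : F} :
    Quotient.mk (orbitSetoid F) H = Quotient.mk (orbitSetoid F) H' ↔
      ∃ φ : D ≃g D, H.1.map φ.toHom = H'.1 :=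
  Quotient.eq (r := orbitSetoid F)

namespace RotationSystem

/-! ### The correspondence -/

theorem transports_twist {V : Type u} {G : SimpleGraph V} {ρ : RotationSystem G} {φ : G ≃g G}
    {ψ : ρ.dual ≃g ρ.dual} {s : ℤˣ}
    (hT : Embedding.Transports φ (fun _ => s) ρ.untwisted ρ.untwisted) (hψ : ρ.Induces φ ψ)
    (H : ρ.dual.Subgraph) :
    Embedding.Transports φ (fun _ => s) (ρ.twist H) (ρ.twist (H.map ψ.toHom)) := by
  have hH : ∀ f g, (H.map ψ.toHom).Adj (ψ f) (ψ g) ↔ H.Adj f g := by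
    intro f g
    constructor
    · rintro ⟨f', g', hfg, h1, h2⟩
      have h1 : f' = f := ψ.injective h1
      have h2 : g' = g := ψ.injective h2
      rwa [h1, h2] at hfg
    · exact fun hfg => ⟨f, g, hfg, rfl, rfl⟩
  refine ⟨fun d => hT.perm d, fun d => ?_⟩
  have key : (ρ.twist (H.map ψ.toHom)).sgn (dartEquiv φ d) = -1 ↔ (ρ.twist H).sgn d = -1 := by
    rw [twist_sgn, twist_sgn]
    rcases hψ d with ⟨h1, h2⟩ | ⟨h1, h2⟩
    · rw [h1, h2, hH]
    · rw [h1, h2, hH, H.adj_comm]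
  rw [Int.units_mul_self, mul_one]
  rcases Int.units_eq_one_or ((ρ.twist (H.map ψ.toHom)).sgn (dartEquiv φ d)) with h3 | h3 <;>
    rcases Int.units_eq_one_or ((ρ.twist H).sgn d) with h4 | h4
  · rw [h3, h4]
  · exact (key.2 h4).trans h4.symm
  · exact h3.trans (key.1 h3).symm
  · rw [h3, h4]

variable {V : Type u} [Fintype V] {G : SimpleGraph V} [DecidableRel G.Adj] {ρ : RotationSystem G}

namespace IsPlaneCubic

theorem isomorphic_twist_map (h : ρ.IsPlaneCubic) (ψ : ρ.dual ≃g ρ.dual) (H : ρ.dual.Subgraph) :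
    (ρ.twist H).Isomorphic (ρ.twist (H.map ψ.toHom)) := by
  obtain ⟨φ, hφ⟩ := h.exists_iso_of_dual ψ
  obtain ⟨s, hT⟩ := h.exists_transports_untwisted φ
  exact ⟨φ, (transports_twist hT hφ H).facialCycles_eq⟩

/-- The automorphism `φ` induces `ψ` on the faces and carries the first embedding to the one defined
by the image of `H`. This one and the embedding defined by `H'` have the same rotation and the same
facial cycles, hence the same twisted edges. -/
theorem exists_map_eq_of_isomorphic (h : ρ.IsPlaneCubic) {H H' : ρ.dual.Subgraph}
    (hH : ∀ f ∈ H.verts, ∃ g, H.Adj f g) (hH' : ∀ f ∈ H'.verts, ∃ g, H'.Adj f g)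
    (hs : (ρ.twist H').IsStrong) (hi : (ρ.twist H).Isomorphic (ρ.twist H')) :
    ∃ ψ : ρ.dual ≃g ρ.dual, H.map ψ.toHom = H' := by
  obtain ⟨φ, hφ⟩ := hi
  obtain ⟨s, hT⟩ := h.exists_transports_untwisted φ
  obtain ⟨ψ, hψ⟩ := exists_dual_iso φ hT
  refine ⟨ψ, ?_⟩
  have hsgn : ∀ d, (ρ.twist H').sgn d = (ρ.twist (H.map ψ.toHom)).sgn d :=
    sgn_eq_of_facialCycles_eq h.cubic ρ (l := (ρ.twist H').sign)
      (m := (ρ.twist (H.map ψ.toHom)).sign) hs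
      (hφ.symm.trans (transports_twist hT hψ H).facialCycles_eq)
  have hadj : ∀ f g, (H.map ψ.toHom).Adj f g ↔ H'.Adj f g := by
    have key : ∀ d, (H.map ψ.toHom).Adj (ρ.left d) (ρ.left d.symm) ↔
        H'.Adj (ρ.left d) (ρ.left d.symm) := fun d => by
      rw [← twist_sgn, ← twist_sgn, hsgn]
    intro f g
    constructor
    · intro hfg
      obtain ⟨-, d, rfl, rfl⟩ := ρ.dual_adj_iff.1 hfg.adj_sub
      exact (key d).1 hfg
    · intro hfg
      obtain ⟨-, d, rfl, rfl⟩ := ρ.dual_adj_iff.1 hfg.adj_sub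
      exact (key d).2 hfg
  refine Subgraph.ext (Set.ext fun f => ⟨?_, fun hf => ?_⟩) (by
    funext f g; exact propext (hadj f g))
  · rintro ⟨f, hf, rfl⟩
    obtain ⟨g, hg⟩ := hH f hf
    exact ((hadj _ _).1 ⟨f, g, hg, rfl, rfl⟩).fst_mem
  · obtain ⟨g, hg⟩ := hH' f hf
    exact ((hadj f g).2 hg).fst_mem

/-- The identity automorphism is used: only local orientations are reversed, so the facial cycles
stay the same. -/
theorem exists_signed_isomorphic (h : ρ.IsPlaneCubic) (E : Embedding G) :
    ∃ l, ((ρ.signed l).IsStrong ↔ E.IsStrong) ∧ ((ρ.signed l).Orientable ↔ E.Orientable) ∧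
      (ρ.signed l).eulerChar = E.eulerChar ∧ (ρ.signed l).Isomorphic E := by
  obtain ⟨l, ε, hT⟩ := exists_transports h.cubic ρ Iso.refl E
  exact ⟨l, hT.isStrong_iff.symm, hT.orientable_iff.symm, hT.eulerChar_eq.symm, _,
    hT.facialCycles_eq⟩

/-- The part common to the three surfaces. Orbits map to classes because automorphisms of the dual
graph lift, injectivity is `exists_map_eq_of_isomorphic`, and surjectivity follows by normalising
the rotation to `ρ` and applying `hof`. The hypothesis `hS` says that `S` depends only on the
surface, so that it survives normalisation. -/
theorem correspondence (h : ρ.IsPlaneCubic) {F : Set ρ.dual.Subgraph} {S : Embedding G → Prop}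
    (hS : ∀ E E' : Embedding G, (E.Orientable ↔ E'.Orientable) → E.eulerChar = E'.eulerChar →
      (S E ↔ S E'))
    (hF : ∀ H ∈ F, ∀ f ∈ H.verts, ∃ g, H.Adj f g)
    (hto : ∀ H ∈ F, (ρ.twist H).IsStrong ∧ S (ρ.twist H))
    (hof : ∀ l, (ρ.signed l).IsStrong → S (ρ.signed l) → ∃ H ∈ F, ρ.twist H = ρ.signed l) :
    ρ.Correspondence F S := by
  let Φ : Orbit F → IsoClass S := Quotient.lift
    (fun H : F => Quotient.mk (isoSetoid S) ⟨ρ.twist H.1, hto H.1 H.2⟩) (by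
      rintro ⟨H, hH⟩ ⟨H', hH'⟩ ⟨ψ, hψ⟩
      have hψ : H.map ψ.toHom = H' := hψ
      subst hψ
      exact isoClass_eq_iff.2 (h.isomorphic_twist_map ψ H))
  have hΦ : ∀ H : F, Φ (Quotient.mk (orbitSetoid F) H) =
      Quotient.mk (isoSetoid S) ⟨ρ.twist H.1, hto H.1 H.2⟩ := fun _ => rfl
  clear_value Φ
  have hinj : Function.Injective Φ := by
    intro x y hxy
    obtain ⟨H, rfl⟩ := Quotient.exists_rep x
    obtain ⟨H', rfl⟩ := Quotient.exists_rep y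
    rw [hΦ, hΦ] at hxy
    have hi := isoClass_eq_iff.1 hxy
    exact orbit_eq_iff.2 (h.exists_map_eq_of_isomorphic (hF _ H.2) (hF _ H'.2) (hto _ H'.2).1 hi)
  have hsurj : Function.Surjective Φ := by
    intro y
    obtain ⟨E, rfl⟩ := Quotient.exists_rep y
    obtain ⟨l, h1, h2, h3, h4⟩ := h.exists_signed_isomorphic E.1
    obtain ⟨H, hH, he⟩ := hof l (h1.2 E.2.1) ((hS _ _ h2 h3).2 E.2.2)
    rw [← he] at h4
    exact ⟨Quotient.mk (orbitSetoid F) ⟨H, hH⟩, (hΦ _).trans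
      (isoClass_eq_iff.2 h4)⟩
  exact ⟨fun H => hto H.1 H.2, Equiv.ofBijective Φ ⟨hinj, hsurj⟩, hΦ⟩

end IsPlaneCubic

end RotationSystem

end StrongEmb

/-! ### The three surfaces. -/

theorem mainTheorem3 {V : Type*} [Fintype V] (G : SimpleGraph V) [DecidableRel G.Adj]
    (h3 : StrongEmb.ThreeConnected G) (hcubic : G.IsRegularOfDegree 3)
    (ρ : StrongEmb.RotationSystem G) (hρ : ρ.IsPlanar) :
    ρ.Correspondence (StrongEmb.projectiveFamily ρ.dual)
        StrongEmb.Embedding.OnProjectivePlane ∧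
      ρ.Correspondence (StrongEmb.torusFamily ρ.dual)
        StrongEmb.Embedding.OnTorus ∧
      ρ.Correspondence (StrongEmb.kleinFamily ρ.dual)
        StrongEmb.Embedding.OnKleinBottle := by
  have h : ρ.IsPlaneCubic := ⟨h3, hcubic, hρ⟩
  refine ⟨?_, ?_, ?_⟩
  · exact h.correspondence (fun E E' ho hc => and_congr (not_congr ho) (by rw [hc]))
      (fun H hH f hf => StrongEmb.exists_adj_of_mem_projectiveFamily hH hf)
      (fun H hH => h.twist_projective hH) (fun l hs hl => h.exists_projective hs hl)
  · exact h.correspondence (fun E E' ho hc => and_congr ho (by rw [hc]))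
      (fun H hH f hf => StrongEmb.exists_adj_of_mem_torusFamily hH hf)
      (fun H hH => h.twist_torus hH) (fun l hs hl => h.exists_torus hs hl)
  · exact h.correspondence (fun E E' ho hc => and_congr (not_congr ho) (by rw [hc]))
      (fun H hH f hf => StrongEmb.exists_adj_of_mem_kleinFamily hH hf)
      (fun H hH => h.twist_klein hH) (fun l hs hl => h.exists_klein hs hl)
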